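/- Let $\mathbb{M}^2=(\mathbb{R}^2,\|\cdot\|)$ be a strictly convex normed plane, and write $B(x,\rho)$ and $S(x,\rho)$ for the closed disc and the circle with center $x$ and radius $\rho$. Let $K\subset\mathbb{M}^2$ be finite, $c\in K$ and $r>1$. For $\theta\in\mathbb{R}$ let $p_\theta$ be the point of $S(c,r)$ for which $p_\theta-c$ has polar angle $\theta$ with respect to some fixed linear coordinates of the plane. Fix $\theta_1$ and consider the $90^\circ$ sweep $\theta\in[\theta_1,\theta_1+90^\circ)$. For $\theta$ in it let $$A_\theta=\{q\in K:\ q\notin B(p_\theta,r)\ \text{and}\ q\in B(p_{\theta'},r)\text{ for some }\theta'\in[\theta_1,\theta)\}.$$ Let $p_1,\dots,p_m$ be the distinct points that belong to $A_\theta$ for some $\theta$ of the sweep, listed in the order in which they are added to $A_\theta$ (points that are added simultaneously may be listed in any order). Let $1\le j\le m$ be such that $\mathrm{bi}(\{p_1,\dots,p_j\},1)=\bigcap_{i=1}^{j}B(p_i,1)$ has non-empty interior. Then the boundary of $\mathrm{bi}(\{p_1,\dots,p_j\},1)$ is a simple closed curve that is composed of finitely many non-degenerate arcs, each of which lies on one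 of the circles $S(p_i,1)$, $1\le i\le j$. Take these arcs maximal, so that neighbouring arcs (if there is more than one arc) lie on circles with different centers, and label an arc with $i$ if it lies on $S(p_i,1)$. Then the labels, in the order of the arcs along the boundary, form a circular sequence with no duplication, with exactly one local maximum and with exactly one local minimum. (The single term of a sequence of length one counts as both.) -/

import Mathlib

open Set Metric

noncomputable section

/-- The `ρ`-ball intersection of `K`: the intersection of all discs of radius `ρ` whose centers
are in `K`. -/
def ballInter {E : Type*} [NormedAddCommGroup E] (K : Set E) (ρ : ℝ) : Set E :=
  ⋂ x ∈ K, closedBall x ρ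

/-- The direction of polar angle `θ` (in radians) in the coordinates given by the basis `b`. -/
def direction {E : Type*} [NormedAddCommGroup E] [NormedSpace ℝ E]
    (b : Module.Basis (Fin 2) ℝ E) (θ : ℝ) : E :=
  Real.cos θ • b 0 + Real.sin θ • b 1

/-- The point of polar angle `θ` on the circle with center `c` and radius `r`. -/
def circlePoint {E : Type*} [NormedAddCommGroup E] [NormedSpace ℝ E]
    (b : Module.Basis (Fin 2) ℝ E) (c : E) (r θ : ℝ) : E :=
  c + (r / ‖direction b θ‖) • direction b θ

/-- The set `A_θ` of the sweep along the circle with center `c` and radius `r` that starts at the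
angle `θ₁`: the points of `K` that do not belong to the disc of radius `r` centered at the current
point, but belong to the disc of radius `r` centered at some previous point of the sweep. -/
def sweepAdded {E : Type*} [NormedAddCommGroup E] [NormedSpace ℝ E]
    (b : Module.Basis (Fin 2) ℝ E) (K : Set E) (c : E) (r θ₁ θ : ℝ) : Set E :=
  {q | q ∈ K ∧ q ∉ closedBall (circlePoint b c r θ) r ∧
    ∃ θ' ∈ Ico θ₁ θ, q ∈ closedBall (circlePoint b c r θ') r}

/-- `p` lists, without repetition, exactly the points that are added to `A_θ` while `θ` runs
through the `90°` sweep `[θ₁, θ₁ + π/2)`, in order of addition: an earlier point of the list is in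
`A` no later than a later one (points added simultaneously may be listed in any order). -/
structure IsAdditionOrder {E : Type*} [NormedAddCommGroup E] [NormedSpace ℝ E]
    (b : Module.Basis (Fin 2) ℝ E) (K : Set E) (c : E) (r θ₁ : ℝ) {m : ℕ} (p : Fin m → E) :
    Prop where
  injective : Function.Injective p
  range_eq : range p =
    {q | ∃ θ ∈ Ico θ₁ (θ₁ + Real.pi / 2), q ∈ sweepAdded b K c r θ₁ θ}
  ordered : ∀ i j : Fin m, i < j → ∀ θ ∈ Ico θ₁ (θ₁ + Real.pi / 2),
    p j ∈ sweepAdded b K c r θ₁ θ → ∃ θ' ∈ Icc θ₁ θ, p i ∈ sweepAdded b K c r θ₁ θ'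

/-- `γ` runs once around the boundary of the `ρ`-ball intersection of the points `q 0, q 1, …`
(as a simple closed curve, of period `n + 1`), and `γ '' [i, i + 1]`, `i = 0, …, n`, are the
successive arcs of this boundary, `label` being the circular sequence of their labels: the `i`-th
arc lies on the circle with center `q (label i)`. The arcs are maximal: if there is more than one,
then neighbouring arcs have different labels. (Addition in `Fin (n + 1)` is cyclic.) -/
structure IsBoundaryArcCycle {E : Type*} [NormedAddCommGroup E] {j : ℕ} (q : Fin j → E) (ρ : ℝ)
    (n : ℕ) (γ : ℝ → E) (label : Fin (n + 1) → Fin j) : Prop where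
  continuous : Continuous γ
  periodic : Function.Periodic γ ((n : ℝ) + 1)
  injOn : InjOn γ (Ico 0 ((n : ℝ) + 1))
  range_eq : range γ = frontier (ballInter (range q) ρ)
  arc : ∀ i : Fin (n + 1), ∀ t ∈ Icc ((i : ℕ) : ℝ) ((i : ℕ) + 1), γ t ∈ sphere (q (label i)) ρ
  label_ne : 0 < n → ∀ i : Fin (n + 1), label i ≠ label (i + 1)

/-- Position `i` is a local maximum of the circular sequence `a 0, …, a n`. -/
def IsCyclicLocalMax {n : ℕ} {α : Type*} [LinearOrder α] (a : Fin (n + 1) → α)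
    (i : Fin (n + 1)) : Prop :=
  a (i - 1) ≤ a i ∧ a (i + 1) ≤ a i

/-- Position `i` is a local minimum of the circular sequence `a 0, …, a n`. -/
def IsCyclicLocalMin {n : ℕ} {α : Type*} [LinearOrder α] (a : Fin (n + 1) → α)
    (i : Fin (n + 1)) : Prop :=
  a i ≤ a (i - 1) ∧ a i ≤ a (i + 1)

end

/-! Translate `c` to the origin and let the center of a disc of radius `r` move counterclockwise
along the circle of radius `r` about the origin. Each listed point leaves this disc at some angle,
and the order of the list makes the exit angles monotone (`IsAdditionOrder.exists_exit_angles`).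

That the boundary is a cycle of arcs is soft. A bounded convex set with interior has a radially
parametrized frontier, two different circles of equal radius meet in finitely many points, and so
the preimages of the circles cut a period into finitely many intervals
(`exists_isBoundaryArcCycle`).

The geometry rests on one principle for two discs of equal radius, `disc_sep`: if the first contains
`a` and `a'` but not `b`, and the second, with center `y`, contains `b` but not `a` and `a'`, then
`[a, a']` misses `[y, b]` (up to conventions about boundary points). It follows from the triangle
inequality, with strict convexity for equality. As a consequence no disc separates one diagonal of a
convex quadrilateral from the other if other discs cut off `b` and `b'` one at a time from `a` and
`a'` (`Crossing.no_separating_disc`). A label that occurs twice would give such a configuration on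
the boundary itself, so the labels are distinct.

For unimodality, a second local maximum would produce four arcs, in cyclic order, whose labels
alternate between low and high. Each arc has a point at distance 1 from its own center and less than
1 from the others. Norming functionals carry the cyclic order of these four points over to the four
centers (`crossing_centers`), and a homothety turns the unit discs into discs of radius `r`
(`norm_sub_expand`). This leaves four centers with crossing diagonals `[a, a']` and `[b, b']`, each
cut off from the other three by an `r`-disc, where `a` and `a'` exit no later than `b`, and `b` no
later than `b'`.

`SweepQuad.false` excludes this by looking at the position `ub` at which `b` exits. The points `a`
and `a'` are not inside the disc about `ub`, and `b` is on its circle. If `b'` is in the disc, then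
the disc separates the diagonals. Otherwise `b'` is strictly to the left of the line through `0` and
`ub`, while `b` is weakly to the right, so `[b, b']` meets this line in some `k • ub`. The cases `k
≤ 0` and `k > 0` are refuted by further uses of `disc_sep`. The extra tool is that some of the
cutting discs must contain the origin (`norm_lt_of_segment_meets_ray`), and hence whole triangles
with a vertex there. -/

section area

/-! ### Determinants and orientation in the plane. -/

variable {E : Type*} [NormedAddCommGroup E] [NormedSpace ℝ E]

/-- The determinant of `u` and `v` in the coordinates given by the basis `e`. -/
noncomputable def area (e : Module.Basis (Fin 2) ℝ E) (u v : E) : ℝ :=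
  e.repr u 0 * e.repr v 1 - e.repr u 1 * e.repr v 0

variable (e : Module.Basis (Fin 2) ℝ E)

@[simp] lemma area_add_left (u v w : E) : area e (u + v) w = area e u w + area e v w := by
  simp [area]; ring

@[simp] lemma area_add_right (u v w : E) : area e u (v + w) = area e u v + area e u w := by
  simp [area]; ring

@[simp] lemma area_sub_left (u v w : E) : area e (u - v) w = area e u w - area e v w := by
  simp [area]; ring

@[simp] lemma area_sub_right (u v w : E) : area e u (v - w) = area e u v - area e u w := by
  simp [area]; ring

@[simp] lemma area_smul_left (c : ℝ) (u v : E) : area e (c • u) v = c * area e u v := by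
  simp [area]; ring

@[simp] lemma area_smul_right (c : ℝ) (u v : E) : area e u (c • v) = c * area e u v := by
  simp [area]; ring

@[simp] lemma area_neg_left (u v : E) : area e (-u) v = -area e u v := by
  simp [area]; ring

@[simp] lemma area_neg_right (u v : E) : area e u (-v) = -area e u v := by
  simp [area]; ring

@[simp] lemma area_zero_left (v : E) : area e 0 v = 0 := by simp [area]

@[simp] lemma area_zero_right (v : E) : area e v 0 = 0 := by simp [area]

@[simp] lemma area_self (u : E) : area e u u = 0 := by simp [area]; ring

lemma area_swap (u v : E) : area e u v = -area e v u := by simp [area]; ring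

lemma area_smul_vec (u v w : E) : area e u v • w = area e w v • u + area e u w • v := by
  apply e.ext_elem
  intro i
  fin_cases i <;> simp [area] <;> ring

/-- The three-term Plücker relation. It serves to deduce the sign of one determinant of four vectors
from the signs of the others. -/
lemma area_plucker (p q r s : E) :
    area e p q * area e r s - area e p r * area e q s + area e p s * area e q r = 0 := by
  simp [area]; ring

lemma continuous_area [FiniteDimensional ℝ E] : Continuous fun p : E × E => area e p.1 p.2 := by
  have h : ∀ i, Continuous fun u : E => e.repr u i := fun i =>
    (e.coord i).continuous_of_finiteDimensional
  have h0 := h 0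
  have h1 := h 1
  unfold area
  fun_prop

variable {e}

lemma exists_combination_of_area_ne_zero {u v : E} (h : area e u v ≠ 0) (w : E) :
    w = (area e w v / area e u v) • u + (area e u w / area e u v) • v := by
  have := area_smul_vec e u v w
  rw [div_eq_inv_mul, div_eq_inv_mul, mul_smul, mul_smul, ← smul_add, ← this, smul_smul,
    inv_mul_cancel₀ h, one_smul]

/-- Vectors of vanishing area are linearly dependent. -/
lemma exists_smul_of_area_eq_zero {u v : E} (hu : u ≠ 0) (h : area e u v = 0) :
    ∃ c : ℝ, v = c • u := by
  by_cases h0 : e.repr u 0 = 0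
  · have h1 : e.repr u 1 ≠ 0 := by
      intro h1
      apply hu
      apply e.ext_elem
      intro i
      fin_cases i <;> simp [h0, h1]
    refine ⟨e.repr v 1 / e.repr u 1, ?_⟩
    have h2 : e.repr v 0 = 0 := by
      simp [area, h0] at h
      tauto
    apply e.ext_elem
    intro i
    fin_cases i <;> simp [h0, h1, h2]
  · refine ⟨e.repr v 0 / e.repr u 0, ?_⟩
    apply e.ext_elem
    intro i
    unfold area at h
    fin_cases i
    · simp [h0]
    · simp
      field_simp
      linarith

end area

/-! ### Separation of discs of equal radius. -/

section discs

variable {E : Type*} [NormedAddCommGroup E] [NormedSpace ℝ E]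

lemma mem_segment_iff_exists {x y z : E} :
    z ∈ segment ℝ x y ↔ ∃ s : ℝ, 0 ≤ s ∧ s ≤ 1 ∧ z = (1 - s) • x + s • y := by
  constructor
  · rintro ⟨p, q, hp, hq, hpq, rfl⟩
    exact ⟨q, hq, by linarith, by rw [← hpq]; congr 2; ring⟩
  · rintro ⟨s, h0, h1, rfl⟩
    exact ⟨1 - s, s, by linarith, h0, by ring, rfl⟩

lemma norm_combination_le (x y : E) {s R : ℝ} (h0 : 0 ≤ s) (h1 : s ≤ 1) (hx : ‖x‖ ≤ R)
    (hy : ‖y‖ ≤ R) : ‖(1 - s) • x + s • y‖ ≤ R := by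
  calc ‖(1 - s) • x + s • y‖ ≤ ‖(1 - s) • x‖ + ‖s • y‖ := norm_add_le _ _
    _ = (1 - s) * ‖x‖ + s * ‖y‖ := by
      rw [norm_smul, norm_smul, Real.norm_of_nonneg h0, Real.norm_of_nonneg (by linarith)]
    _ ≤ R := by nlinarith

lemma norm_combination_sub_le (x y v : E) {s R : ℝ} (h0 : 0 ≤ s) (h1 : s ≤ 1)
    (hx : ‖x - v‖ ≤ R) (hy : ‖y - v‖ ≤ R) : ‖((1 - s) • x + s • y) - v‖ ≤ R := by
  have : ((1 - s) • x + s • y) - v = (1 - s) • (x - v) + s • (y - v) := by module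
  rw [this]
  exact norm_combination_le _ _ h0 h1 hx hy

/-- The main case of the separation of two discs: `v` is on the side of `A` of the line through `0`
and `u = p • A + q • A'`. -/
lemma disc_sep_aux [StrictConvexSpace ℝ E] {A A' u v : E} {p q m n r : ℝ}
    (hr : 0 < r) (hp : 0 < p) (hq : 0 ≤ q) (hpq : 1 ≤ p + q)
    (hu : u = p • A + q • A') (hv : v = m • A + n • A') (hside : p * n ≤ q * m)
    (hA : r ≤ ‖A‖) (hA' : r ≤ ‖A'‖) (hAv : ‖A - v‖ ≤ r) (hAv' : ‖A' - v‖ ≤ r)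
    (hur : ‖u‖ ≤ r) (huv : r ≤ ‖u - v‖)
    (hstrict : (‖A - v‖ < r ∧ ‖A' - v‖ < r) ∨ r < ‖u - v‖) (hdep : A ≠ -A') : False := by
  -- Here `v` is in the cone opposite to that of `A` and `A'`. Expressing `A` and `A'` by `A - v`
  -- and `A' - v`, the triangle inequality yields `n ≤ m` and `m ≤ n`, so only `m = n` needs more
  -- care.
  by_cases h3 : m ≤ 0 ∧ n ≤ 0
  · obtain ⟨hm, hn⟩ := h3
    set P := A - v with hP
    set Q := A' - v with hQ
    have hd : 0 < 1 - m - n := by linarith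
    have e1 : (1 - m - n) • A = (1 - n) • P - (-n) • Q := by
      rw [hP, hQ, hv]; module
    have e2 : (1 - m - n) • A' = (1 - m) • Q - (-m) • P := by
      rw [hP, hQ, hv]; module
    have b1 : (1 - m - n) * ‖A‖ ≤ (1 - n) * ‖P‖ + (-n) * ‖Q‖ := by
      have := norm_sub_le ((1 - n) • P) ((-n) • Q)
      rw [← e1, norm_smul, norm_smul, norm_smul, Real.norm_of_nonneg hd.le,
        Real.norm_of_nonneg (by linarith : 0 ≤ 1 - n), Real.norm_of_nonneg (by linarith : 0 ≤ -n)]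
        at this
      exact this
    have b2 : (1 - m - n) * ‖A'‖ ≤ (1 - m) * ‖Q‖ + (-m) * ‖P‖ := by
      have := norm_sub_le ((1 - m) • Q) ((-m) • P)
      rw [← e2, norm_smul, norm_smul, norm_smul, Real.norm_of_nonneg hd.le,
        Real.norm_of_nonneg (by linarith : 0 ≤ 1 - m), Real.norm_of_nonneg (by linarith : 0 ≤ -m)]
        at this
      exact this
    rcases lt_trichotomy m n with h | h | h
    · nlinarith
    · subst h
      rcases hstrict with hs | hs
      · nlinarith
      rcases hm.eq_or_lt with h0 | h0
      · subst h0
        have : v = 0 := by rw [hv]; simp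
        rw [this, sub_zero] at hs
        linarith
      have hPQ : P ≠ -Q := by
        intro h
        have h1 : (1 - m - m) • (A + A') = 0 := by
          rw [smul_add, e1, e2, h]; module
        rcases smul_eq_zero.1 h1 with h2 | h2
        · linarith
        · exact hdep (eq_neg_of_add_eq_zero_left h2)
      -- `A` is a proper convex combination of the points `P` and `-Q` of the `r`-disc about `0`, so
      -- strict convexity puts it in the interior.
      have h5 := combo_mem_ball_of_ne (x := P) (y := -Q) (z := 0) (r := r)
        (a := (1 - m) / (1 - m - m)) (b := (-m) / (1 - m - m)) (by simpa using hAv)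
        (by simpa using hAv') hPQ (by apply div_pos <;> linarith) (by apply div_pos <;> linarith)
        (by field_simp; ring)
      have h6 : ((1 - m) / (1 - m - m)) • P + ((-m) / (1 - m - m)) • -Q = A := by
        have : A = (1 - m - m)⁻¹ • ((1 - m) • P - (-m) • Q) := by
          rw [← e1, smul_smul, inv_mul_cancel₀ hd.ne', one_smul]
        rw [this, div_eq_inv_mul, div_eq_inv_mul]
        module
      rw [h6, mem_ball_zero_iff] at h5
      linarith
    · nlinarith
  · have hm : 0 < m := by
      by_contra hm
      push Not at hm
      have hn : 0 < n := by
        by_contra hn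
        exact h3 ⟨hm, by linarith⟩
      nlinarith [mul_pos hp hn, mul_nonneg hq (neg_nonneg.2 hm)]
    -- The segment `[A', v]` meets the ray through `u`; solving `k • u = (1 - τ) • A' + τ • v` gives
    -- `τ = p / D` and `k = m / D`.
    set D := p + q * m - p * n with hD
    have hDp : 0 < D := by linarith
    set τ := p / D with hτ
    set k := m / D with hk
    have hτ0 : 0 ≤ τ := by positivity
    have hτ1 : τ ≤ 1 := by rw [hτ, div_le_one hDp]; linarith
    have hk0 : 0 < k := by positivity
    have hz : k • u = (1 - τ) • A' + τ • v := by
      rw [hu, hv]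
      have h1 : k * p = τ * m := by rw [hk, hτ]; ring
      have h2 : k * q = (1 - τ) + τ * n := by
        rw [hk, hτ]; field_simp; rw [hD]; ring
      calc k • (p • A + q • A') = (k * p) • A + (k * q) • A' := by module
        _ = _ := by rw [h1, h2]; module
    -- For `k ≤ 1` the segments `[0, u]` and `[A', v]` are the diagonals of a quadrilateral. Their
    -- total length, at most `2 * r`, bounds that of the opposite sides `[0, A']` and `[u, v]`,
    -- which is at least `2 * r`; `hstrict` makes one estimate strict.
    rcases le_or_gt k 1 with h1 | h1
    · have f1 : ‖A'‖ ≤ ‖A' - k • u‖ + ‖k • u‖ := by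
        simpa using norm_add_le (A' - k • u) (k • u)
      have f2 : ‖u - v‖ ≤ ‖u - k • u‖ + ‖k • u - v‖ := by
        simpa using norm_add_le (u - k • u) (k • u - v)
      have g1 : ‖A' - k • u‖ = τ * ‖A' - v‖ := by
        rw [hz, show A' - ((1 - τ) • A' + τ • v) = τ • (A' - v) by module, norm_smul,
          Real.norm_of_nonneg hτ0]
      have g2 : ‖k • u - v‖ = (1 - τ) * ‖A' - v‖ := by
        rw [hz, show ((1 - τ) • A' + τ • v) - v = (1 - τ) • (A' - v) by module, norm_smul,
          Real.norm_of_nonneg (by linarith)]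
      have g3 : ‖u - k • u‖ = (1 - k) * ‖u‖ := by
        rw [show u - k • u = (1 - k) • u by module, norm_smul,
          Real.norm_of_nonneg (by linarith)]
      have g4 : ‖k • u‖ = k * ‖u‖ := by rw [norm_smul, Real.norm_of_nonneg hk0.le]
      rcases hstrict with hs | hs
      · nlinarith [hs.2]
      · nlinarith
    · -- `u` is in the convex hull of `A`, `A'` and `v`
      set t := 1 / (p + q) with ht
      have hpq0 : 0 < p + q := by linarith
      have ht0 : 0 < t := by positivity
      have ht1 : t ≤ 1 := by rw [ht, div_le_one hpq0]; exact hpq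
      have hw : t • u = (1 - q / (p + q)) • A + (q / (p + q)) • A' := by
        rw [hu]
        have h1 : t * p = 1 - q / (p + q) := by rw [ht]; field_simp; ring
        have h2 : t * q = q / (p + q) := by rw [ht]; field_simp
        calc t • (p • A + q • A') = (t * p) • A + (t * q) • A' := by module
          _ = _ := by rw [h1, h2]
      have key : ∀ R, 0 ≤ R → ‖A - v‖ ≤ R → ‖A' - v‖ ≤ R → ‖u - v‖ ≤ R := by
        intro R hR h2 h3
        have c1 : ‖t • u - v‖ ≤ R := by
          rw [hw]
          exact norm_combination_sub_le _ _ _ (by positivity)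
            (by rw [div_le_one hpq0]; linarith) h2 h3
        have c2 : ‖k • u - v‖ ≤ R := by
          rw [hz]
          exact norm_combination_sub_le _ _ _ hτ0 hτ1 h3 (by simpa using hR)
        have hkt : 0 < k - t := by linarith
        have c3 : u = (1 - (1 - t) / (k - t)) • (t • u) + ((1 - t) / (k - t)) • (k • u) := by
          rw [smul_smul, smul_smul, ← add_smul]
          have : (1 - (1 - t) / (k - t)) * t + (1 - t) / (k - t) * k = 1 := by
            field_simp; ring
          rw [this, one_smul]
        rw [c3]
        exact norm_combination_sub_le _ _ _ (div_nonneg (by linarith) hkt.le)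
          (by rw [div_le_one hkt]; linarith) c1 c2
      rcases hstrict with hs | hs
      · have := key (max ‖A - v‖ ‖A' - v‖) (le_max_of_le_left (norm_nonneg _)) (le_max_left _ _)
          (le_max_right _ _)
        have h4 : max ‖A - v‖ ‖A' - v‖ < r := max_lt hs.1 hs.2
        linarith
      · have := key r hr.le hAv hAv'
        linarith

variable {e : Module.Basis (Fin 2) ℝ E}

/-- Separation of discs, with the center of one of them at the origin. -/
lemma disc_sep_origin [StrictConvexSpace ℝ E] {A A' u v : E} {s t r : ℝ}
    (hr : 0 < r) (hs0 : 0 ≤ s) (hs1 : s ≤ 1) (ht0 : 0 ≤ t) (ht1 : t ≤ 1)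
    (hz : t • u = (1 - s) • A + s • A')
    (hA : r ≤ ‖A‖) (hA' : r ≤ ‖A'‖) (hAv : ‖A - v‖ ≤ r) (hAv' : ‖A' - v‖ ≤ r)
    (hur : ‖u‖ ≤ r) (huv : r ≤ ‖u - v‖)
    (hstrict : (‖A - v‖ < r ∧ ‖A' - v‖ < r) ∨ r < ‖u - v‖) (hdep : area e A A' ≠ 0) : False := by
  have ht : 0 < t := by
    rcases ht0.eq_or_lt with h | h
    · exfalso
      subst h
      rw [zero_smul] at hz
      have h1 : area e A ((1 - s) • A + s • A') = 0 := by rw [← hz]; simp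
      have h2 : area e ((1 - s) • A + s • A') A' = 0 := by rw [← hz]; simp
      simp [hdep] at h1 h2
      linarith
    · exact h
  have hneg : A ≠ -A' := by
    rintro rfl
    simp at hdep
  have hneg' : A' ≠ -A := by
    rintro rfl
    simp at hdep
  have hu : u = ((1 - s) / t) • A + (s / t) • A' := by
    have : u = t⁻¹ • ((1 - s) • A + s • A') := by
      rw [← hz, smul_smul, inv_mul_cancel₀ ht.ne', one_smul]
    rw [this, div_eq_inv_mul, div_eq_inv_mul]
    module
  have hv := exists_combination_of_area_ne_zero hdep v
  set m := area e v A' / area e A A'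
  set n := area e A v / area e A A'
  have hsum : 1 ≤ (1 - s) / t + s / t := by
    rw [← add_div, le_div_iff₀ ht]; linarith
  -- If the meeting point is an end point `B` of `[A, A']`, then `‖u‖ ≤ r ≤ ‖B‖` forces `u = B`.
  have hend : ∀ B : E, ‖B - v‖ ≤ r → (‖B - v‖ < r ∨ r < ‖u - v‖) → r ≤ ‖B‖ → t • u = B →
      False := by
    intro B h1 h2 h3 h4
    have h5 : t = 1 := by
      rw [← h4, norm_smul, Real.norm_of_nonneg ht0] at h3
      nlinarith
    rw [h5, one_smul] at h4
    rw [h4] at h2 huv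
    rcases h2 with h2 | h2 <;> linarith
  rcases le_or_gt ((1 - s) / t * n) (s / t * m) with h | h
  · rcases hs1.eq_or_lt with h1 | h1
    · apply hend A' hAv' (hstrict.imp_left And.right) hA'
      rw [hz, h1]; simp
    · exact disc_sep_aux hr (div_pos (by linarith) ht) (by positivity) hsum hu hv h hA hA' hAv
        hAv' hur huv hstrict hneg
  · rcases hs0.eq_or_lt with h1 | h1
    · apply hend A hAv (hstrict.imp_left And.left) hA
      rw [hz, ← h1]; simp
    · exact disc_sep_aux hr (div_pos h1 ht) (div_nonneg (by linarith) ht0)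
        (by linarith) (hu.trans (add_comm _ _)) (hv.trans (add_comm _ _)) h.le hA' hA hAv'
        hAv hur huv (hstrict.imp_left And.symm) hneg'

/-- If `a` and `a'` belong to the disc with center `x` but not to that with center `y`, and `b`
belongs to the latter but not to the former, then the segments `[a, a']` and `[y, b]` are
disjoint. -/
lemma disc_sep (e : Module.Basis (Fin 2) ℝ E) [StrictConvexSpace ℝ E] {a a' b x y z : E} {r : ℝ}
    (hr : 0 < r) (ha : r ≤ ‖y - a‖) (ha' : r ≤ ‖y - a'‖) (hb : ‖y - b‖ ≤ r)
    (hxa : ‖x - a‖ < r) (hxa' : ‖x - a'‖ < r) (hxb : r ≤ ‖x - b‖)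
    (h1 : z ∈ segment ℝ a a') (h2 : z ∈ segment ℝ y b) : False := by
  obtain ⟨s, hs0, hs1, rfl⟩ := mem_segment_iff_exists.1 h1
  obtain ⟨t, ht0, ht1, hz⟩ := mem_segment_iff_exists.1 h2
  rw [norm_sub_rev] at ha ha' hb hxa hxa' hxb
  have hz' : t • (b - y) = (1 - s) • (a - y) + s • (a' - y) := by
    have : (1 - s) • (a - y) + s • (a' - y) = ((1 - s) • a + s • a') - y := by module
    rw [this, hz]; module
  have e1 : (a - y) - (x - y) = a - x := by abel
  have e2 : (a' - y) - (x - y) = a' - x := by abel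
  have e3 : (b - y) - (x - y) = b - x := by abel
  -- If `y`, `a`, `a'` are collinear, then either `y` is between `a` and `a'`, and these are too far
  -- apart for the disc about `x`, or `b` is itself on `[a, a']`.
  by_cases hd : area e (a - y) (a' - y) = 0
  · have hA0 : a - y ≠ 0 := by
      intro h; rw [h, norm_zero] at ha; linarith
    obtain ⟨c, hc⟩ := exists_smul_of_area_eq_zero hA0 hd
    rcases le_or_gt c 0 with h0 | h0
    · have f1 : ‖(a - y) - (a' - y)‖ = ‖a - y‖ + ‖a' - y‖ := by
        rw [hc, show (a - y) - c • (a - y) = (1 - c) • (a - y) by module, norm_smul, norm_smul,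
          Real.norm_of_nonneg (by linarith), Real.norm_of_nonpos h0]
        ring
      have f2 : ‖(a - y) - (a' - y)‖ ≤ ‖a - x‖ + ‖a' - x‖ := by
        rw [show (a - y) - (a' - y) = (a - x) - (a' - x) by abel]
        exact norm_sub_le _ _
      linarith
    · have f1 : ‖t • (b - y)‖ = (1 - s) * ‖a - y‖ + s * ‖a' - y‖ := by
        rw [hz', hc, show (1 - s) • (a - y) + s • c • (a - y) = (1 - s + s * c) • (a - y) by module,
          norm_smul, norm_smul, Real.norm_of_nonneg (by nlinarith), Real.norm_of_nonneg h0.le]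
        ring
      rw [norm_smul, Real.norm_of_nonneg ht0] at f1
      have ht : t = 1 := by
        by_contra hne
        have : t < 1 := lt_of_le_of_ne ht1 hne
        nlinarith [norm_nonneg (b - y)]
      rw [ht] at hz
      have hzb : b = (1 - s) • a + s • a' := by rw [hz]; module
      have : ‖b - x‖ < r := by
        rw [hzb]
        exact (norm_combination_sub_le _ _ _ hs0 hs1 (le_max_left _ _)
          (le_max_right _ _)).trans_lt (max_lt hxa hxa')
      linarith
  · exact disc_sep_origin hr hs0 hs1 ht0 ht1 hz' ha ha' (by rw [e1]; exact hxa.le)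
      (by rw [e2]; exact hxa'.le) hb (by rw [e3]; exact hxb) (Or.inl ⟨by rwa [e1], by rwa [e2]⟩) hd

/-- The segments `[a, a']` and `[b, b']` cross at interior points. -/
def Crossing (e : Module.Basis (Fin 2) ℝ E) (a a' b b' : E) : Prop :=
  area e (a' - a) (b - a) * area e (a' - a) (b' - a) < 0 ∧
    area e (b' - b) (a - b) * area e (b' - b) (a' - b) < 0

lemma Crossing.swap {a a' b b' : E} (h : Crossing e a a' b b') : Crossing e b b' a a' :=
  ⟨h.2, h.1⟩

lemma Crossing.swap_right {a a' b b' : E} (h : Crossing e a a' b b') : Crossing e a a' b' b := by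
  refine ⟨by rw [mul_comm]; exact h.1, ?_⟩
  have := h.2
  simp only [area_sub_left, area_sub_right, area_self] at this ⊢
  rw [area_swap e b b'] at *
  nlinarith

lemma Crossing.swap_left {a a' b b' : E} (h : Crossing e a a' b b') : Crossing e a' a b b' :=
  h.swap.swap_right.swap

lemma Crossing.exists_right {a a' b b' : E} (h : Crossing e a a' b b') :
    ∃ t : ℝ, 0 < t ∧ t < 1 ∧ area e (a' - a) ((1 - t) • b + t • b' - a) = 0 := by
  set p := area e (a' - a) (b - a) with hp
  set q := area e (a' - a) (b' - a) with hq
  have h1 : p * q < 0 := h.1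
  have hne : p - q ≠ 0 := by
    intro h0
    have : p = q := by linarith
    rw [this] at h1
    nlinarith
  have hmain : area e (a' - a) ((1 - p / (p - q)) • b + (p / (p - q)) • b' - a) =
      (1 - p / (p - q)) * p + (p / (p - q)) * q := by
    rw [hp, hq]; simp only [area_sub_left, area_sub_right, area_add_right, area_smul_right]; ring
  refine ⟨p / (p - q), ?_, ?_, ?_⟩
  · rcases mul_neg_iff.1 h1 with ⟨h2, h3⟩ | ⟨h2, h3⟩
    · exact div_pos h2 (by linarith)
    · exact div_pos_of_neg_of_neg h2 (by linarith)
  · rcases mul_neg_iff.1 h1 with ⟨h2, h3⟩ | ⟨h2, h3⟩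
    · rw [div_lt_one (by linarith)]; linarith
    · rw [div_lt_one_of_neg (by linarith)]; linarith
  · rw [hmain]; field_simp; ring

lemma Crossing.exists_point {a a' b b' : E} (h : Crossing e a a' b b') :
    ∃ s t : ℝ, 0 < s ∧ s < 1 ∧ 0 < t ∧ t < 1 ∧
      (1 - s) • a + s • a' = (1 - t) • b + t • b' := by
  obtain ⟨t, ht0, ht1, ht⟩ := h.exists_right
  obtain ⟨s, hs0, hs1, hs⟩ := h.swap.exists_right
  refine ⟨s, t, hs0, hs1, ht0, ht1, ?_⟩
  have hd : area e (a' - a) (b' - b) ≠ 0 := by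
    intro h0
    have h1 : area e (a' - a) (b - a) = area e (a' - a) (b' - a) := by
      have : b' - b = (b' - a) - (b - a) := by abel
      rw [this, area_sub_right] at h0
      linarith
    have := h.1
    rw [h1] at this
    nlinarith
  set w := ((1 - s) • a + s • a') - ((1 - t) • b + t • b') with hw
  have h1 : area e (a' - a) w = 0 := by
    have : w = s • (a' - a) - ((1 - t) • b + t • b' - a) := by rw [hw]; module
    rw [this, area_sub_right, ht]; simp
  have h2 : area e (b' - b) w = 0 := by
    have : w = ((1 - s) • a + s • a' - b) - t • (b' - b) := by rw [hw]; module
    rw [this, area_sub_right, hs, area_smul_right, area_self]; simp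
  have h3 := area_smul_vec e (a' - a) (b' - b) w
  rw [h1, area_swap e w, h2] at h3
  simp only [neg_zero, zero_smul, add_zero] at h3
  exact sub_eq_zero.1 ((smul_eq_zero.1 h3).resolve_left hd)

/-- A chord of a disc on the line through two points outside of the interior of the disc lies
between these points as soon as a point of the disc does. -/
lemma mem_segment_of_mem_disc [StrictConvexSpace ℝ E] {a a' y : E} {r s τ : ℝ}
    (ha : r ≤ ‖y - a‖) (ha' : r ≤ ‖y - a'‖) (haa : a ≠ a') (hs0 : 0 < s) (hs1 : s < 1)
    (hs : ‖y - ((1 - s) • a + s • a')‖ ≤ r) (hτ : ‖y - ((1 - τ) • a + τ • a')‖ ≤ r) :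
    (1 - τ) • a + τ • a' ∈ segment ℝ a a' := by
  -- For `τ < 0` the point `c` would be strictly between two different points of the disc, hence
  -- interior to it.
  have haux : ∀ (c c' : E) (s τ : ℝ), c ≠ c' → r ≤ ‖y - c‖ → 0 < s →
      ‖y - ((1 - s) • c + s • c')‖ ≤ r → ‖y - ((1 - τ) • c + τ • c')‖ ≤ r → 0 ≤ τ := by
    intro c c' s τ hcc hc hs0 hs hτ
    by_contra hneg
    push Not at hneg
    have hne : (1 - s) • c + s • c' ≠ (1 - τ) • c + τ • c' := by
      intro h
      have : (s - τ) • (c' - c) = 0 := by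
        have h2 := sub_eq_zero.2 h
        rw [← h2]; module
      rcases smul_eq_zero.1 this with h3 | h3
      · linarith
      · exact hcc (sub_eq_zero.1 h3).symm
    have hst : 0 < s - τ := by linarith
    have := combo_mem_ball_of_ne (x := (1 - s) • c + s • c') (y := (1 - τ) • c + τ • c') (z := y)
      (r := r) (a := -τ / (s - τ)) (b := s / (s - τ)) (by rwa [mem_closedBall', dist_eq_norm])
      (by rwa [mem_closedBall', dist_eq_norm]) hne (div_pos (by linarith) hst)
      (div_pos hs0 hst) (by field_simp; ring)
    have h2 : (-τ / (s - τ)) • ((1 - s) • c + s • c') + (s / (s - τ)) • ((1 - τ) • c + τ • c')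
        = c := by
      have e1 : (-τ / (s - τ)) * (1 - s) + (s / (s - τ)) * (1 - τ) = 1 := by field_simp; ring
      have e2 : (-τ / (s - τ)) * s + (s / (s - τ)) * τ = 0 := by field_simp; ring
      calc _ = ((-τ / (s - τ)) * (1 - s) + (s / (s - τ)) * (1 - τ)) • c +
          ((-τ / (s - τ)) * s + (s / (s - τ)) * τ) • c' := by module
        _ = c := by rw [e1, e2]; simp
    rw [h2, mem_ball', dist_eq_norm] at this
    linarith
  have h0 := haux a a' s τ haa ha hs0 hs hτ
  have h1 := haux a' a (1 - s) (1 - τ) haa.symm ha' (by linarith)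
    (by rwa [sub_sub_cancel, add_comm]) (by rwa [sub_sub_cancel, add_comm])
  exact mem_segment_iff_exists.2 ⟨τ, h0, by linarith, rfl⟩

/-- A point of the line through `a` and `a'` is an affine combination of them. -/
lemma exists_line_param {a a' z : E} (haa : a ≠ a') (h : area e (a' - a) (z - a) = 0) :
    ∃ τ : ℝ, z = (1 - τ) • a + τ • a' := by
  obtain ⟨τ, hτ⟩ := exists_smul_of_area_eq_zero (sub_ne_zero.2 haa.symm) h
  refine ⟨τ, ?_⟩
  rw [← sub_add_cancel z a, hτ]; module

lemma exists_combination_eq_zero {f g : ℝ} (h : f * g ≤ 0) :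
    ∃ t : ℝ, 0 ≤ t ∧ t ≤ 1 ∧ (1 - t) * f + t * g = 0 := by
  by_cases h0 : f = g
  · have h1 : f = 0 := by
      rw [← h0] at h
      nlinarith
    exact ⟨0, le_rfl, zero_le_one, by rw [h1]; simp⟩
  · have hne : f - g ≠ 0 := sub_ne_zero.2 h0
    refine ⟨f / (f - g), ?_, ?_, ?_⟩
    · rcases mul_nonpos_iff.1 h with ⟨h2, h3⟩ | ⟨h2, h3⟩
      · exact div_nonneg h2 (by linarith)
      · exact div_nonneg_of_nonpos h2 (by linarith)
    · rcases mul_nonpos_iff.1 h with ⟨h2, h3⟩ | ⟨h2, h3⟩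
      · exact div_le_one_of_le₀ (by linarith) (by linarith)
      · exact div_le_one_of_ge (by linarith) (by linarith)
    · field_simp; ring

/-- If a segment inside a disc meets the line through `a` and `a'`, then it meets the segment
between these points, provided the latter are not interior to the disc and some point between them
belongs to it. -/
lemma exists_mem_segment_of_area_mul_nonpos [StrictConvexSpace ℝ E] {a a' y p q : E} {r s : ℝ}
    (ha : r ≤ ‖y - a‖) (ha' : r ≤ ‖y - a'‖) (haa : a ≠ a') (hs0 : 0 < s) (hs1 : s < 1)
    (hs : ‖y - ((1 - s) • a + s • a')‖ ≤ r) (hp : ‖y - p‖ ≤ r) (hq : ‖y - q‖ ≤ r)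
    (h : area e (a' - a) (p - a) * area e (a' - a) (q - a) ≤ 0) :
    ∃ z ∈ segment ℝ a a', z ∈ segment ℝ p q := by
  obtain ⟨t, ht0, ht1, ht'⟩ := exists_combination_eq_zero h
  have ht : area e (a' - a) ((1 - t) • p + t • q - a) = 0 := by
    rw [← ht']
    simp only [area_sub_left, area_sub_right, area_add_right, area_smul_right]
    ring
  obtain ⟨τ, hτ⟩ := exists_line_param haa ht
  have hin : ‖y - ((1 - t) • p + t • q)‖ ≤ r := by
    rw [norm_sub_rev]
    exact norm_combination_sub_le _ _ _ ht0 ht1 (by rwa [norm_sub_rev]) (by rwa [norm_sub_rev])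
  refine ⟨_, ?_, mem_segment_iff_exists.2 ⟨t, ht0, ht1, rfl⟩⟩
  rw [hτ] at hin ⊢
  exact mem_segment_of_mem_disc ha ha' haa hs0 hs1 hs hin

lemma Crossing.ne {a a' b b' : E} (h : Crossing e a a' b b') : a ≠ a' := by
  rintro rfl
  simpa using h.1

/-- No disc separates the diagonal `b, b'` from the diagonal `a, a'` of a quadrilateral if each of
`b` and `b'` can be separated from `a, a'` by the complement of a disc of the same radius. -/
lemma Crossing.no_separating_disc [StrictConvexSpace ℝ E] {a a' b b' x x' y : E} {r : ℝ}
    (hr : 0 < r) (h : Crossing e a a' b b') (ha : r ≤ ‖y - a‖) (ha' : r ≤ ‖y - a'‖)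
    (hb : ‖y - b‖ ≤ r) (hb' : ‖y - b'‖ ≤ r)
    (hxa : ‖x - a‖ < r) (hxa' : ‖x - a'‖ < r) (hxb : r ≤ ‖x - b‖)
    (hxa2 : ‖x' - a‖ < r) (hxa2' : ‖x' - a'‖ < r) (hxb' : r ≤ ‖x' - b'‖) : False := by
  obtain ⟨s, t, hs0, hs1, ht0, ht1, hst⟩ := h.exists_point
  have hin : ‖y - ((1 - s) • a + s • a')‖ ≤ r := by
    rw [hst, norm_sub_rev]
    exact norm_combination_sub_le _ _ _ ht0.le ht1.le (by rwa [norm_sub_rev])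
      (by rwa [norm_sub_rev])
  have hyy : ‖y - y‖ ≤ r := by simpa using hr.le
  -- By `disc_sep` the segment `[y, b]` misses `[a, a']`, so `y` is on the side of `b`. It is
  -- equally on the side of `b'`, but the crossing puts these on opposite sides.
  have h1 : 0 < area e (a' - a) (y - a) * area e (a' - a) (b - a) := by
    by_contra hc
    obtain ⟨z, hz, hz'⟩ := exists_mem_segment_of_area_mul_nonpos ha ha' h.ne hs0 hs1 hin hyy hb
      (not_lt.1 hc)
    exact disc_sep e hr ha ha' hb hxa hxa' hxb hz hz'
  have h2 : 0 < area e (a' - a) (y - a) * area e (a' - a) (b' - a) := by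
    by_contra hc
    obtain ⟨z, hz, hz'⟩ := exists_mem_segment_of_area_mul_nonpos ha ha' h.ne hs0 hs1 hin hyy hb'
      (not_lt.1 hc)
    exact disc_sep e hr ha ha' hb' hxa2 hxa2' hxb' hz hz'
  have h3 := h.1
  nlinarith [mul_pos h1 h2, sq_nonneg (area e (a' - a) (y - a))]

end discs

/-! ### Intersection of two circles of equal radius. -/

section circles

variable {E : Type*} [NormedAddCommGroup E] [NormedSpace ℝ E] {e : Module.Basis (Fin 2) ℝ E}

/-- On the line through `s` in direction `v` the four points `s - v`, `s`, `w - v`, `w` are ordered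
so that, for `t ≠ 0`, one of the two circle points is strictly between two different points of the
disc, against strict convexity. -/
lemma not_parallel_chords [StrictConvexSpace ℝ E] {p v s w : E} {r t : ℝ} (hv : v ≠ 0)
    (hs : ‖s - p‖ = r) (hs' : ‖s - v - p‖ = r) (hw : ‖w - p‖ ≤ r) (hw' : ‖w - v - p‖ ≤ r)
    (ht : t ≠ 0) (h : s = w + t • v) : False := by
  have key : ∀ (x y z : E) (c d : ℝ), ‖x - p‖ ≤ r → ‖y - p‖ ≤ r → ‖z - p‖ = r → x ≠ y → 0 < c →
      0 < d → c + d = 1 → c • x + d • y = z → False := by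
    intro x y z c d hx hy hz hxy hc hd hcd hxyz
    have := combo_mem_ball_of_ne (x := x) (y := y) (z := p) (r := r) (by rwa [mem_closedBall_iff_norm])
      (by rwa [mem_closedBall_iff_norm]) hxy hc hd hcd
    rw [hxyz, mem_ball_iff_norm] at this
    linarith
  rcases lt_or_gt_of_ne ht with h0 | h0
  · have h1 : 0 < 1 - t := by linarith
    refine key (s - v) w s (-t / (1 - t)) (1 / (1 - t)) hs'.le hw hs ?_ (div_pos (by linarith) h1)
      (div_pos one_pos h1) (by field_simp; ring) ?_
    · intro h2
      rw [h] at h2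
      have : (t - 1) • v = 0 := by
        rw [← sub_eq_zero] at h2; rw [← h2]; module
      rcases smul_eq_zero.1 this with h3 | h3
      · linarith
      · exact hv h3
    · have hw2 : w = s - t • v := by rw [h]; abel
      rw [hw2]
      have e1 : (-t / (1 - t)) + (1 / (1 - t)) = 1 := by field_simp; ring
      have e2 : (-t / (1 - t)) + (1 / (1 - t)) * t = 0 := by field_simp; ring
      calc _ = ((-t / (1 - t)) + (1 / (1 - t))) • s -
            ((-t / (1 - t)) + (1 / (1 - t)) * t) • v := by module
        _ = s := by rw [e1, e2]; simp
  · have h1 : 0 < 1 + t := by linarith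
    refine key (w - v) s (s - v) (1 / (1 + t)) (t / (1 + t)) hw' hs.le hs' ?_ (div_pos one_pos h1)
      (div_pos h0 h1) (by field_simp) ?_
    · intro h2
      rw [h] at h2
      have : (t + 1) • v = 0 := by
        rw [← sub_eq_zero] at h2; rw [← neg_eq_zero, ← h2]; module
      rcases smul_eq_zero.1 this with h3 | h3
      · linarith
      · exact hv h3
    · have hw2 : w = s - t • v := by rw [h]; abel
      rw [hw2]
      have e1 : (1 / (1 + t)) + (t / (1 + t)) = 1 := by field_simp
      have e2 : (1 / (1 + t)) * t + (1 / (1 + t)) = 1 := by field_simp; ring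
      calc _ = ((1 / (1 + t)) + (t / (1 + t))) • s -
            ((1 / (1 + t)) * t + (1 / (1 + t))) • v := by module
        _ = s - v := by rw [e1, e2]; simp

/-- Two different circles of the same radius have finitely many common points. -/
lemma finite_sphere_inter_sphere (e : Module.Basis (Fin 2) ℝ E) [StrictConvexSpace ℝ E] {p q : E}
    (hpq : p ≠ q) (r : ℝ) : (sphere p r ∩ sphere q r).Finite := by
  have : FiniteDimensional ℝ E := e.finiteDimensional_of_finite
  have : ProperSpace E := FiniteDimensional.proper ℝ E
  set v := q - p with hv
  have hv0 : v ≠ 0 := sub_ne_zero.2 hpq.symm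
  set S := sphere p r ∩ sphere q r with hS
  have hmem : ∀ s ∈ S, ‖s - p‖ = r ∧ ‖s - v - p‖ = r := by
    rintro s ⟨h1, h2⟩
    rw [mem_sphere_iff_norm] at h1 h2
    exact ⟨h1, by rw [hv, show s - (q - p) - p = s - q by abel]; exact h2⟩
  -- The linear functional `area e v` is injective on the common points. No common point has a value
  -- strictly between two others, so only the points of least and of greatest value remain.
  have hinj : ∀ s ∈ S, ∀ s' ∈ S, area e v s = area e v s' → s = s' := by
    intro s hs s' hs' h
    obtain ⟨t, ht⟩ := exists_smul_of_area_eq_zero (e := e) (v := s - s') hv0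
      (by rw [area_sub_right, h, sub_self])
    have ht' : s = s' + t • v := by rw [← ht]; abel
    by_cases h0 : t = 0
    · simpa [h0] using ht'
    · exact (not_parallel_chords hv0 (hmem s hs).1 (hmem s hs).2 (hmem s' hs').1.le
        (hmem s' hs').2.le h0 ht').elim
  have hbetween : ∀ s ∈ S, ∀ x ∈ S, ∀ y ∈ S, area e v x < area e v s → area e v s < area e v y →
      False := by
    intro s hs x hx y hy h1 h2
    set d := area e v y - area e v x with hd
    have hd0 : 0 < d := by linarith
    set c := (area e v s - area e v x) / d with hc
    have hc0 : 0 < c := div_pos (by linarith) hd0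
    have hc1 : c < 1 := by rw [hc, div_lt_one hd0]; linarith
    have hxy : x ≠ y := by rintro rfl; linarith
    -- The point of the chord `[x, y]` with the same value as `s`; it is interior to the disc about
    -- `p`.
    set w := (1 - c) • x + c • y with hw
    have hwp : ‖w - p‖ < r := by
      have := combo_mem_ball_of_ne (x := x) (y := y) (z := p) (r := r) (a := 1 - c) (b := c)
        (by rw [mem_closedBall_iff_norm]; exact (hmem x hx).1.le)
        (by rw [mem_closedBall_iff_norm]; exact (hmem y hy).1.le) hxy (by linarith) hc0 (by ring)
      rwa [mem_ball_iff_norm] at this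
    have hwv : ‖w - v - p‖ ≤ r := by
      rw [sub_sub, hw]
      exact norm_combination_sub_le _ _ _ hc0.le hc1.le
        (by rw [← sub_sub]; exact (hmem x hx).2.le) (by rw [← sub_sub]; exact (hmem y hy).2.le)
    obtain ⟨t, ht⟩ := exists_smul_of_area_eq_zero (e := e) (v := s - w) hv0 (by
      rw [hw, area_sub_right, area_add_right, area_smul_right, area_smul_right]
      have : c * d = area e v s - area e v x := by rw [hc]; field_simp
      rw [hd] at this
      linarith)
    have ht' : s = w + t • v := by rw [← ht]; abel
    by_cases h0 : t = 0
    · have : s = w := by simpa [h0] using ht'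
      rw [← this, (hmem s hs).1] at hwp
      exact lt_irrefl _ hwp
    · exact not_parallel_chords hv0 (hmem s hs).1 (hmem s hs).2 hwp.le hwv h0 ht'
  rcases S.eq_empty_or_nonempty with h0 | h0
  · rw [h0]; exact finite_empty
  · have hcomp : IsCompact S := (isCompact_sphere p r).inter_right isClosed_sphere
    have hcont : ContinuousOn (fun s => area e v s) S :=
      ((continuous_area e).comp (continuous_const.prodMk continuous_id)).continuousOn
    obtain ⟨x, hx, hmin⟩ := hcomp.exists_isMinOn h0 hcont
    obtain ⟨y, hy, hmax⟩ := hcomp.exists_isMaxOn h0 hcont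
    refine (finite_singleton x).insert y |>.subset ?_
    intro s hs
    by_contra hne
    simp only [mem_insert_iff, mem_singleton_iff, not_or] at hne
    have h1 : area e v x ≤ area e v s := hmin hs
    have h2 : area e v s ≤ area e v y := hmax hs
    exact hbetween s hs x hx y hy
      (lt_of_le_of_ne h1 fun h => hne.2 (hinj s hs x hx h.symm))
      (lt_of_le_of_ne h2 fun h => hne.1 (hinj s hs y hy h))

end circles

lemma mem_ballInter_range {E : Type*} [NormedAddCommGroup E] {j : ℕ} {q : Fin j → E} {ρ : ℝ}
    {x : E} : x ∈ ballInter (range q) ρ ↔ ∀ i, ‖x - q i‖ ≤ ρ := by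
  simp [ballInter, dist_eq_norm]

lemma isClosed_ballInter {E : Type*} [NormedAddCommGroup E] {ρ : ℝ} (K : Set E) : IsClosed (ballInter K ρ) :=
  isClosed_biInter fun _ _ => isClosed_closedBall

/-! ### Interior and frontier of a ball intersection. -/

section ballInter

variable {E : Type*} [NormedAddCommGroup E] [NormedSpace ℝ E] {j : ℕ} {q : Fin j → E} {ρ : ℝ}

lemma mem_interior_ballInter_of_lt {x : E} (h : ∀ i, ‖x - q i‖ < ρ) :
    x ∈ interior (ballInter (range q) ρ) := by
  rw [mem_interior]
  refine ⟨⋂ i, ball (q i) ρ, ?_, isOpen_iInter_of_finite fun i => isOpen_ball, ?_⟩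
  · intro y hy
    rw [mem_ballInter_range]
    intro i
    have := mem_iInter.1 hy i
    rw [mem_ball_iff_norm] at this
    exact this.le
  · rw [mem_iInter]
    intro i
    rw [mem_ball_iff_norm]
    exact h i

lemma lt_of_mem_interior_ballInter {x : E} (hρ : ρ ≠ 0)
    (h : x ∈ interior (ballInter (range q) ρ)) (i : Fin j) : ‖x - q i‖ < ρ := by
  have h1 : interior (ballInter (range q) ρ) ⊆ interior (closedBall (q i) ρ) := by
    apply interior_mono
    intro y hy
    rw [mem_closedBall_iff_norm]
    exact mem_ballInter_range.1 hy i
  have h2 := h1 h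
  rw [interior_closedBall _ hρ, mem_ball_iff_norm] at h2
  exact h2

lemma mem_frontier_ballInter {x : E} (hρ : ρ ≠ 0) :
    x ∈ frontier (ballInter (range q) ρ) ↔ (∀ i, ‖x - q i‖ ≤ ρ) ∧ ∃ i, ‖x - q i‖ = ρ := by
  rw [(isClosed_ballInter _).frontier_eq]
  constructor
  · rintro ⟨h1, h2⟩
    rw [mem_ballInter_range] at h1
    refine ⟨h1, ?_⟩
    by_contra hne
    push Not at hne
    exact h2 (mem_interior_ballInter_of_lt fun i => lt_of_le_of_ne (h1 i) (hne i))
  · rintro ⟨h1, i, hi⟩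
    refine ⟨mem_ballInter_range.2 h1, fun h => ?_⟩
    exact (lt_of_mem_interior_ballInter hρ h i).ne hi

lemma combination_mem_interior_ballInter [StrictConvexSpace ℝ E] {x y : E} {s : ℝ}
    (hx : x ∈ ballInter (range q) ρ) (hy : y ∈ ballInter (range q) ρ) (hxy : x ≠ y) (h0 : 0 < s)
    (h1 : s < 1) : (1 - s) • x + s • y ∈ interior (ballInter (range q) ρ) := by
  rw [mem_ballInter_range] at hx hy
  apply mem_interior_ballInter_of_lt
  intro i
  have := combo_mem_ball_of_ne (x := x) (y := y) (z := q i) (r := ρ) (a := 1 - s) (b := s)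
    (by rw [mem_closedBall_iff_norm]; exact hx i) (by rw [mem_closedBall_iff_norm]; exact hy i)
    hxy (by linarith) h0 (by ring)
  rwa [mem_ball_iff_norm] at this

lemma isBounded_ballInter_range (i : Fin j) : Bornology.IsBounded (ballInter (range q) ρ) := by
  refine (isBounded_closedBall (x := q i) (r := ρ)).subset fun y hy => ?_
  rw [mem_closedBall_iff_norm]
  exact mem_ballInter_range.1 hy i

end ballInter

/-! ### Cyclic order on a convex curve and its transport by supporting functionals. -/

section curves

variable {E : Type*} [NormedAddCommGroup E] [NormedSpace ℝ E] {e : Module.Basis (Fin 2) ℝ E}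

/-- Injectivity carries over from `Ico 0 T` to every window shorter than a period. -/
lemma eq_of_periodic_injOn {α : Type*} {γ : ℝ → α} {T s t : ℝ} (hT : 0 < T)
    (hp : Function.Periodic γ T) (hi : InjOn γ (Ico 0 T)) (hst : s < t) (hts : t < s + T) :
    γ s ≠ γ t := by
  intro h
  have h1 : ∀ x, γ (toIcoMod hT 0 x) = γ x := fun x => hp.sub_zsmul_eq _
  have h2 : ∀ x, toIcoMod hT 0 x ∈ Ico 0 T := fun x => by
    simpa using toIcoMod_mem_Ico hT 0 x
  have h3 : toIcoMod hT 0 s = toIcoMod hT 0 t := hi (h2 s) (h2 t) (by rw [h1, h1, h])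
  have h4 : t - s = ((toIcoDiv hT 0 t - toIcoDiv hT 0 s : ℤ) : ℝ) * T := by
    unfold toIcoMod at h3
    simp only [zsmul_eq_mul] at h3
    push_cast
    linarith
  set k := toIcoDiv hT 0 t - toIcoDiv hT 0 s
  have h5 : (0 : ℝ) < k := by
    by_contra hk
    push Not at hk
    nlinarith
  have h6 : (k : ℝ) < 1 := by
    by_contra hk
    push Not at hk
    nlinarith
  have h7 : 0 < k := by exact_mod_cast h5
  have h8 : k < 1 := by exact_mod_cast h6
  omega

/-- A ray from an interior point of a bounded set leaves this set through its frontier. -/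
lemma exists_pos_mem_frontier {Y : Set E} (hY : Bornology.IsBounded Y) {m d : E}
    (hm : m ∈ interior Y) (hd : d ≠ 0) : ∃ t : ℝ, 0 < t ∧ m + t • d ∈ frontier Y := by
  obtain ⟨R, hR⟩ := hY.exists_norm_le
  set T := (|R| + 1 + ‖m‖) / ‖d‖ with hT
  have hd0 : 0 < ‖d‖ := norm_pos_iff.2 hd
  have hT0 : 0 < T := by positivity
  have hout : m + T • d ∉ Y := by
    intro h
    have h1 := hR _ h
    have h2 : ‖T • d‖ ≤ ‖m + T • d‖ + ‖m‖ := by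
      have := norm_sub_le (m + T • d) m
      simpa using this
    rw [norm_smul, Real.norm_of_nonneg hT0.le, hT, div_mul_cancel₀ _ hd0.ne'] at h2
    linarith [le_abs_self R]
  obtain ⟨z, hz, hzf⟩ : ∃ z ∈ segment ℝ m (m + T • d), z ∈ frontier Y := by
    by_contra hne
    push Not at hne
    have hcov : ∀ z ∈ segment ℝ m (m + T • d), z ∈ interior Y ∨ z ∈ (closure Y)ᶜ := by
      intro z hz
      by_cases h1 : z ∈ interior Y
      · exact Or.inl h1
      · exact Or.inr fun h2 => hne z hz ⟨h2, h1⟩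
    obtain ⟨z, -, hz1, hz2⟩ := (convex_segment m (m + T • d)).isPreconnected _ _ isOpen_interior
      isClosed_closure.isOpen_compl hcov ⟨m, left_mem_segment _ _ _, hm⟩
      ⟨m + T • d, right_mem_segment _ _ _, (hcov _ (right_mem_segment _ _ _)).resolve_left
        fun h => hout (interior_subset h)⟩
    exact hz2 (subset_closure (interior_subset hz1))
  obtain ⟨s, hs0, hs1, rfl⟩ := mem_segment_iff_exists.1 hz
  have he : (1 - s) • m + s • (m + T • d) = m + (s * T) • d := by module
  rw [he] at hzf
  refine ⟨s * T, ?_, hzf⟩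
  rcases hs0.eq_or_lt with h | h
  · exfalso
    rw [← h] at hzf
    simp only [zero_mul, zero_smul, add_zero] at hzf
    exact hzf.2 hm
  · positivity

lemma exists_area_pos {u : E} (hu : u ≠ 0) : ∃ d : E, 0 < area e u d := by
  by_contra hne
  push Not at hne
  have h0 : ∀ d, area e u d = 0 := fun d => le_antisymm (hne d) (by
    have := hne (-d)
    rw [area_neg_right] at this
    linarith)
  apply hu
  apply e.ext_elem
  intro i
  have h1 := h0 (e 0)
  have h2 := h0 (e 1)
  simp [area] at h1 h2
  fin_cases i <;> simp [h1, h2]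

/-- A continuous function without zeros in an interval has constant sign there. -/
lemma mul_pos_of_ne_zero_on_Ioo {f : ℝ → ℝ} (hf : Continuous f) {a b s t : ℝ}
    (h : ∀ x ∈ Ioo a b, f x ≠ 0) (hs : s ∈ Ioo a b) (ht : t ∈ Ioo a b) : 0 < f s * f t := by
  by_contra hneg
  push Not at hneg
  have h0 : (0 : ℝ) ∈ uIcc (f s) (f t) := by
    rcases mul_nonpos_iff.1 hneg with ⟨h1, h2⟩ | ⟨h1, h2⟩
    · exact mem_uIcc.2 (Or.inr ⟨h2, h1⟩)
    · exact mem_uIcc.2 (Or.inl ⟨h1, h2⟩)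
  obtain ⟨x, hx, hx0⟩ := intermediate_value_uIcc hf.continuousOn h0
  exact h x (ordConnected_Ioo.uIcc_subset hs ht hx) hx0

/-- On the boundary of a strictly convex set, the chord between two points separates the two arcs
between them. -/
lemma area_mul_area_neg_of_cyclic {Y : Set E} (hcl : IsClosed Y) (hb : Bornology.IsBounded Y)
    (hsc : ∀ x ∈ Y, ∀ y ∈ Y, x ≠ y → ∀ s : ℝ, 0 < s → s < 1 → (1 - s) • x + s • y ∈ interior Y)
    {γ : ℝ → E} {T : ℝ} (hγ : Continuous γ) (hp : Function.Periodic γ T)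
    (hi : InjOn γ (Ico 0 T)) (hr : range γ = frontier Y) {t₁ t₂ t₃ t₄ : ℝ} (h12 : t₁ < t₂)
    (h23 : t₂ < t₃) (h34 : t₃ < t₄) (h41 : t₄ < t₁ + T) :
    area e (γ t₃ - γ t₁) (γ t₂ - γ t₁) * area e (γ t₃ - γ t₁) (γ t₄ - γ t₁) < 0 := by
  have : FiniteDimensional ℝ E := e.finiteDimensional_of_finite
  have hT : 0 < T := by linarith
  have hfr : ∀ t, γ t ∈ frontier Y := fun t => hr ▸ mem_range_self t
  have hfY : ∀ t, γ t ∈ Y := fun t => hcl.frontier_subset (hfr t)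
  have h13 : γ t₁ ≠ γ t₃ := eq_of_periodic_injOn hT hp hi (by linarith) (by linarith)
  set f : ℝ → ℝ := fun t => area e (γ t₃ - γ t₁) (γ t - γ t₁) with hf
  have hfc : Continuous f :=
    (continuous_area e).comp (continuous_const.prodMk (hγ.sub continuous_const))
  have hnot : ∀ x ∈ Y, ∀ y ∈ Y, ∀ s : ℝ, 0 < s → s < 1 → x ≠ y →
      (1 - s) • x + s • y ∉ frontier Y := fun x hx y hy s h0 h1 hxy h =>
    h.2 (hsc x hx y hy hxy s h0 h1)
  -- Three different frontier points of a strictly convex set are not collinear, since the middle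
  -- one would be interior.
  have hne : ∀ t, γ t ≠ γ t₁ → γ t ≠ γ t₃ → f t ≠ 0 := by
    intro t ht1 ht3 h0
    obtain ⟨τ, hτ⟩ := exists_line_param h13 h0
    rcases lt_trichotomy τ 0 with h | h | h
    · have hd : 0 < 1 - τ := by linarith
      apply hnot (γ t) (hfY t) (γ t₃) (hfY t₃) (-τ / (1 - τ)) (div_pos (by linarith) hd)
        (by rw [div_lt_one hd]; linarith) ht3
      have : (1 - -τ / (1 - τ)) • γ t + (-τ / (1 - τ)) • γ t₃ = γ t₁ := by
        rw [hτ]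
        have e1 : (1 - -τ / (1 - τ)) * (1 - τ) = 1 := by field_simp; ring
        have e2 : (1 - -τ / (1 - τ)) * τ + (-τ / (1 - τ)) = 0 := by field_simp; ring
        calc _ = ((1 - -τ / (1 - τ)) * (1 - τ)) • γ t₁ +
            ((1 - -τ / (1 - τ)) * τ + (-τ / (1 - τ))) • γ t₃ := by module
          _ = _ := by rw [e1, e2]; simp
      rw [this]
      exact hfr t₁
    · apply ht1
      rw [hτ, h]; simp
    · rcases lt_trichotomy τ 1 with h' | h' | h'
      · apply hnot (γ t₁) (hfY t₁) (γ t₃) (hfY t₃) τ h h' h13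
        rw [← hτ]
        exact hfr t
      · apply ht3
        rw [hτ, h']; simp
      · apply hnot (γ t₁) (hfY t₁) (γ t) (hfY t) (1 / τ) (by positivity)
          (by rw [div_lt_one h]; exact h') ht1.symm
        have : (1 - 1 / τ) • γ t₁ + (1 / τ) • γ t = γ t₃ := by
          rw [hτ]
          have e1 : (1 - 1 / τ) + 1 / τ * (1 - τ) = 0 := by field_simp; ring
          have e2 : 1 / τ * τ = 1 := by field_simp
          calc _ = ((1 - 1 / τ) + 1 / τ * (1 - τ)) • γ t₁ + (1 / τ * τ) • γ t₃ := by module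
            _ = _ := by rw [e1, e2]; simp
        rw [this]
        exact hfr t₃
  have hA : ∀ x ∈ Ioo t₁ t₃, f x ≠ 0 := fun x hx =>
    hne x (eq_of_periodic_injOn hT hp hi hx.1 (by linarith [hx.2])).symm
      (eq_of_periodic_injOn hT hp hi hx.2 (by linarith [hx.1]))
  have hB : ∀ x ∈ Ioo t₃ (t₁ + T), f x ≠ 0 := fun x hx =>
    hne x (eq_of_periodic_injOn hT hp hi (by linarith [hx.1]) hx.2).symm
      (eq_of_periodic_injOn hT hp hi hx.1 (by linarith [hx.2])).symm
  -- So `f` has constant sign on each of the two open arcs. The midpoint of the chord is interior,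
  -- and rays from it to either side hit the frontier; hence both signs occur, and the arcs have
  -- opposite ones.
  have hm := hsc _ (hfY t₁) _ (hfY t₃) h13 (1 / 2) (by norm_num) (by norm_num)
  set m := (1 - (1 / 2 : ℝ)) • γ t₁ + (1 / 2 : ℝ) • γ t₃ with hmdef
  have hside : ∀ d : E, area e (γ t₃ - γ t₁) d ≠ 0 →
      ∃ t ∈ Ioo t₁ t₃ ∪ Ioo t₃ (t₁ + T), 0 < f t * area e (γ t₃ - γ t₁) d := by
    intro d hd
    have hd0 : d ≠ 0 := by rintro rfl; simp at hd
    obtain ⟨c, hc, hcf⟩ := exists_pos_mem_frontier hb hm hd0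
    rw [← hr] at hcf
    obtain ⟨x, hx⟩ := hcf
    obtain ⟨t, ht, htx⟩ := hp.exists_mem_Ico hT x t₁
    have hft : f t = c * area e (γ t₃ - γ t₁) d := by
      simp only [hf]
      rw [← htx, hx, hmdef]
      simp
      rw [area_swap e (γ t₃) (γ t₁)]
      ring
    have hft0 : 0 < f t * area e (γ t₃ - γ t₁) d := by
      rw [hft, mul_assoc]
      exact mul_pos hc (mul_self_pos.2 hd)
    refine ⟨t, ?_, hft0⟩
    have hf0 : f t ≠ 0 := fun h => by rw [h] at hft0; simp at hft0
    have ht1 : t ≠ t₁ := by rintro rfl; exact hf0 (by simp only [hf, sub_self, area_zero_right])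
    have ht3 : t ≠ t₃ := by rintro rfl; exact hf0 (area_self _ _)
    rcases lt_or_gt_of_ne ht3 with h | h
    · exact Or.inl ⟨lt_of_le_of_ne ht.1 ht1.symm, h⟩
    · exact Or.inr ⟨h, ht.2⟩
  obtain ⟨d, hd⟩ := exists_area_pos (e := e) (sub_ne_zero.2 h13.symm)
  obtain ⟨x, hx, hx0⟩ := hside d hd.ne'
  obtain ⟨y, hy, hy0⟩ := hside (-d) (by rw [area_neg_right]; exact (neg_neg_of_pos hd).ne)
  rw [area_neg_right] at hy0
  have hx0' : 0 < f x := pos_of_mul_pos_left hx0 hd.le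
  have hy0' : f y < 0 := by nlinarith
  have hA' := fun s t => mul_pos_of_ne_zero_on_Ioo hfc hA (s := s) (t := t)
  have hB' := fun s t => mul_pos_of_ne_zero_on_Ioo hfc hB (s := s) (t := t)
  have h2 : t₂ ∈ Ioo t₁ t₃ := ⟨h12, h23⟩
  have h4 : t₄ ∈ Ioo t₃ (t₁ + T) := ⟨h34, h41⟩
  change f t₂ * f t₄ < 0
  rcases hx with hx | hx <;> rcases hy with hy | hy
  · nlinarith [hA' x y hx hy]
  · have g1 := hA' x t₂ hx h2
    have g2 := hB' y t₄ hy h4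
    have : 0 < f t₂ := pos_of_mul_pos_right g1 hx0'.le
    have : f t₄ < 0 := by nlinarith
    nlinarith
  · have g1 := hA' y t₂ hy h2
    have g2 := hB' x t₄ hx h4
    have : 0 < f t₄ := pos_of_mul_pos_right g2 hx0'.le
    have : f t₂ < 0 := by nlinarith
    nlinarith
  · nlinarith [hB' x y hx hy]

/-- Three points that are exposed by given functionals have an orientation which depends on these
functionals only. -/
lemma area_mul_area_pos_of_exposed {f₁ f₂ f₃ : E →L[ℝ] ℝ} {x₁ x₂ x₃ z₁ z₂ z₃ : E}
    (h12 : f₁ x₂ < f₁ x₁) (h13 : f₁ x₃ < f₁ x₁) (h21 : f₂ x₁ < f₂ x₂) (h23 : f₂ x₃ < f₂ x₂)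
    (h31 : f₃ x₁ < f₃ x₃) (h32 : f₃ x₂ < f₃ x₃)
    (k12 : f₁ z₂ < f₁ z₁) (k13 : f₁ z₃ < f₁ z₁) (k21 : f₂ z₁ < f₂ z₂) (k23 : f₂ z₃ < f₂ z₂)
    (k31 : f₃ z₁ < f₃ z₃) (k32 : f₃ z₂ < f₃ z₃) :
    0 < area e (x₂ - x₁) (x₃ - x₁) * area e (z₂ - z₁) (z₃ - z₁) := by
  have : FiniteDimensional ℝ E := e.finiteDimensional_of_finite
  have hne : ∀ {w₁ w₂ w₃ : E}, f₁ w₂ < f₁ w₁ → f₁ w₃ < f₁ w₁ → f₂ w₁ < f₂ w₂ → f₂ w₃ < f₂ w₂ →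
      f₃ w₁ < f₃ w₃ → f₃ w₂ < f₃ w₃ → area e (w₂ - w₁) (w₃ - w₁) ≠ 0 := by
    intro w₁ w₂ w₃ g12 g13 g21 g23 g31 g32 h0
    have hw : w₁ ≠ w₂ := by rintro rfl; exact lt_irrefl _ g12
    obtain ⟨c, rfl⟩ := exists_line_param hw h0
    simp only [map_add, map_smul, smul_eq_mul] at g13 g23 g31 g32
    have c0 : 0 < c := by nlinarith
    have c1 : c < 1 := by nlinarith
    have c2 : 0 < f₃ w₂ - f₃ w₁ := by nlinarith
    nlinarith
  -- The triples are joined by a linear homotopy. Exposedness by the same functionals survives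
  -- convex combinations and excludes collinearity, so the orientation cannot change on the way.
  set g : ℝ → ℝ := fun t => area e (((1 - t) • x₂ + t • z₂) - ((1 - t) • x₁ + t • z₁))
    (((1 - t) • x₃ + t • z₃) - ((1 - t) • x₁ + t • z₁)) with hg
  have hgc : Continuous g := by
    refine (continuous_area e).comp (Continuous.prodMk ?_ ?_) <;> fun_prop
  by_contra hneg
  push Not at hneg
  have hg0 : g 0 = area e (x₂ - x₁) (x₃ - x₁) := by simp only [hg]; congr 1 <;> module
  have hg1 : g 1 = area e (z₂ - z₁) (z₃ - z₁) := by simp only [hg]; congr 1 <;> module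
  rw [← hg0, ← hg1] at hneg
  have h0 : (0 : ℝ) ∈ uIcc (g 0) (g 1) := by
    rcases mul_nonpos_iff.1 hneg with ⟨h1, h2⟩ | ⟨h1, h2⟩
    · exact mem_uIcc.2 (Or.inr ⟨h2, h1⟩)
    · exact mem_uIcc.2 (Or.inl ⟨h1, h2⟩)
  obtain ⟨t, ht, ht0⟩ := intermediate_value_uIcc hgc.continuousOn h0
  rw [uIcc_of_le zero_le_one] at ht
  have hlt : ∀ {a b c d : ℝ}, a < b → c < d → (1 - t) * a + t * c < (1 - t) * b + t * d := by
    intro a b c d h1 h2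
    rcases ht.1.eq_or_lt with h | h
    · rw [← h]; simpa using h1
    · nlinarith [ht.2]
  refine hne (w₁ := (1 - t) • x₁ + t • z₁) (w₂ := (1 - t) • x₂ + t • z₂)
    (w₃ := (1 - t) • x₃ + t • z₃) ?_ ?_ ?_ ?_ ?_ ?_ ht0 <;>
  simp only [map_add, map_smul, smul_eq_mul] <;> apply hlt <;> assumption

/-- If `x k` is at distance `ρ` from `q k` and closer to the other ones of the points `q 0, …, q 3`,
then `x 0, …, x 3` and `q 0, …, q 3` have the same cyclic order. -/
lemma crossing_centers {x q : Fin 4 → E} {ρ : ℝ} (hself : ∀ k, ‖x k - q k‖ = ρ)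
    (hlt : ∀ k l, k ≠ l → ‖x k - q l‖ < ρ) (h : Crossing e (x 0) (x 2) (x 1) (x 3)) :
    Crossing e (q 0) (q 2) (q 1) (q 3) := by
  -- A norming functional of `x k - q k` exposes `x k` among the points `x l`, and also `-q k` among
  -- the points `-q l`.
  have hex : ∀ k, ∃ f : E →L[ℝ] ℝ, ‖f‖ ≤ 1 ∧ f (x k - q k) = ρ := by
    intro k
    obtain ⟨f, hf, hfx⟩ := exists_dual_vector'' ℝ (x k - q k)
    exact ⟨f, hf, by rw [hfx]; simpa using hself k⟩
  choose f hf hfx using hex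
  have hle : ∀ k v, f k v ≤ ‖v‖ := fun k v =>
    (le_abs_self _).trans (((f k).le_of_opNorm_le (hf k) v).trans (by rw [one_mul]))
  have h1 : ∀ k l, k ≠ l → f k (x l) < f k (x k) := by
    intro k l hkl
    have g1 := hle k (x l - q k)
    have g2 := hlt l k hkl.symm
    have g3 := hfx k
    rw [map_sub] at g1 g3
    linarith
  have h2 : ∀ k l, k ≠ l → f k (-q l) < f k (-q k) := by
    intro k l hkl
    have g1 := hle k (x k - q l)
    have g2 := hlt k l hkl
    have g3 := hfx k
    rw [map_sub] at g1 g3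
    rw [map_neg, map_neg]
    linarith
  have key : ∀ k l m : Fin 4, k ≠ l → k ≠ m → l ≠ m →
      0 < area e (x l - x k) (x m - x k) * area e (q l - q k) (q m - q k) := by
    intro k l m hkl hkm hlm
    have := area_mul_area_pos_of_exposed (e := e) (h1 k l hkl) (h1 k m hkm) (h1 l k hkl.symm)
      (h1 l m hlm) (h1 m k hkm.symm) (h1 m l hlm.symm) (h2 k l hkl) (h2 k m hkm) (h2 l k hkl.symm)
      (h2 l m hlm) (h2 m k hkm.symm) (h2 m l hlm.symm)
    -- The point reflection in the origin preserves orientation in the plane.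
    have e1 : area e (-q l - -q k) (-q m - -q k) = area e (q l - q k) (q m - q k) := by
      simp; ring
    rwa [e1] at this
  have hsign : ∀ {a b c d : ℝ}, 0 < a * c → 0 < b * d → a * b < 0 → c * d < 0 := by
    intro a b c d g1 g2 g3
    have : 0 < (a * b) * (c * d) := by nlinarith [mul_pos g1 g2]
    exact neg_of_mul_pos_right this g3.le
  exact ⟨hsign (key 0 2 1 (by decide) (by decide) (by decide))
      (key 0 2 3 (by decide) (by decide) (by decide)) h.1,
    hsign (key 1 3 0 (by decide) (by decide) (by decide))
      (key 1 3 2 (by decide) (by decide) (by decide)) h.2⟩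

end curves

/-! ### Generic points of the arcs; no label occurs twice. -/

section cycles

variable {E : Type*} [NormedAddCommGroup E] [NormedSpace ℝ E] {e : Module.Basis (Fin 2) ℝ E}
  {j n : ℕ} {q : Fin j → E} {ρ : ℝ} {γ : ℝ → E} {label : Fin (n + 1) → Fin j}

lemma IsBoundaryArcCycle.norm_le (h : IsBoundaryArcCycle q ρ n γ label) (t : ℝ) (i : Fin j) :
    ‖γ t - q i‖ ≤ ρ := by
  have h1 : γ t ∈ frontier (ballInter (range q) ρ) := h.range_eq ▸ mem_range_self t
  exact mem_ballInter_range.1 ((isClosed_ballInter _).frontier_subset h1) i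

lemma IsBoundaryArcCycle.crossing [StrictConvexSpace ℝ E]
    (h : IsBoundaryArcCycle q ρ n γ label) {t₁ t₂ t₃ t₄ : ℝ} (h12 : t₁ < t₂)
    (h23 : t₂ < t₃) (h34 : t₃ < t₄) (h41 : t₄ < t₁ + (n + 1)) :
    Crossing e (γ t₁) (γ t₃) (γ t₂) (γ t₄) := by
  have hsc : ∀ x ∈ ballInter (range q) ρ, ∀ y ∈ ballInter (range q) ρ, x ≠ y → ∀ s : ℝ, 0 < s →
      s < 1 → (1 - s) • x + s • y ∈ interior (ballInter (range q) ρ) :=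
    fun x hx y hy hxy s h0 h1 => combination_mem_interior_ballInter hx hy hxy h0 h1
  have hb := isBounded_ballInter_range (q := q) (ρ := ρ) (label 0)
  refine ⟨area_mul_area_neg_of_cyclic (isClosed_ballInter _) hb hsc h.continuous h.periodic h.injOn
    h.range_eq h12 h23 h34 h41, ?_⟩
  have := area_mul_area_neg_of_cyclic (e := e) (isClosed_ballInter _) hb hsc h.continuous
    h.periodic h.injOn h.range_eq h23 h34 h41 (by linarith : t₁ + ((n : ℝ) + 1) < _)
  rw [h.periodic t₁, mul_comm] at this
  exact this

/-- Every arc of the boundary has a point that does not lie on the circles with other labels. -/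
lemma IsBoundaryArcCycle.exists_generic (e : Module.Basis (Fin 2) ℝ E) [StrictConvexSpace ℝ E]
    (h : IsBoundaryArcCycle q ρ n γ label) (hq : Function.Injective q) (i : Fin (n + 1)) :
    ∃ t ∈ Ioo ((i : ℕ) : ℝ) ((i : ℕ) + 1), ‖γ t - q (label i)‖ = ρ ∧
      ∀ k, k ≠ label i → ‖γ t - q k‖ < ρ := by
  set I := Ioo ((i : ℕ) : ℝ) ((i : ℕ) + 1) with hI
  -- The points of this circle that lie on another one are finite in number, while the arc is
  -- infinite because `γ` is injective on it.
  set F := ⋃ k ∈ {k | k ≠ label i}, sphere (q k) ρ ∩ sphere (q (label i)) ρ with hF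
  have hFfin : F.Finite := by
    refine Set.Finite.biUnion (Set.toFinite _) fun k hk => ?_
    exact finite_sphere_inter_sphere e (fun h => hk (hq h)) ρ
  have hIsub : I ⊆ Ico 0 ((n : ℝ) + 1) := by
    intro t ht
    have h1 : ((i : ℕ) : ℝ) + 1 ≤ (n : ℝ) + 1 := by
      have : (i : ℕ) ≤ n := by omega
      have : ((i : ℕ) : ℝ) ≤ n := by exact_mod_cast this
      linarith
    have h2 : (0 : ℝ) ≤ ((i : ℕ) : ℝ) := by positivity
    exact ⟨by linarith [ht.1], by linarith [ht.2]⟩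
  have hpre : (I ∩ γ ⁻¹' F).Finite := by
    refine Set.Finite.of_finite_image (f := γ) (hFfin.subset ?_) ((h.injOn.mono hIsub).mono
      inter_subset_left)
    rintro _ ⟨t, ht, rfl⟩
    exact ht.2
  have hinf : I.Infinite := Ioo_infinite (by linarith)
  obtain ⟨t, htI, ht⟩ := (hinf.sdiff hpre).nonempty
  have hlab : ‖γ t - q (label i)‖ = ρ := by
    have := h.arc i t ⟨htI.1.le, htI.2.le⟩
    rwa [mem_sphere_iff_norm] at this
  refine ⟨t, htI, hlab, fun k hk => lt_of_le_of_ne (h.norm_le t k) fun hk' => ht ⟨htI, ?_⟩⟩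
  rw [mem_preimage, hF, mem_iUnion₂]
  exact ⟨k, hk, by rwa [mem_sphere_iff_norm], by rwa [mem_sphere_iff_norm]⟩

/-- No label occurs twice. -/
lemma IsBoundaryArcCycle.label_injective (e : Module.Basis (Fin 2) ℝ E) [StrictConvexSpace ℝ E]
    (h : IsBoundaryArcCycle q ρ n γ label) (hρ : 0 < ρ) (hq : Function.Injective q) :
    Function.Injective label := by
  choose t ht hself hlt using h.exists_generic e hq
  have hmono : ∀ i k : Fin (n + 1), i < k → t i < t k := by
    intro i k hik
    have h1 : ((i : ℕ) : ℝ) + 1 ≤ (k : ℕ) := by exact_mod_cast hik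
    linarith [(ht i).2, (ht k).1]
  have hper : ∀ i k : Fin (n + 1), t i < t k + (n + 1) := by
    intro i k
    have h1 : ((i : ℕ) : ℝ) ≤ n := by
      have : (i : ℕ) ≤ n := by omega
      exact_mod_cast this
    have h2 : (0 : ℝ) ≤ ((k : ℕ) : ℝ) := by positivity
    linarith [(ht i).2, (ht k).1]
  -- The disc about the common center of the arcs `a` and `a'` has their generic points on its
  -- circle and those of `b` and `b'` inside. The discs about the centers of `b` and `b'` do the
  -- reverse, so `Crossing.no_separating_disc` applies.
  have key : ∀ a a' b b' : Fin (n + 1), label a = label a' → label b ≠ label a →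
      label b' ≠ label a → Crossing e (γ (t a)) (γ (t a')) (γ (t b)) (γ (t b')) → False := by
    intro a a' b b' haa hb hb' hc
    refine hc.no_separating_disc (y := q (label a)) (x := q (label b)) (x' := q (label b')) hρ
      ?_ ?_ ?_ ?_ ?_ ?_ ?_ ?_ ?_ ?_ <;> rw [norm_sub_rev]
    · exact (hself a).ge
    · rw [haa]; exact (hself a').ge
    · exact (hlt b _ hb.symm).le
    · exact (hlt b' _ hb'.symm).le
    · exact hlt a _ hb
    · exact hlt a' _ (haa ▸ hb)
    · exact (hself b).ge
    · exact hlt a _ hb'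
    · exact hlt a' _ (haa ▸ hb')
    · exact (hself b').ge
  have main : ∀ i k : Fin (n + 1), i < k → label i ≠ label k := by
    intro i k hik hlab
    have hn : 0 < n := by
      have := k.2
      have : (i : ℕ) < k := hik
      omega
    have hik1 : i + 1 ≠ k := fun h1 => h.label_ne hn i (h1 ▸ hlab)
    have hi1 : ((i + 1 : Fin (n + 1)) : ℕ) = i + 1 := by
      apply Fin.val_add_one_of_lt
      exact lt_of_lt_of_le hik (Fin.le_last k)
    have hii : i < i + 1 := by rw [Fin.lt_def, hi1]; omega
    have hik2 : i + 1 < k := by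
      have : (i : ℕ) < k := hik
      have h3 : ((i + 1 : Fin (n + 1)) : ℕ) ≠ k := fun h4 => hik1 (Fin.ext h4)
      rw [Fin.lt_def, hi1]
      rw [hi1] at h3
      omega
    have hl1 : label (i + 1) ≠ label i := (h.label_ne hn i).symm
    -- The arc `i + 1` is on one side, between `i` and `k`, and the arc `k + 1` is on the other. For
    -- the last `k` the latter is the arc `0`, which precedes `i` in the linear order.
    by_cases hk : k = Fin.last n
    · have hk1 : k + 1 = 0 := by rw [hk]; exact Fin.last_add_one n
      have hl2 : label 0 ≠ label i := by
        have := h.label_ne hn k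
        rw [hk1, ← hlab] at this
        exact this.symm
      have h0i : (0 : Fin (n + 1)) < i := by
        refine Fin.pos_iff_ne_zero.2 fun h3 => hl2 ?_
        rw [h3]
      have hc := h.crossing (e := e) (hmono _ _ h0i) (hmono _ _ hii) (hmono _ _ hik2) (hper k 0)
      exact key i k 0 (i + 1) hlab hl2 hl1 hc.swap
    · have hk1 : ((k + 1 : Fin (n + 1)) : ℕ) = k + 1 :=
        Fin.val_add_one_of_lt (lt_of_le_of_ne (Fin.le_last k) hk)
      have hkk : k < k + 1 := by rw [Fin.lt_def, hk1]; omega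
      have hl2 : label (k + 1) ≠ label i := by
        rw [hlab]; exact (h.label_ne hn k).symm
      have hc := h.crossing (e := e) (hmono _ _ hii) (hmono _ _ hik2) (hmono _ _ hkk) (hper _ i)
      exact key i k (i + 1) (k + 1) hlab hl1 hl2 hc
  intro i k hik
  rcases lt_trichotomy i k with h1 | h1 | h1
  · exact absurd hik (main i k h1)
  · exact h1
  · exact absurd hik.symm (main k i h1)

/-- Four arcs in cyclic order come with four points of the boundary, each of them exposing the
label of its arc, and the segments between opposite centers cross. -/
lemma IsBoundaryArcCycle.crossing_labels [StrictConvexSpace ℝ E]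
    (h : IsBoundaryArcCycle q ρ n γ label) (hρ : 0 < ρ) (hq : Function.Injective q)
    {i : Fin 4 → Fin (n + 1)} (hi : StrictMono i) :
    ∃ x : Fin 4 → E, (∀ k, ‖x k - q (label (i k))‖ = ρ) ∧
      (∀ k l, k ≠ l → ‖x k - q (label (i l))‖ < ρ) ∧
      Crossing e (q (label (i 0))) (q (label (i 2))) (q (label (i 1))) (q (label (i 3))) := by
  choose t ht hself hlt using h.exists_generic e hq
  have hinj := h.label_injective e hρ hq
  have hmono : ∀ i k : Fin (n + 1), i < k → t i < t k := by
    intro i k hik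
    have h1 : ((i : ℕ) : ℝ) + 1 ≤ (k : ℕ) := by exact_mod_cast hik
    linarith [(ht i).2, (ht k).1]
  have hper : t (i 3) < t (i 0) + (n + 1) := by
    have h1 : ((i 3 : ℕ) : ℝ) ≤ n := by
      have : (i 3 : ℕ) ≤ n := by omega
      exact_mod_cast this
    have h2 : (0 : ℝ) ≤ ((i 0 : ℕ) : ℝ) := by positivity
    linarith [(ht (i 3)).2, (ht (i 0)).1]
  have h1 : ∀ k l, k ≠ l → ‖γ (t (i k)) - q (label (i l))‖ < ρ := fun k l hkl =>
    hlt _ _ fun h2 => hkl (hi.injective (hinj h2.symm))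
  have hc := h.crossing (e := e) (hmono _ _ (hi (by decide : (0 : Fin 4) < 1)))
    (hmono _ _ (hi (by decide : (1 : Fin 4) < 2))) (hmono _ _ (hi (by decide : (2 : Fin 4) < 3)))
    hper
  exact ⟨fun k => γ (t (i k)), fun k => hself _, h1,
    crossing_centers (x := fun k => γ (t (i k))) (q := fun k => q (label (i k)))
      (fun k => hself _) h1 hc⟩

end cycles

/-! ### Points leaving a disc whose center moves along a circle through which the origin always
stays on its boundary. -/

section exit

variable {E : Type*} [NormedAddCommGroup E] [NormedSpace ℝ E] {e : Module.Basis (Fin 2) ℝ E}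
  {r : ℝ} {q u v w : E}

/-- When the center of a disc of radius `r` moves counterclockwise along the circle with radius `r`
around the origin, `q` leaves this disc at the position `u` of the center, and does not return
within half a turn. -/
structure IsExit (e : Module.Basis (Fin 2) ℝ E) (r : ℝ) (q u : E) : Prop where
  norm_eq : ‖u‖ = r
  dist_eq : ‖q - u‖ = r
  lt_of_area_pos : ∀ v, ‖v‖ = r → 0 < area e u v → r < ‖q - v‖

/-- `v` is in the direction of `u` or comes after it in the counterclockwise order, within less
than half a turn. -/
def Before (e : Module.Basis (Fin 2) ℝ E) (u v : E) : Prop :=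
  0 < area e u v ∨ u = v

lemma Before.area_nonneg (h : Before e u v) : 0 ≤ area e u v := by
  rcases h with h | rfl
  · exact h.le
  · simp

/-- A disc meets a circle of the same radius in an arc. -/
lemma norm_sub_le_of_between [StrictConvexSpace ℝ E] (hr : 0 < r) (hu : ‖u‖ = r) (hv : ‖v‖ = r)
    (hw : ‖w‖ = r) (hqu : ‖q - u‖ ≤ r) (hqv : ‖q - v‖ ≤ r) (huw : 0 < area e u w)
    (hwv : 0 < area e w v) (huv : 0 < area e u v) : ‖q - w‖ ≤ r := by
  by_contra hneg
  push Not at hneg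
  have hc := exists_combination_of_area_ne_zero huv.ne' w
  set l := area e w v / area e u v with hl
  set m := area e u w / area e u v with hm
  have hl0 : 0 < l := by positivity
  have hm0 : 0 < m := by positivity
  -- The triangle inequality for `w = l • u + m • v`, all three vectors having norm `r`.
  have hlm : 1 ≤ l + m := by
    have h1 : ‖w‖ ≤ ‖l • u‖ + ‖m • v‖ := by
      conv_lhs => rw [hc]
      exact norm_add_le _ _
    rw [norm_smul, norm_smul, Real.norm_of_nonneg hl0.le, Real.norm_of_nonneg hm0.le, hu, hv,
      hw] at h1
    nlinarith
  have hp : 0 < l + m := by linarith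
  -- The chord `[u, v]` meets `[0, w]` at `w` divided by `l + m`. The disc about `q` contains `u`
  -- and `v` but not `w`.
  refine disc_sep_origin (e := e) (A := u) (A' := v) (u := w) (v := q) (s := m / (l + m))
    (t := 1 / (l + m)) hr (by positivity) (by rw [div_le_one hp]; linarith) (by positivity)
    (by rw [div_le_one hp]; exact hlm) ?_ hu.ge hv.ge (by rwa [norm_sub_rev])
    (by rwa [norm_sub_rev]) hw.le (by rw [norm_sub_rev]; exact hneg.le)
    (Or.inr (by rwa [norm_sub_rev])) huv.ne'
  have e1 : 1 - m / (l + m) = 1 / (l + m) * l := by field_simp; ring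
  have e2 : m / (l + m) = 1 / (l + m) * m := by field_simp
  rw [e1, e2]
  conv_lhs => rw [hc]
  module

/-- Supplies a position of the center, in the direction of `q`, at which the moving disc surely
contains `q`. -/
lemma norm_sub_radial {r : ℝ} (hr : 0 < r) (hq : q ≠ 0) (h : ‖q‖ ≤ 2 * r) :
    ‖(r / ‖q‖) • q‖ = r ∧ ‖q - (r / ‖q‖) • q‖ ≤ r := by
  have hq0 : 0 < ‖q‖ := norm_pos_iff.2 hq
  constructor
  · rw [norm_smul, Real.norm_of_nonneg (by positivity)]
    field_simp
  · have : q - (r / ‖q‖) • q = (1 - r / ‖q‖) • q := by module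
    rw [this, norm_smul, Real.norm_eq_abs]
    have h2 : |1 - r / ‖q‖| * ‖q‖ = |‖q‖ - r| := by
      rw [← abs_of_pos hq0, ← abs_mul, abs_of_pos hq0]
      congr 1
      field_simp
    rw [h2, abs_le]
    constructor <;> linarith

namespace IsExit

lemma norm_le (h : IsExit e r q u) : ‖q‖ ≤ 2 * r := by
  have := norm_add_le (q - u) u
  rw [sub_add_cancel, h.norm_eq, h.dist_eq] at this
  linarith

lemma center_ne_zero (hr : 0 < r) (h : IsExit e r q u) : u ≠ 0 := by
  rintro rfl
  have := h.norm_eq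
  rw [norm_zero] at this
  linarith

/-- The origin is at distance exactly `r` from every position of the center, so it never exits. -/
lemma ne_zero (hr : 0 < r) (h : IsExit e r q u) : q ≠ 0 := by
  rintro rfl
  obtain ⟨d, hd⟩ := exists_area_pos (e := e) (h.center_ne_zero hr)
  have hd0 : 0 < ‖d‖ := norm_pos_iff.2 (by rintro rfl; simp at hd)
  have hn : ‖(r / ‖d‖) • d‖ = r := by
    rw [norm_smul, Real.norm_of_nonneg (by positivity)]
    field_simp
  have := h.lt_of_area_pos _ hn (by rw [area_smul_right]; positivity)
  rw [zero_sub, norm_neg, hn] at this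
  exact lt_irrefl _ this

/-- The disc centered in the direction of `q` contains `q`, so this direction cannot come after the
exit position. -/
lemma area_nonneg (hr : 0 < r) (h : IsExit e r q u) : 0 ≤ area e q u := by
  by_contra hneg
  push Not at hneg
  rw [area_swap] at hneg
  have hq := h.ne_zero hr
  obtain ⟨h1, h2⟩ := norm_sub_radial hr hq h.norm_le
  have hq0 : 0 < ‖q‖ := norm_pos_iff.2 hq
  have := h.lt_of_area_pos _ h1 (by rw [area_smul_right]; exact mul_pos (by positivity) (by linarith))
  linarith

lemma eq_two_smul (hr : 0 < r) (h : IsExit e r q u) (h0 : area e u q = 0) :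
    q = (2 : ℝ) • u := by
  obtain ⟨c, rfl⟩ := exists_smul_of_area_eq_zero (h.center_ne_zero hr) h0
  have h1 := h.dist_eq
  rw [show c • u - u = (c - 1) • u by module, norm_smul, h.norm_eq] at h1
  have h2 : ‖c - 1‖ = 1 := mul_right_cancel₀ hr.ne' (h1.trans (one_mul r).symm)
  rw [Real.norm_eq_abs] at h2
  rcases eq_or_eq_neg_of_abs_eq h2 with h3 | h3
  · rw [show c = 2 by linarith]
  · exfalso
    apply h.ne_zero hr
    rw [show c = 0 by linarith, zero_smul]

lemma le_norm_add (h : IsExit e r q u) : r ≤ ‖q + u‖ := by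
  have h1 : ‖(2 : ℝ) • u‖ ≤ ‖q + u‖ + ‖q - u‖ := by
    rw [show (2 : ℝ) • u = (q + u) - (q - u) by module]
    exact norm_sub_le _ _
  rw [norm_smul, h.norm_eq, h.dist_eq] at h1
  norm_num at h1
  linarith

lemma le_norm_sub (h : IsExit e r q u) (hv : ‖v‖ = r) (hb : Before e u v) : r ≤ ‖q - v‖ := by
  rcases hb with hb | rfl
  · exact (h.lt_of_area_pos v hv hb).le
  · exact h.dist_eq.ge

/-- The disc contains `q` when its center is in the direction of `q` and again at the exit, hence at
all positions in between. -/
lemma norm_sub_le [StrictConvexSpace ℝ E] (hr : 0 < r) (h : IsExit e r q u) (hv : ‖v‖ = r)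
    (hqv : 0 ≤ area e q v) (hvu : Before e v u) : ‖q - v‖ ≤ r := by
  rcases hvu with hvu | rfl
  swap
  · exact h.dist_eq.le
  have hq := h.ne_zero hr
  have hq0 : 0 < ‖q‖ := norm_pos_iff.2 hq
  have hv0 : v ≠ 0 := by rintro rfl; simp at hvu
  have hqu := h.area_nonneg hr
  rcases hqv.eq_or_lt with h0 | h0
  · obtain ⟨c, rfl⟩ := exists_smul_of_area_eq_zero (e := e) (v := q) hv0
      (by rw [area_swap, ← h0, neg_zero])
    rw [area_smul_left] at hqu
    have hc : 0 ≤ c := by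
      by_contra hc
      push Not at hc
      nlinarith
    have h2 := h.norm_le
    rw [norm_smul, hv, Real.norm_of_nonneg hc] at h2
    rw [show c • v - v = (c - 1) • v by module, norm_smul, hv, Real.norm_eq_abs]
    have : |c - 1| ≤ 1 := by
      rw [abs_le]; constructor <;> nlinarith
    nlinarith
  · have hqu' : 0 < area e q u := by
      rcases hqu.eq_or_lt with h1 | h1
      · have := h.eq_two_smul hr (by rw [area_swap, ← h1, neg_zero])
        rw [this, area_smul_left, area_swap] at h0
        linarith
      · exact h1
    obtain ⟨h1, h2⟩ := norm_sub_radial hr hq h.norm_le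
    exact norm_sub_le_of_between hr h1 h.norm_eq hv h2 h.dist_eq.le
      (by rw [area_smul_left]; positivity) hvu (by rw [area_smul_left]; positivity)

end IsExit

/-- If a segment meets the ray from the origin through `w`, and its end points are on the two sides
of the circles around `w` and `-w`, then every disc that contains the segment contains the origin. -/
lemma norm_lt_of_segment_meets_ray [StrictConvexSpace ℝ E] {p x : E} {κ : ℝ} (e : Module.Basis (Fin 2) ℝ E)
    (hr : 0 < r) (hw : ‖w‖ = r) (hp : r ≤ ‖p - w‖) (hq : ‖q + w‖ ≤ r) (hκ : 0 ≤ κ)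
    (hz : κ • w ∈ segment ℝ p q) (hpq : ‖p - q‖ < 2 * r) (hxp : ‖x - p‖ < r)
    (hxq : ‖x - q‖ < r) : ‖x‖ < r := by
  obtain ⟨s, hs0, hs1, hs⟩ := mem_segment_iff_exists.1 hz
  -- For `κ ≥ 1` the triangle inequality, applied along `[p, q]` and along the line through `w`,
  -- would make `[p, q]` at least `2 * r` long.
  have hκ1 : κ < 1 := by
    by_contra hκ1
    push Not at hκ1
    have f1 : ‖q - κ • w‖ = (1 - s) * ‖p - q‖ := by
      rw [hs, show q - ((1 - s) • p + s • q) = -((1 - s) • (p - q)) by module, norm_neg, norm_smul,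
        Real.norm_of_nonneg (by linarith)]
    have f2 : ‖p - κ • w‖ = s * ‖p - q‖ := by
      rw [hs, show p - ((1 - s) • p + s • q) = s • (p - q) by module, norm_smul,
        Real.norm_of_nonneg hs0]
    have f3 : (1 + κ) * r ≤ ‖q - κ • w‖ + ‖q + w‖ := by
      have := norm_sub_le (q + w) (q - κ • w)
      rw [show q + w - (q - κ • w) = (1 + κ) • w by module, norm_smul, hw,
        Real.norm_of_nonneg (by linarith)] at this
      linarith
    have f4 : ‖p - w‖ ≤ ‖p - κ • w‖ + (κ - 1) * r := by
      have := norm_add_le (p - κ • w) ((κ - 1) • w)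
      rw [show p - κ • w + (κ - 1) • w = p - w by module, norm_smul, hw,
        Real.norm_of_nonneg (by linarith)] at this
      linarith
    nlinarith
  by_contra hx
  push Not at hx
  have hq' : r ≤ ‖w - q‖ := by
    have := norm_add_le (w - q) (q + w)
    rw [show w - q + (q + w) = (2 : ℝ) • w by module, norm_smul, hw] at this
    norm_num at this
    linarith
  -- The disc about `w` contains `0` but not `p` and `q`. If the disc about `x` missed `0`, then
  -- `[p, q]` could not meet `[w, 0]`, although `κ • w` is on both.
  refine disc_sep e hr (a := p) (a' := q) (y := w) (b := 0) (x := x) (by rwa [norm_sub_rev]) hq'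
    (by simpa using hw.le) hxp hxq (by simpa using hx) hz ?_
  exact mem_segment_iff_exists.2 ⟨1 - κ, by linarith, by linarith, by simp⟩

/-- A segment from `p` to the line through `y` meets the ray opposite to `u`. -/
lemma exists_mem_ray {p y : E} {k : ℝ} (huy : 0 < area e u y) (hyp : 0 ≤ area e y p)
    (h : area e u p * k ≤ 0) : ∃ κ : ℝ, 0 ≤ κ ∧ κ • (-u) ∈ segment ℝ p (k • y) := by
  obtain ⟨t, ht0, ht1, ht⟩ := exists_combination_eq_zero (f := area e u p) (g := k * area e u y)
    (by nlinarith)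
  have hu : u ≠ 0 := by rintro rfl; simp at huy
  obtain ⟨m, hm⟩ := exists_smul_of_area_eq_zero (e := e) (v := (1 - t) • p + t • k • y) hu
    (by simp only [area_add_right, area_smul_right]; exact ht)
  have h1 : area e y ((1 - t) • p + t • k • y) = area e y (m • u) := by rw [hm]
  simp only [area_add_right, area_smul_right, area_self] at h1
  rw [area_swap e y u] at h1
  have hm0 : m ≤ 0 := by nlinarith [mul_nonneg (sub_nonneg.2 ht1) hyp]
  refine ⟨-m, by linarith, mem_segment_iff_exists.2 ⟨t, ht0, ht1, ?_⟩⟩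
  rw [hm]; module

/-- An open disc containing `0`, `p` and `q` contains their triangle. -/
lemma norm_sub_combination_lt {p x : E} {l m : ℝ} (hl : 0 ≤ l) (hm : 0 ≤ m) (hlm : l + m ≤ 1)
    (hx : ‖x‖ < r) (hp : ‖x - p‖ < r) (hq : ‖x - q‖ < r) : ‖x - (l • p + m • q)‖ < r := by
  have h1 : x - (l • p + m • q) = (1 - l - m) • x + l • (x - p) + m • (x - q) := by module
  have h2 : ‖x - (l • p + m • q)‖ ≤ (1 - l - m) * ‖x‖ + l * ‖x - p‖ + m * ‖x - q‖ := by
    rw [h1]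
    refine (norm_add₃_le).trans ?_
    rw [norm_smul, norm_smul, norm_smul, Real.norm_of_nonneg (by linarith),
      Real.norm_of_nonneg hl, Real.norm_of_nonneg hm]
  set M := max ‖x‖ (max ‖x - p‖ ‖x - q‖) with hM
  have hMr : M < r := max_lt hx (max_lt hp hq)
  have g1 : ‖x‖ ≤ M := le_max_left _ _
  have g2 : ‖x - p‖ ≤ M := (le_max_left _ _).trans (le_max_right _ _)
  have g3 : ‖x - q‖ ≤ M := (le_max_right _ _).trans (le_max_right _ _)
  nlinarith [mul_le_mul_of_nonneg_left g1 (by linarith : 0 ≤ 1 - l - m),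
    mul_le_mul_of_nonneg_left g2 hl, mul_le_mul_of_nonneg_left g3 hm]

/-- As `a` is weakly to the right of `ua` and to the left of `y`, the part of `[a, a']` from `a` to
the ray through `y` meets the ray through `-ua`. The position `-ua` comes after the exit of `a'`, so
`norm_lt_of_segment_meets_ray` applies with `w = -ua`. -/
lemma norm_lt_of_left_right [StrictConvexSpace ℝ E] {a a' x y ua ua' : E} {κ τ : ℝ} (hr : 0 < r)
    (ha : IsExit e r a ua) (ha' : IsExit e r a' ua') (hy : Before e ua y) (hy' : Before e ua' y)
    (hord : Before e ua ua' ∨ Before e ua' ua) (hleft : 0 < area e y a) (hright : area e y a' ≤ 0)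
    (hκ : 0 ≤ κ) (hτ0 : 0 ≤ τ) (hτ1 : τ ≤ 1) (hz : κ • y = (1 - τ) • a + τ • a')
    (hd : ‖a - a'‖ < 2 * r) (hxa : ‖x - a‖ < r) (hxa' : ‖x - a'‖ < r) : ‖x‖ < r := by
  have f1 := ha.area_nonneg hr
  have f1' := ha'.area_nonneg hr
  rw [area_swap] at f1 f1'
  have huy : 0 < area e ua y := by
    rcases hy with h | h
    · exact h
    · rw [h] at f1; linarith
  obtain ⟨m, hm, hmem⟩ := exists_mem_ray (k := κ) huy hleft.le (by nlinarith)
  have hmem' : m • (-ua) ∈ segment ℝ a' a := by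
    have hzs : κ • y ∈ segment ℝ a a' := mem_segment_iff_exists.2 ⟨τ, hτ0, hτ1, hz⟩
    rw [segment_symm]
    exact (convex_segment a a').segment_subset (left_mem_segment _ _ _) hzs hmem
  refine norm_lt_of_segment_meets_ray e hr (by rw [norm_neg]; exact ha.norm_eq) ?_
    (by rw [← sub_eq_add_neg]; exact ha.dist_eq.le) hm hmem' (by rwa [norm_sub_rev]) hxa' hxa
  rw [sub_neg_eq_add]
  have hb : Before e ua ua' → r ≤ ‖a' + ua‖ := by
    rintro (h | h)
    · have := ha'.lt_of_area_pos (-ua) (by rw [norm_neg]; exact ha.norm_eq)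
        (by rw [area_neg_right, area_swap, neg_neg]; exact h)
      rw [sub_neg_eq_add] at this
      exact this.le
    · rw [h]; exact ha'.le_norm_add
  rcases hord with h | h
  · exact hb h
  rcases h with h | h
  swap
  · exact hb (Or.inr h.symm)
  exfalso
  have g1 : area e ua (κ • y) = (1 - τ) * area e ua a + τ * area e ua a' := by
    rw [hz]; simp only [area_add_right, area_smul_right]
  have g2 : area e y (κ • y) = (1 - τ) * area e y a + τ * area e y a' := by
    rw [hz]; simp only [area_add_right, area_smul_right]
  rw [area_smul_right] at g1 g2
  rw [area_self, mul_zero] at g2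
  have hτ : 0 < τ := by
    rcases hτ0.eq_or_lt with h0 | h0
    · rw [← h0] at g2; linarith
    · exact h0
  have g3 : 0 ≤ area e ua a' := by
    by_contra hc
    push Not at hc
    nlinarith [mul_nonneg hκ huy.le, mul_nonneg (sub_nonneg.2 hτ1) (by linarith : 0 ≤ -area e ua a)]
  have huy' : 0 < area e ua' y := by
    rcases hy' with h' | h'
    · exact h'
    · rw [h', area_swap] at h; linarith
  -- If `ua'` came strictly before `ua`, all three terms of this relation would be nonnegative,
  -- hence zero. Then `a'` is `2 • ua'` and also on the line through `y`, which is impossible.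
  have hpl := area_plucker e ua' y ua a'
  rw [area_swap e y ua] at hpl
  have t1 : 0 ≤ area e ua' y * area e ua a' := mul_nonneg huy'.le g3
  have t2 : 0 ≤ area e ua' ua * -area e y a' := mul_nonneg h.le (by linarith)
  have t3 : 0 ≤ -area e ua' a' * area e ua y := mul_nonneg (by linarith) huy.le
  have t4 : area e ua' a' = 0 := by
    have : -area e ua' a' * area e ua y = 0 := by nlinarith
    rcases mul_eq_zero.1 this with h' | h'
    · linarith
    · linarith
  have t5 : area e y a' = 0 := by
    have : area e ua' ua * -area e y a' = 0 := by nlinarith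
    rcases mul_eq_zero.1 this with h' | h'
    · linarith
    · linarith
  have t6 := ha'.eq_two_smul hr t4
  rw [t6, area_smul_right, area_swap] at t5
  linarith

/-- The segment `[b, b']` meets the ray through `-u`, with `b` in the disc about `u` and `b'` not
inside the disc about `-u`, so `norm_lt_of_segment_meets_ray` applies with `w = -u`. -/
lemma norm_lt_of_diagonal [StrictConvexSpace ℝ E] {b b' x y : E} {k : ℝ} (hr : 0 < r)
    (hb : IsExit e r b y) (hu : ‖u‖ = r) (hub' : 0 < area e u b') (hyb' : 0 < area e y b')
    (huy : Before e u y) (hle : r ≤ ‖b' + u‖) (hk : k ≤ 0) (hz : k • y ∈ segment ℝ b b')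
    (hd : ‖b - b'‖ < 2 * r) (hxb : ‖x - b‖ < r) (hxb' : ‖x - b'‖ < r) : ‖x‖ < r := by
  obtain ⟨κ, hκ, hmem⟩ : ∃ κ : ℝ, 0 ≤ κ ∧ κ • (-u) ∈ segment ℝ b b' := by
    rcases huy with h | h
    · obtain ⟨κ, hκ, hmem⟩ := exists_mem_ray (k := k) h hyb'.le (by nlinarith)
      exact ⟨κ, hκ, (convex_segment b b').segment_subset (right_mem_segment _ _ _) hz hmem⟩
    · exact ⟨-k, by linarith, by rw [h]; simpa using hz⟩
  have hub : 0 ≤ area e b u := by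
    obtain ⟨s, hs0, hs1, hs⟩ := mem_segment_iff_exists.1 hmem
    have h1 : area e u (κ • (-u)) = (1 - s) * area e u b + s * area e u b' := by
      rw [hs]; simp only [area_add_right, area_smul_right]
    simp only [area_smul_right, area_neg_right, area_self] at h1
    rw [area_swap]
    by_contra hc
    push Not at hc
    have h2 : 0 < area e u b := by linarith
    rcases hs1.eq_or_lt with h3 | h3
    · rw [h3] at h1; linarith
    · nlinarith [mul_nonneg hs0 hub'.le, mul_pos (by linarith : 0 < 1 - s) h2]
  have hbu := hb.norm_sub_le hr hu hub huy
  exact norm_lt_of_segment_meets_ray e hr (by rwa [norm_neg]) (by rwa [sub_neg_eq_add])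
    (by rwa [← sub_eq_add_neg]) hκ (by rw [segment_symm]; exact hmem) (by rwa [norm_sub_rev]) hxb'
    hxb

end exit

lemma norm_sub_lt_two_mul {E : Type*} [NormedAddCommGroup E] {r : ℝ} {x p q : E}
    (hp : ‖x - p‖ < r) (hq : ‖x - q‖ < r) : ‖p - q‖ < 2 * r := by
  have := norm_sub_le (x - q) (x - p)
  rw [sub_sub_sub_cancel_left] at this
  linarith

/-! ### The sweep does not separate the diagonals of a quadrilateral. -/

section quad

variable {E : Type*} [NormedAddCommGroup E] [NormedSpace ℝ E] {e : Module.Basis (Fin 2) ℝ E}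
  {r : ℝ} {a a' b b' ua ua' ub ub' xa xa' xb xb' : E}

/-- Four points with crossing diagonals `[a, a']` and `[b, b']`, each of which can be separated from
the other ones by the complement of a disc of radius `r`, such that the sweep leaves `a` and `a'`
before `b`, and `b` before `b'`. -/
structure SweepQuad (e : Module.Basis (Fin 2) ℝ E) (r : ℝ)
    (a a' b b' ua ua' ub ub' xa xa' xb xb' : E) : Prop where
  r_pos : 0 < r
  exit_a : IsExit e r a ua
  exit_a' : IsExit e r a' ua'
  exit_b : IsExit e r b ub
  exit_b' : IsExit e r b' ub'
  before_ab : Before e ua ub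
  before_a'b : Before e ua' ub
  before_bb' : Before e ub ub'
  before_ab' : Before e ua ub'
  before_a'b' : Before e ua' ub'
  before_aa' : Before e ua ua' ∨ Before e ua' ua
  xa_a : r ≤ ‖xa - a‖
  xa_a' : ‖xa - a'‖ < r
  xa_b : ‖xa - b‖ < r
  xa_b' : ‖xa - b'‖ < r
  xa'_a : ‖xa' - a‖ < r
  xa'_a' : r ≤ ‖xa' - a'‖
  xa'_b : ‖xa' - b‖ < r
  xa'_b' : ‖xa' - b'‖ < r
  xb_a : ‖xb - a‖ < r
  xb_a' : ‖xb - a'‖ < r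
  xb_b : r ≤ ‖xb - b‖
  xb_b' : ‖xb - b'‖ < r
  xb'_a : ‖xb' - a‖ < r
  xb'_a' : ‖xb' - a'‖ < r
  xb'_b : ‖xb' - b‖ < r
  xb'_b' : r ≤ ‖xb' - b'‖
  cross : Crossing e a a' b b'

namespace SweepQuad

lemma symm (h : SweepQuad e r a a' b b' ua ua' ub ub' xa xa' xb xb') :
    SweepQuad e r a' a b b' ua' ua ub ub' xa' xa xb xb' where
  r_pos := h.r_pos
  exit_a := h.exit_a'
  exit_a' := h.exit_a
  exit_b := h.exit_b
  exit_b' := h.exit_b'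
  before_ab := h.before_a'b
  before_a'b := h.before_ab
  before_bb' := h.before_bb'
  before_ab' := h.before_a'b'
  before_a'b' := h.before_ab'
  before_aa' := h.before_aa'.symm
  xa_a := h.xa'_a'
  xa_a' := h.xa'_a
  xa_b := h.xa'_b
  xa_b' := h.xa'_b'
  xa'_a := h.xa_a'
  xa'_a' := h.xa_a
  xa'_b := h.xa_b
  xa'_b' := h.xa_b'
  xb_a := h.xb_a'
  xb_a' := h.xb_a
  xb_b := h.xb_b
  xb_b' := h.xb_b'
  xb'_a := h.xb'_a'
  xb'_a' := h.xb'_a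
  xb'_b := h.xb'_b
  xb'_b' := h.xb'_b'
  cross := h.cross.swap_left

lemma le_norm_sub_a (h : SweepQuad e r a a' b b' ua ua' ub ub' xa xa' xb xb') : r ≤ ‖ub - a‖ := by
  rw [norm_sub_rev]; exact h.exit_a.le_norm_sub h.exit_b.norm_eq h.before_ab

/-- The disc about `ub` itself would separate `b, b'` from `a, a'`. -/
lemma not_near [StrictConvexSpace ℝ E] (h : SweepQuad e r a a' b b' ua ua' ub ub' xa xa' xb xb')
    (hb' : ‖b' - ub‖ ≤ r) : False :=
  h.cross.no_separating_disc h.r_pos h.le_norm_sub_a h.symm.le_norm_sub_a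
    (by rw [norm_sub_rev]; exact h.exit_b.dist_eq.le) (by rwa [norm_sub_rev]) h.xb_a h.xb_a' h.xb_b
    h.xb'_a h.xb'_a' h.xb'_b'

lemma area_b_nonpos (h : SweepQuad e r a a' b b' ua ua' ub ub' xa xa' xb xb') :
    area e ub b ≤ 0 := by
  have := h.exit_b.area_nonneg h.r_pos
  rw [area_swap] at this
  linarith

lemma area_ub'_pos (h : SweepQuad e r a a' b b' ua ua' ub ub' xa xa' xb xb')
    (hfar : r < ‖b' - ub‖) : 0 < area e ub ub' := by
  rcases h.before_bb' with h1 | h1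
  · exact h1
  · rw [h1, h.exit_b'.dist_eq] at hfar
    exact absurd hfar (lt_irrefl _)

/-- A point on the ray through `ub` outside of the disc around `ub` is its end point. -/
lemma eq_two_of_on_ray (h : SweepQuad e r a a' b b' ua ua' ub ub' xa xa' xb xb') {α : ℝ}
    (hα : 0 < α) (ha : a = α • ub) : α = 2 := by
  have hr := h.r_pos
  have hnorm : ‖ub‖ = r := h.exit_b.norm_eq
  have h1 := h.exit_a.norm_le
  rw [ha, norm_smul, hnorm, Real.norm_of_nonneg hα.le] at h1
  have h2 := h.le_norm_sub_a
  rw [ha, show ub - α • ub = (1 - α) • ub by module, norm_smul, hnorm, Real.norm_eq_abs] at h2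
  have h3 : α ≤ 2 := by nlinarith
  have h4 : 1 ≤ |1 - α| := by
    by_contra hc
    push Not at hc
    nlinarith
  rcases le_abs.1 h4 with h5 | h5 <;> linarith

section far

variable [StrictConvexSpace ℝ E]

/-- Were `b'` weakly to the right of `ub`, the position `ub` would be between the direction of `b'`
and its exit, and the disc there would contain `b'`. -/
lemma area_b'_pos (h : SweepQuad e r a a' b b' ua ua' ub ub' xa xa' xb xb')
    (hfar : r < ‖b' - ub‖) : 0 < area e ub b' := by
  by_contra hc
  have := h.exit_b'.norm_sub_le h.r_pos h.exit_b.norm_eq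
    (by rw [area_swap]; linarith [not_lt.1 hc]) h.before_bb'
  linarith

lemma area_uab'_pos (h : SweepQuad e r a a' b b' ua ua' ub ub' xa xa' xb xb')
    (hfar : r < ‖b' - ub‖) : 0 < area e ua ub' := by
  rcases h.before_ab' with h1 | h1
  · exact h1
  · have h2 := h.area_ub'_pos hfar
    have h3 := h.before_ab.area_nonneg
    rw [h1, area_swap] at h3
    linarith

lemma area_ua_b'_pos (h : SweepQuad e r a a' b b' ua ua' ub ub' xa xa' xb xb')
    (hfar : r < ‖b' - ub‖) : 0 < area e ua b' := by
  have h1 := h.area_b'_pos hfar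
  have h2 := h.area_ub'_pos hfar
  have h3 := h.area_uab'_pos hfar
  have h4 := h.exit_b'.area_nonneg h.r_pos
  have h5 := h.before_ab.area_nonneg
  have hp := area_plucker e ua b' ub ub'
  rw [area_swap e b' ub] at hp
  have : 0 < area e ua b' * area e ub ub' := by
    nlinarith [mul_nonneg h5 h4, mul_pos h3 h1]
  exact pos_of_mul_pos_left this h2.le

/-- The position `-ua` comes after `ub'` within half a turn, when `b'` has already left. -/
lemma le_norm_b'_add (h : SweepQuad e r a a' b b' ua ua' ub ub' xa xa' xb xb')
    (hfar : r < ‖b' - ub‖) : r ≤ ‖b' + ua‖ := by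
  have := h.exit_b'.lt_of_area_pos (-ua) (by rw [norm_neg]; exact h.exit_a.norm_eq)
    (by rw [area_neg_right, area_swap, neg_neg]; exact h.area_uab'_pos hfar)
  rw [sub_neg_eq_add] at this
  exact this.le

/-- If `a` is on the left of the line through `0` and `ub`, then it comes after `b'`. -/
lemma area_b'_a_pos (h : SweepQuad e r a a' b b' ua ua' ub ub' xa xa' xb xb')
    (hfar : r < ‖b' - ub‖) (hleft : 0 < area e ub a) : 0 < area e b' a := by
  have h1 := h.area_b'_pos hfar
  have h2 := h.area_ua_b'_pos hfar
  have h3 := h.exit_a.area_nonneg h.r_pos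
  rw [area_swap] at h3
  have h4 : 0 < area e ua ub := by
    rcases h.before_ab with h5 | h5
    · exact h5
    · rw [h5] at h3; linarith
  have hp := area_plucker e ua ub b' a
  have : 0 < area e ua ub * area e b' a := by
    nlinarith [mul_pos h2 hleft, mul_nonneg (neg_nonneg.2 (neg_nonneg.1 h3)) h1.le]
  exact pos_of_mul_pos_right this h4.le

set_option maxHeartbeats 1000000 in
/-- The case that `[b, b']` does not pass between `0` and the position `ub`. -/
lemma not_behind_of_neg (h : SweepQuad e r a a' b b' ua ua' ub ub' xa xa' xb xb')
    (hfar : r < ‖b' - ub‖) {k s : ℝ} (hk : k ≤ 0) (hs0 : 0 ≤ s) (hs1 : s ≤ 1)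
    (hP : k • ub = (1 - s) • b + s • b') (hσ : area e (b' - b) (a - b) < 0) : False := by
  have hr := h.r_pos
  have hyb' := h.area_b'_pos hfar
  have hub0 := h.exit_b.center_ne_zero hr
  -- The open disc about `xa` contains the origin, hence the triangle `0, b, b'`; it does not
  -- contain `a`.
  have hxa := norm_lt_of_diagonal hr h.exit_b h.exit_a.norm_eq (h.area_ua_b'_pos hfar) hyb'
    h.before_ab (h.le_norm_b'_add hfar) hk (mem_segment_iff_exists.2 ⟨s, hs0, hs1, hP⟩)
    (norm_sub_lt_two_mul h.xa_b h.xa_b') h.xa_b h.xa_b'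
  have g1 : k * area e ub b' = (1 - s) * area e b b' := by
    have := congrArg (fun z => area e z b') hP
    simpa only [area_add_left, area_smul_left, area_self, mul_zero, add_zero] using this
  have g2 : 0 = (1 - s) * area e ub b + s * area e ub b' := by
    have := congrArg (fun z => area e ub z) hP
    simpa only [area_add_right, area_smul_right, area_self, mul_zero, add_zero] using this
  have hs1' : s < 1 := by
    rcases hs1.eq_or_lt with h1 | h1
    · rw [h1] at g2; linarith
    · exact h1
  -- The origin is weakly on the same side of the line through `b` and `b'` as `a`.
  have hW : area e b b' ≤ 0 := by
    by_contra hc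
    push Not at hc
    nlinarith [mul_pos (by linarith : 0 < 1 - s) hc]
  have hyb : area e ub b < 0 := by
    rcases h.area_b_nonpos.eq_or_lt with h1 | h1
    · exfalso
      have h2 := h.exit_b.eq_two_smul hr h1
      rw [h1, mul_zero, zero_add] at g2
      have hs : s = 0 := by
        rcases mul_eq_zero.1 g2.symm with h3 | h3
        · exact h3
        · linarith
      rw [hs, h2] at hP
      have h4 : (k - 2) • ub = 0 := by
        rw [sub_smul, hP]; module
      rcases smul_eq_zero.1 h4 with h5 | h5
      · linarith
      · exact hub0 h5
    · exact h1
  have hs : 0 < s := by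
    rcases hs0.eq_or_lt with h1 | h1
    · rw [← h1] at g2; linarith
    · exact h1
  have hσ' : area e b' a - area e b a + area e b b' < 0 := by
    have : area e (b' - b) (a - b) = area e b' a - area e b a + area e b b' := by
      simp only [area_sub_left, area_sub_right, area_self]
      rw [area_swap e b' b]
      ring
    linarith
  -- `a` is not in the cone over `[b, b']`
  have hcone : ∀ l m : ℝ, 0 ≤ l → 0 ≤ m → a = l • b + m • b' → False := by
    intro l m hl hm ha
    have h1 : area e b b' * (1 - l - m) < 0 := by
      rw [ha] at hσ'
      simp only [area_add_right, area_smul_right, area_self, area_swap e b' b] at hσ'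
      nlinarith
    have h2 : l + m ≤ 1 := by nlinarith
    have h3 := norm_sub_combination_lt hl hm h2 hxa h.xa_b h.xa_b'
    rw [← ha] at h3
    linarith [h.xa_a]
  -- the case that `0` is on `[b, b']`
  have hk0 : k = 0 → ∀ z, (1 - s) * area e b z = -(s * area e b' z) := by
    intro hk0 z
    have := congrArg (fun w => area e w z) hP
    simp only [area_add_left, area_smul_left, hk0, zero_mul] at this
    linarith
  have hWk : k = 0 → area e b b' = 0 := by
    intro hk0
    rw [hk0, zero_mul] at g1
    rcases mul_eq_zero.1 g1.symm with h1 | h1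
    · linarith
    · exact h1
  -- For negative `k` the vector `-ub` is in the cone over `[b, b']`.
  have hconek : k < 0 → ∀ c d f : ℝ, 0 ≤ c → 0 ≤ d → f ≤ 0 → a = c • b + d • b' + f • ub →
      False := by
    intro hk c d f hc hd hf ha
    have hfk : 0 ≤ f / k := div_nonneg_of_nonpos hf hk.le
    refine hcone (c + f / k * (1 - s)) (d + f / k * s)
      (add_nonneg hc (mul_nonneg hfk (by linarith))) (add_nonneg hd (mul_nonneg hfk hs0)) ?_
    have : f • ub = (f / k) • ((1 - s) • b + s • b') := by
      rw [← hP, smul_smul, div_mul_cancel₀ _ hk.ne]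
    rw [ha, this]
    module
  -- If `a` were to the left of `ub`, it would come after `b'` and be in the cone of `b'` and `-ub`,
  -- which is excluded. For `k = 0` the vectors `b` and `b'` point in opposite directions, and `hσ'`
  -- is contradicted directly.
  have hay : 0 ≤ area e a ub := by
    by_contra hc
    push Not at hc
    rw [area_swap] at hc
    have hleft : 0 < area e ub a := by linarith
    have hb'a := h.area_b'_a_pos hfar hleft
    rcases hk.eq_or_lt with h0 | h0
    · have h1 := hk0 h0 a
      have h2 := hWk h0
      have h3 : area e b a ≤ 0 := by
        by_contra h4
        push Not at h4
        nlinarith [mul_pos (by linarith : 0 < 1 - s) h4, mul_pos hs hb'a]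
      linarith
    · have hne : area e b' ub ≠ 0 := by rw [area_swap]; linarith
      have hd : area e b' ub < 0 := by rw [area_swap]; linarith
      have ha := exists_combination_of_area_ne_zero hne a
      refine hconek h0 0 _ _ le_rfl ?_ ?_ (ha.trans (by rw [zero_smul, zero_add]))
      · exact div_nonneg_of_nonpos (by rw [area_swap]; linarith) hd.le
      · exact div_nonpos_of_nonneg_of_nonpos hb'a.le hd.le
  have hby : 0 < area e b ub := by rw [area_swap]; linarith
  have ha := exists_combination_of_area_ne_zero hby.ne' a
  have hba : 0 ≤ area e b a := by
    by_contra hc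
    push Not at hc
    rcases hk.eq_or_lt with h0 | h0
    · have h1 := hk0 h0 a
      have h2 := hWk h0
      have h3 : 0 ≤ area e b' a := by
        by_contra h4
        push Not at h4
        nlinarith
      linarith
    · refine hconek h0 _ 0 _ (div_nonneg hay hby.le) le_rfl
        (div_nonpos_of_nonpos_of_nonneg hc.le hby.le) (ha.trans (by rw [zero_smul, add_zero]))
  set l := area e a ub / area e b ub with hl
  set m := area e b a / area e b ub with hm
  have hl0 : 0 ≤ l := div_nonneg hay hby.le
  have hm0 : 0 ≤ m := div_nonneg hba hby.le
  -- Otherwise `a` is in the triangle `0, b, ub`, and the estimate of `‖a - ub‖` leaves only a point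
  -- of `[0, b]`.
  have hlm : 1 < l + m := by
    by_contra hc
    push Not at hc
    have h1 : ‖a - ub‖ ≤ l * r + (1 - l - m) * r := by
      have h2 : a - ub = l • (b - ub) - (1 - l - m) • ub := by
        conv_lhs => rw [ha]
        module
      rw [h2]
      refine (norm_sub_le _ _).trans ?_
      rw [norm_smul, norm_smul, Real.norm_of_nonneg hl0, Real.norm_of_nonneg (by linarith),
        h.exit_b.dist_eq, h.exit_b.norm_eq]
    have h3 := h.le_norm_sub_a
    rw [norm_sub_rev] at h3
    have h4 : m = 0 := by nlinarith
    rw [h4, zero_smul, add_zero] at ha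
    exact hcone l 0 hl0 le_rfl (by rw [zero_smul, add_zero]; exact ha)
  have hlm0 : 0 < l + m := by linarith
  have hya := h.le_norm_sub_a
  have hyb2 : ‖ub - b‖ ≤ r := by rw [norm_sub_rev]; exact h.exit_b.dist_eq.le
  -- Now `[0, a]` meets `[ub, b]`. If the disc about `xb` contained `0` besides `a`, this would
  -- contradict `disc_sep`.
  have hxb : r ≤ ‖xb‖ := by
    by_contra hc
    push Not at hc
    refine disc_sep e hr (a := 0) (a' := a) (z := (1 / (l + m)) • a)
      (by rw [sub_zero]; exact h.exit_b.norm_eq.ge) hya hyb2 (by rwa [sub_zero]) h.xb_a h.xb_b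
      (mem_segment_iff_exists.2 ⟨1 / (l + m), by positivity, by rw [div_le_one hlm0]; exact hlm.le,
        by simp⟩)
      (mem_segment_iff_exists.2 ⟨l / (l + m), by positivity,
        by rw [div_le_one hlm0]; linarith, ?_⟩)
    have e1 : 1 - l / (l + m) = 1 / (l + m) * m := by field_simp; ring
    have e2 : l / (l + m) = 1 / (l + m) * l := by field_simp
    rw [e1, e2]
    conv_lhs => rw [ha]
    module
  -- points of `[a, a']` on the side of `0` of the line through `b` and `b'`
  have key : ∀ (z : E) (l₁ m₁ : ℝ), z ∈ segment ℝ a a' → z = l₁ • b + m₁ • ub → 0 ≤ l₁ →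
      l₁ + m₁ ≤ 1 → area e (b' - b) (z - b) ≤ 0 → False := by
    intro z l₁ m₁ hz hzc hl₁ hlm₁ hσz
    have hσy : area e (b' - b) (ub - b) < 0 := by
      simp only [area_sub_left, area_sub_right, area_self]
      rw [area_swap e b' b, area_swap e b' ub]
      linarith
    -- The parameter at which the path from `a` to `z` meets the line through `ub` and `b`, where
    -- the coefficients sum to 1. The meeting point turns out to be on `[ub, b]`, against
    -- `disc_sep`.
    set t := (l + m - 1) / (l + m - (l₁ + m₁)) with ht
    have hd : 0 < l + m - (l₁ + m₁) := by linarith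
    have ht0 : 0 ≤ t := div_nonneg (by linarith) hd.le
    have ht1 : t ≤ 1 := by rw [ht, div_le_one hd]; linarith
    set l₂ := (1 - t) * l + t * l₁ with hl₂
    have hw : (1 - t) • a + t • z = l₂ • b + (1 - l₂) • ub := by
      have e1 : (1 - t) * m + t * m₁ = 1 - l₂ := by
        rw [hl₂, ht]; field_simp; ring
      rw [← e1, hzc, hl₂]
      conv_lhs => rw [ha]
      module
    have hσw : area e (b' - b) (((1 - t) • a + t • z) - b) ≤ 0 := by
      have : area e (b' - b) (((1 - t) • a + t • z) - b) =
          (1 - t) * area e (b' - b) (a - b) + t * area e (b' - b) (z - b) := by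
        simp only [area_sub_left, area_sub_right, area_add_right, area_smul_right]; ring
      rw [this]
      nlinarith [mul_nonneg (sub_nonneg.2 ht1) (neg_nonneg.2 hσ.le),
        mul_nonneg ht0 (neg_nonneg.2 hσz)]
    have hl₂1 : l₂ ≤ 1 := by
      rw [hw] at hσw
      have : area e (b' - b) ((l₂ • b + (1 - l₂) • ub) - b) =
          (1 - l₂) * area e (b' - b) (ub - b) := by
        simp only [area_sub_left, area_sub_right, area_add_right, area_smul_right]; ring
      rw [this] at hσw
      nlinarith
    have hl₂0 : 0 ≤ l₂ := add_nonneg (mul_nonneg (sub_nonneg.2 ht1) hl0) (mul_nonneg ht0 hl₁)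
    refine disc_sep e hr hya h.symm.le_norm_sub_a hyb2 h.xb_a h.xb_a' h.xb_b
      (z := (1 - t) • a + t • z) ?_ ?_
    · exact (convex_segment a a').segment_subset (left_mem_segment _ _ _) hz
        (mem_segment_iff_exists.2 ⟨t, ht0, ht1, rfl⟩)
    · rw [hw]
      exact mem_segment_iff_exists.2 ⟨l₂, hl₂0, hl₂1, add_comm _ _⟩
  obtain ⟨s₀, t₀, hs00, hs01, ht00, ht01, hx⟩ := h.cross.exists_point
  set x₀ := (1 - s₀) • a + s₀ • a' with hx₀
  have hx₀mem : x₀ ∈ segment ℝ a a' := mem_segment_iff_exists.2 ⟨s₀, hs00.le, hs01.le, hx₀⟩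
  have hσx : area e (b' - b) (x₀ - b) = 0 := by
    rw [hx]; simp only [area_sub_left, area_sub_right, area_add_right, area_smul_right, area_self]
    rw [area_swap e b' b]; ring
  have hyx : area e ub x₀ = (1 - t₀) * area e ub b + t₀ * area e ub b' := by
    rw [hx]; simp only [area_add_right, area_smul_right]
  -- If the crossing point `x₀` is weakly to the right of `ub`, then it is between `b` and `k • ub`,
  -- and `key` applies to it.
  rcases le_or_gt (area e ub x₀) 0 with h0 | h0
  · have hts : t₀ ≤ s := by
      by_contra hc
      push Not at hc
      nlinarith
    have hb' : b' = (k / s) • ub - ((1 - s) / s) • b := by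
      have : b' = s⁻¹ • (k • ub - (1 - s) • b) := by
        rw [hP, add_sub_cancel_left, smul_smul, inv_mul_cancel₀ hs.ne', one_smul]
      rw [this, div_eq_inv_mul, div_eq_inv_mul]; module
    refine key x₀ (1 - t₀ / s) (t₀ / s * k) hx₀mem ?_ ?_ ?_ hσx.le
    · have e1 : 1 - t₀ / s = (1 - t₀) - t₀ * ((1 - s) / s) := by field_simp; ring
      have e2 : t₀ / s * k = t₀ * (k / s) := by ring
      rw [hx, e1, e2]
      conv_lhs => rw [hb']
      module
    · rw [sub_nonneg, div_le_one hs]; exact hts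
    · have : 0 ≤ t₀ / s := by positivity
      nlinarith
  · have hya0 : area e ub a ≤ 0 := by rw [area_swap]; linarith
    obtain ⟨t, ht0, ht1, ht⟩ := exists_combination_eq_zero (f := area e ub a) (g := area e ub x₀)
      (by nlinarith)
    obtain ⟨κ, hκ⟩ := exists_smul_of_area_eq_zero (e := e) (v := (1 - t) • a + t • x₀) hub0
      (by simp only [area_add_right, area_smul_right]; exact ht)
    have hmem : κ • ub ∈ segment ℝ a a' := by
      rw [← hκ]
      exact (convex_segment a a').segment_subset (left_mem_segment _ _ _) hx₀mem
        (mem_segment_iff_exists.2 ⟨t, ht0, ht1, rfl⟩)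
    -- With `x₀` on the left, `[a, a']` meets the line through `ub` in `κ • ub`. By `key` this is
    -- beyond `ub`, and then `norm_lt_of_left_right` puts the origin in the disc about `xb`, against
    -- `hxb`.
    have hκ1 : 1 < κ := by
      by_contra hc
      push Not at hc
      refine key (κ • ub) 0 κ hmem (by simp) le_rfl (by linarith) ?_
      rw [← hκ]
      have : area e (b' - b) (((1 - t) • a + t • x₀) - b) =
          (1 - t) * area e (b' - b) (a - b) + t * area e (b' - b) (x₀ - b) := by
        simp only [area_sub_left, area_sub_right, area_add_right, area_smul_right]; ring
      rw [this, hσx]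
      nlinarith [mul_nonneg (sub_nonneg.2 ht1) (neg_nonneg.2 hσ.le)]
    have hya' : 0 < area e ub a' := by
      have : area e ub x₀ = (1 - s₀) * area e ub a + s₀ * area e ub a' := by
        rw [hx₀]; simp only [area_add_right, area_smul_right]
      by_contra hc
      push Not at hc
      nlinarith [mul_nonneg (sub_nonneg.2 hs01.le) (neg_nonneg.2 hya0),
        mul_nonneg hs00.le (neg_nonneg.2 hc)]
    rw [segment_symm] at hmem
    obtain ⟨τ, hτ0, hτ1, hτ⟩ := mem_segment_iff_exists.1 hmem
    have := norm_lt_of_left_right hr h.exit_a' h.exit_a h.before_a'b h.before_ab h.before_aa'.symm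
      hya' hya0 (by linarith) hτ0 hτ1 hτ (norm_sub_lt_two_mul h.xb_a' h.xb_a) h.xb_a' h.xb_a
    linarith

/-- The points `a` and `a'` are on opposite sides of the line through `b` and `b'`, and their roles
are symmetric. -/
lemma not_behind (h : SweepQuad e r a a' b b' ua ua' ub ub' xa xa' xb xb')
    (hfar : r < ‖b' - ub‖) {k s : ℝ} (hk : k ≤ 0) (hs0 : 0 ≤ s) (hs1 : s ≤ 1)
    (hP : k • ub = (1 - s) • b + s • b') : False := by
  rcases mul_neg_iff.1 h.cross.2 with ⟨-, h1⟩ | ⟨h1, -⟩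
  · exact h.symm.not_behind_of_neg hfar hk hs0 hs1 hP h1
  · exact h.not_behind_of_neg hfar hk hs0 hs1 hP h1

/-- The case that `[a, a']` crosses the ray through `ub`, with `a` on the left. -/
lemma not_crossing_ray (h : SweepQuad e r a a' b b' ua ua' ub ub' xa xa' xb xb')
    (hfar : r < ‖b' - ub‖) (hleft : 0 < area e ub a) (hright : area e ub a' ≤ 0) {κ τ : ℝ}
    (hκ : 0 < κ) (hτ0 : 0 ≤ τ) (hτ1 : τ ≤ 1) (hz : κ • ub = (1 - τ) • a + τ • a') : False := by
  have hr := h.r_pos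
  -- The open discs about `xb` and `xb'` contain the origin, hence the triangle `0, a, a'`.
  have hxb := norm_lt_of_left_right hr h.exit_a h.exit_a' h.before_ab h.before_a'b h.before_aa'
    hleft hright hκ.le hτ0 hτ1 hz (norm_sub_lt_two_mul h.xb_a h.xb_a') h.xb_a h.xb_a'
  have hxb' := norm_lt_of_left_right hr h.exit_a h.exit_a' h.before_ab h.before_a'b h.before_aa'
    hleft hright hκ.le hτ0 hτ1 hz (norm_sub_lt_two_mul h.xb_a h.xb_a') h.xb'_a h.xb'_a'
  have hzs : κ • ub ∈ segment ℝ a a' := mem_segment_iff_exists.2 ⟨τ, hτ0, hτ1, hz⟩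
  have hnorm : ‖ub‖ = r := h.exit_b.norm_eq
  have hκ2 : κ ≤ 2 := by
    have h1 : ‖κ • ub‖ ≤ 2 * r := by
      rw [hz]
      exact norm_combination_le _ _ hτ0 hτ1 h.exit_a.norm_le h.exit_a'.norm_le
    rw [norm_smul, hnorm, Real.norm_of_nonneg hκ.le] at h1
    nlinarith
  have hzd : ‖ub - κ • ub‖ ≤ r := by
    rw [show ub - κ • ub = (1 - κ) • ub by module, norm_smul, hnorm, Real.norm_eq_abs]
    have : |1 - κ| ≤ 1 := by rw [abs_le]; constructor <;> linarith
    nlinarith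
  have hV1 : κ * area e ub a = -(τ * area e a a') := by
    have := congrArg (fun z => area e z a) hz
    simp only [area_add_left, area_smul_left, area_self, area_swap e a' a] at this
    linarith
  have hV : area e a a' < 0 ∧ 0 < τ := by
    have h1 : τ * area e a a' < 0 := by nlinarith [mul_pos hκ hleft]
    rcases mul_neg_iff.1 h1 with ⟨h2, h3⟩ | ⟨h2, h3⟩
    · exact ⟨h3, h2⟩
    · linarith
  obtain ⟨hV, hτ⟩ := hV
  have hρ : ∀ l m : ℝ, area e (a' - a) ((l • a + m • a') - a) = area e a a' * (1 - l - m) := by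
    intro l m
    simp only [area_sub_left, area_sub_right, area_add_right, area_smul_right, area_self,
      area_swap e a' a]
    ring
  -- The direction of `b'` is between those of `ub` and `a`, and `ub` is in the cone of `a` and
  -- `a'`. By the choice of `xb'` the point `b'` is beyond `[a, a']`, so that `b` is on the side of
  -- the origin.
  have hb'c : ∃ l m : ℝ, 0 ≤ l ∧ 0 ≤ m ∧ b' = l • a + m • a' := by
    have h1 := exists_combination_of_area_ne_zero hleft.ne' b'
    have h2 := h.area_b'_a_pos hfar hleft
    have h3 := h.area_b'_pos hfar
    set p := area e b' a / area e ub a with hp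
    set q := area e ub b' / area e ub a with hq
    have hp0 : 0 < p := by positivity
    have hq0 : 0 < q := by positivity
    refine ⟨q + p / κ * (1 - τ), p / κ * τ, add_nonneg hq0.le
      (mul_nonneg (by positivity) (by linarith)), by positivity, ?_⟩
    have h4 : p • ub = (p / κ) • ((1 - τ) • a + τ • a') := by
      rw [← hz, smul_smul, div_mul_cancel₀ _ hκ.ne']
    conv_lhs => rw [h1, h4]
    module
  obtain ⟨l, m, hl, hm, hb'⟩ := hb'c
  have hlm : 1 < l + m := by
    by_contra hc
    push Not at hc
    have := norm_sub_combination_lt hl hm hc hxb' h.xb'_a h.xb'_a'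
    rw [← hb'] at this
    linarith [h.xb'_b']
  have hρb' : 0 < area e (a' - a) (b' - a) := by
    rw [hb', hρ]; nlinarith
  have hρb : area e (a' - a) (b - a) < 0 := by
    have := h.cross.1
    by_contra hc
    push Not at hc
    nlinarith [mul_nonneg hc hρb'.le]
  have hya := h.le_norm_sub_a
  have hya' := h.symm.le_norm_sub_a
  have hyb : ‖ub - b‖ ≤ r := by rw [norm_sub_rev]; exact h.exit_b.dist_eq.le
  have hyz : ub = (1 / κ) • (κ • ub) := by
    rw [smul_smul, one_div_mul_cancel hκ.ne', one_smul]
  have hρy : area e (a' - a) (ub - a) = area e a a' * (1 - 1 / κ) := by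
    have : ub = ((1 / κ) * (1 - τ)) • a + ((1 / κ) * τ) • a' := by
      conv_lhs => rw [hyz, hz]
      module
    conv_lhs => rw [this, hρ]
    ring
  -- Otherwise `ub` is on or beyond the line through `a` and `a'`, so that `[ub, b]` crosses `[a,
  -- a']`, against `disc_sep`.
  have hκ1 : 1 < κ := by
    by_contra hc
    push Not at hc
    have h1 : 1 ≤ 1 / κ := by rw [le_div_iff₀ hκ]; linarith
    have hτ1' : τ < 1 := by
      rcases hτ1.eq_or_lt with h2 | h2
      · exfalso
        have h3 : κ • ub = a' := by rw [hz, h2]; simp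
        rw [← h3, show ub - κ • ub = (1 - κ) • ub by module, norm_smul, hnorm,
          Real.norm_of_nonneg (by linarith)] at hya'
        nlinarith
      · exact h2
    obtain ⟨z, hz1, hz2⟩ := exists_mem_segment_of_area_mul_nonpos (e := e) hya hya' h.cross.ne hτ hτ1'
      (by rw [← hz]; exact hzd) (by simpa using hr.le : ‖ub - ub‖ ≤ r) hyb
      (by rw [hρy]; nlinarith [mul_nonneg (neg_nonneg.2 hV.le) (by linarith : 0 ≤ 1 / κ - 1)])
    exact disc_sep e hr hya hya' hyb h.xb_a h.xb_a' h.xb_b hz1 hz2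
  rcases h.area_b_nonpos.eq_or_lt with h0 | h0
  · have hb := h.exit_b.eq_two_smul hr h0
    refine disc_sep e hr hya hya' hyb h.xb_a h.xb_a' h.xb_b hzs
      (mem_segment_iff_exists.2 ⟨κ - 1, by linarith, by linarith, ?_⟩)
    rw [hb]; module
  rcases hright.eq_or_lt with h1 | h1
  · have hza' : κ • ub = a' := by
      have := congrArg (fun z => area e ub z) hz
      simp only [area_add_right, area_smul_right, area_self, h1, mul_zero, add_zero] at this
      have h2 : τ = 1 := by
        rcases mul_eq_zero.1 this.symm with h3 | h3 <;> linarith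
      rw [hz, h2]; simp
    refine disc_sep e hr (a := 0) (a' := a') (z := ub) (by rw [sub_zero]; exact hnorm.ge) hya' hyb
      (by rwa [sub_zero]) h.xb_a' h.xb_b (mem_segment_iff_exists.2 ⟨1 / κ, by positivity,
        by rw [div_le_one hκ]; exact hκ1.le, ?_⟩) (left_mem_segment _ _ _)
    rw [← hza', ← hyz]; simp
  have hb := exists_combination_of_area_ne_zero h1.ne b
  set μ := area e b a' / area e ub a' with hμ
  set α := area e ub b / area e ub a' with hα
  have hα0 : 0 < α := div_pos_of_neg_of_neg h0 h1
  have hbc : b = (μ / κ * (1 - τ)) • a + (α + μ / κ * τ) • a' := by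
    have h4 : μ • ub = (μ / κ) • ((1 - τ) • a + τ • a') := by
      rw [← hz, smul_smul, div_mul_cancel₀ _ hκ.ne']
    conv_lhs => rw [hb, h4]
    module
  have hsum : α + μ / κ < 1 := by
    rw [hbc, hρ] at hρb
    nlinarith
  -- For `μ ≥ 0` the point `b` is in the triangle `0, a, a'`, hence in the disc about `xb`. For `μ <
  -- 0` the segment `[ub, b]` meets `[0, a']`, against `disc_sep`.
  rcases le_or_gt 0 μ with h2 | h2
  · have h3 : 0 ≤ μ / κ := by positivity
    have := norm_sub_combination_lt (p := a) (q := a') (l := μ / κ * (1 - τ))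
      (m := α + μ / κ * τ) (mul_nonneg h3 (by linarith)) (by positivity) (by linarith) hxb h.xb_a
      h.xb_a'
    rw [← hbc] at this
    linarith [h.xb_b]
  · have hd : 0 < 1 - μ := by linarith
    have h3 : α ≤ 1 - μ := by
      have : μ ≤ μ / κ := by
        rw [le_div_iff₀ hκ]; nlinarith
      linarith
    refine disc_sep e hr (a := 0) (a' := a') (z := (α / (1 - μ)) • a')
      (by rw [sub_zero]; exact hnorm.ge) hya' hyb (by rwa [sub_zero]) h.xb_a' h.xb_b
      (mem_segment_iff_exists.2 ⟨α / (1 - μ), by positivity, by rw [div_le_one hd]; exact h3,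
        by simp⟩) (mem_segment_iff_exists.2 ⟨1 / (1 - μ), by positivity,
          by rw [div_le_one hd]; linarith, ?_⟩)
    conv_rhs => rw [hb]
    have e1 : (1 - 1 / (1 - μ)) + 1 / (1 - μ) * μ = 0 := by field_simp; ring
    have e2 : 1 / (1 - μ) * α = α / (1 - μ) := by ring
    calc (α / (1 - μ)) • a' = ((1 - 1 / (1 - μ)) + 1 / (1 - μ) * μ) • ub + (1 / (1 - μ) * α) • a' := by
          rw [e1, e2]; simp
      _ = _ := by module

set_option maxHeartbeats 1000000 in
/-- The case that `[b, b']` passes between `0` and the antipode of `0`. -/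
lemma not_in_front (h : SweepQuad e r a a' b b' ua ua' ub ub' xa xa' xb xb')
    (hfar : r < ‖b' - ub‖) {k s : ℝ} (hk : 0 < k) (hs0 : 0 ≤ s) (hs1 : s ≤ 1)
    (hP : k • ub = (1 - s) • b + s • b') : False := by
  have hr := h.r_pos
  have hnorm : ‖ub‖ = r := h.exit_b.norm_eq
  have hub0 := h.exit_b.center_ne_zero hr
  have hyb' := h.area_b'_pos hfar
  have hyb0 := h.area_b_nonpos
  have hya := h.le_norm_sub_a
  have hya' := h.symm.le_norm_sub_a
  have hyb : ‖ub - b‖ ≤ r := by rw [norm_sub_rev]; exact h.exit_b.dist_eq.le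
  have hk2 : k ≤ 2 := by
    have h1 : ‖k • ub‖ ≤ 2 * r := by
      rw [hP]
      exact norm_combination_le _ _ hs0 hs1 h.exit_b.norm_le h.exit_b'.norm_le
    rw [norm_smul, hnorm, Real.norm_of_nonneg hk.le] at h1
    nlinarith
  have hPd : ‖ub - k • ub‖ ≤ r := by
    rw [show ub - k • ub = (1 - k) • ub by module, norm_smul, hnorm, Real.norm_eq_abs]
    have : |1 - k| ≤ 1 := by rw [abs_le]; constructor <;> linarith
    nlinarith
  have g2 : 0 = (1 - s) * area e ub b + s * area e ub b' := by
    have := congrArg (fun z => area e ub z) hP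
    simpa only [area_add_right, area_smul_right, area_self, mul_zero, add_zero] using this
  -- neither `a` nor `a'` is on the left, or one of them is
  have hfinish : ∀ κ : ℝ, 0 < κ → κ • ub ∈ segment ℝ a a' →
      (0 < area e ub a ∨ 0 < area e ub a') → False := by
    intro κ hκ hz hor
    obtain ⟨τ, hτ0, hτ1, hτ⟩ := mem_segment_iff_exists.1 hz
    have h1 : 0 = (1 - τ) * area e ub a + τ * area e ub a' := by
      have := congrArg (fun z => area e ub z) hτ
      simpa only [area_add_right, area_smul_right, area_self, mul_zero] using this
    rcases le_or_gt (area e ub a) 0 with h2 | h2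
    · have h3 : 0 < area e ub a' := hor.resolve_left (not_lt.2 h2)
      refine h.symm.not_crossing_ray hfar h3 h2 hκ (τ := 1 - τ) (by linarith) (by linarith) ?_
      rw [hτ]; module
    · rcases le_or_gt (area e ub a') 0 with h3 | h3
      · exact h.not_crossing_ray hfar h2 h3 hκ hτ0 hτ1 hτ
      · nlinarith [mul_nonneg (sub_nonneg.2 hτ1) h2.le, mul_nonneg hτ0 h3.le,
          mul_pos h2 h3]
  obtain ⟨s₀, t₀, hs00, hs01, ht00, ht01, hx⟩ := h.cross.exists_point
  set x₀ := (1 - s₀) • a + s₀ • a' with hx₀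
  have hx₀mem : x₀ ∈ segment ℝ a a' := mem_segment_iff_exists.2 ⟨s₀, hs00.le, hs01.le, hx₀⟩
  have hyx : area e ub x₀ = (1 - t₀) * area e ub b + t₀ * area e ub b' := by
    rw [hx]; simp only [area_add_right, area_smul_right]
  have hyx2 : area e ub x₀ = (1 - s₀) * area e ub a + s₀ * area e ub a' := by
    rw [hx₀]; simp only [area_add_right, area_smul_right]
  -- With `x₀` weakly to the right, it is on `[b, k • ub]`, in the disc about `ub`. With `x₀` to the
  -- left, the angular position of `b'` decides where `[a, a']` meets the line through `ub`.
  rcases le_or_gt (area e ub x₀) 0 with h0 | h0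
  · have hts : t₀ ≤ s := by
      by_contra hc
      push Not at hc
      nlinarith
    have hs : 0 < s := by linarith
    have hx₀P : x₀ ∈ segment ℝ b (k • ub) := by
      refine mem_segment_iff_exists.2 ⟨t₀ / s, by positivity, by rw [div_le_one hs]; exact hts, ?_⟩
      rw [hx, hP]
      have e1 : 1 - t₀ = (1 - t₀ / s) + t₀ / s * (1 - s) := by field_simp; ring
      have e2 : t₀ = t₀ / s * s := by field_simp
      calc (1 - t₀) • b + t₀ • b' = ((1 - t₀ / s) + t₀ / s * (1 - s)) • b + (t₀ / s * s) • b' := by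
            rw [← e1, ← e2]
        _ = _ := by module
    have hx₀d : ‖ub - x₀‖ ≤ r := by
      obtain ⟨t, h1, h2, h3⟩ := mem_segment_iff_exists.1 hx₀P
      rw [h3, norm_sub_rev]
      exact norm_combination_sub_le _ _ _ h1 h2 (by rwa [norm_sub_rev]) (by rwa [norm_sub_rev])
    have hyy : ‖ub - ub‖ ≤ r := by simpa using hr.le
    have h1 : 0 < area e (a' - a) (ub - a) * area e (a' - a) (b - a) := by
      by_contra hc
      obtain ⟨z, hz, hz'⟩ := exists_mem_segment_of_area_mul_nonpos hya hya' h.cross.ne hs00 hs01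
        hx₀d hyy hyb (not_lt.1 hc)
      exact disc_sep e hr hya hya' hyb h.xb_a h.xb_a' h.xb_b hz hz'
    have h2 : area e (a' - a) (b - a) * area e (a' - a) (k • ub - a) ≤ 0 := by
      set B := area e (a' - a) (b - a) with hB
      set B' := area e (a' - a) (b' - a) with hB'
      have f1 : area e (a' - a) (k • ub - a) = (1 - s) * B + s * B' := by
        rw [hP, hB, hB']
        simp only [area_sub_left, area_sub_right, area_add_right, area_smul_right]; ring
      have f2 : (1 - t₀) * B + t₀ * B' = 0 := by
        have : area e (a' - a) (x₀ - a) = 0 := by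
          rw [hx₀]
          simp only [area_sub_left, area_sub_right, area_add_right, area_smul_right, area_self,
            area_swap e a' a]
          ring
        rw [← this, hx, hB, hB']
        simp only [area_sub_left, area_sub_right, area_add_right, area_smul_right]; ring
      have f3 : t₀ * (B * ((1 - s) * B + s * B')) = -((s - t₀) * B ^ 2) := by
        linear_combination s * B * f2
      rw [f1]
      by_contra hc
      push Not at hc
      nlinarith [mul_pos ht00 hc, mul_nonneg (sub_nonneg.2 hts) (sq_nonneg B)]
    -- By `disc_sep`, `ub` is on the side of `b`, while `x₀` is between `b` and `k • ub`; so `[a,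
    -- a']` meets the ray between `ub` and `k • ub`.
    have h3 : area e (a' - a) (ub - a) * area e (a' - a) (k • ub - a) ≤ 0 := by
      by_contra hc
      push Not at hc
      nlinarith [mul_pos h1 hc, mul_nonneg (sq_nonneg (area e (a' - a) (ub - a)))
        (neg_nonneg.2 h2)]
    obtain ⟨z, hz, hz'⟩ := exists_mem_segment_of_area_mul_nonpos hya hya' h.cross.ne hs00 hs01
      hx₀d hyy hPd h3
    obtain ⟨t, ht0, ht1, ht⟩ := mem_segment_iff_exists.1 hz'
    have hzκ : z = ((1 - t) + t * k) • ub := by rw [ht]; module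
    set κ := (1 - t) + t * k with hκ
    have hκ0 : 0 < κ := by
      rcases ht0.eq_or_lt with h4 | h4
      · rw [hκ, ← h4]; norm_num
      · nlinarith [mul_pos h4 hk]
    rw [hzκ] at hz
    refine hfinish κ hκ0 hz ?_
    by_contra hnone
    push Not at hnone
    obtain ⟨n1, n2⟩ := hnone
    -- an end point on the ray would be a point of `[b, b']`
    have hend : κ = 2 → k • ub = (2 : ℝ) • ub := by
      intro h4
      have : k = 2 := by
        by_contra h5
        have h6 : k < 2 := lt_of_le_of_ne hk2 h5
        nlinarith
      rw [this]
    have hPa : κ = 2 → a = (2 : ℝ) • ub → False := by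
      intro h4 h5
      have h6 : a = (1 - s) • b + s • b' := by rw [h5, ← hend h4, hP]
      have h7 : ‖a - xa‖ ≤ max ‖b - xa‖ ‖b' - xa‖ := by
        rw [h6]
        exact norm_combination_sub_le _ _ _ hs0 hs1 (le_max_left _ _) (le_max_right _ _)
      rw [norm_sub_rev, norm_sub_rev b, norm_sub_rev b'] at h7
      linarith [max_lt h.xa_b h.xa_b', h.xa_a]
    have hPa' : κ = 2 → a' = (2 : ℝ) • ub → False := by
      intro h4 h5
      have h6 : a' = (1 - s) • b + s • b' := by rw [h5, ← hend h4, hP]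
      have h7 : ‖a' - xa'‖ ≤ max ‖b - xa'‖ ‖b' - xa'‖ := by
        rw [h6]
        exact norm_combination_sub_le _ _ _ hs0 hs1 (le_max_left _ _) (le_max_right _ _)
      rw [norm_sub_rev, norm_sub_rev b, norm_sub_rev b'] at h7
      linarith [max_lt h.xa'_b h.xa'_b', h.xa'_a']
    obtain ⟨τ, hτ0, hτ1, hτ⟩ := mem_segment_iff_exists.1 hz
    have h4 : 0 = (1 - τ) * area e ub a + τ * area e ub a' := by
      have := congrArg (fun z => area e ub z) hτ
      simpa only [area_add_right, area_smul_right, area_self, mul_zero] using this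
    rcases hτ0.eq_or_lt with h5 | h5
    · have h6 : a = κ • ub := by rw [hτ, ← h5]; simp
      have h7 := h.eq_two_of_on_ray hκ0 h6
      exact hPa h7 (by rw [h6, h7])
    rcases hτ1.eq_or_lt with h6 | h6
    · have h7 : a' = κ • ub := by rw [hτ, h6]; simp
      have h8 := h.symm.eq_two_of_on_ray hκ0 h7
      exact hPa' h8 (by rw [h7, h8])
    have h7 : area e ub a = 0 := by
      by_contra hc
      have : area e ub a < 0 := lt_of_le_of_ne n1 hc
      nlinarith
    have h8 : area e ub a' = 0 := by
      by_contra hc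
      have : area e ub a' < 0 := lt_of_le_of_ne n2 hc
      nlinarith
    obtain ⟨α, hα⟩ := exists_smul_of_area_eq_zero hub0 h7
    obtain ⟨α', hα'⟩ := exists_smul_of_area_eq_zero hub0 h8
    have hκα : κ = (1 - τ) * α + τ * α' := by
      have h9 : (κ - ((1 - τ) * α + τ * α')) • ub = 0 := by
        rw [sub_smul, hτ, hα, hα']; module
      rcases smul_eq_zero.1 h9 with h10 | h10
      · linarith
      · exact absurd h10 hub0
    -- The remaining degenerate case has `a` and `a'` on the line through `ub`, a positive
    -- coefficient being 2. The witness solves `(1 - t) * l + t * 2 = 1`.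
    have hmem1 : ∀ {l m : ℝ}, l ≤ 0 → m = 2 → ub ∈ segment ℝ (l • ub) (m • ub) := by
      intro l m hl hm
      refine mem_segment_iff_exists.2 ⟨(1 - l) / (2 - l), div_nonneg (by linarith) (by linarith),
        by rw [div_le_one (by linarith)]; linarith, ?_⟩
      have h9 : (1 - (1 - l) / (2 - l)) * l + (1 - l) / (2 - l) * m = 1 := by
        have : 2 - l ≠ 0 := by linarith
        rw [hm]; field_simp; ring
      rw [smul_smul, smul_smul, ← add_smul, h9, one_smul]
    have hcontra : ub ∈ segment ℝ a a' → False := fun h9 =>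
      disc_sep e hr hya hya' hyb h.xb_a h.xb_a' h.xb_b h9 (left_mem_segment _ _ _)
    rcases le_or_gt α 0 with h9 | h9
    · rcases le_or_gt α' 0 with h10 | h10
      · nlinarith
      · have h11 := h.symm.eq_two_of_on_ray h10 hα'
        apply hcontra
        rw [hα, hα']
        exact hmem1 h9 h11
    · have h11 := h.eq_two_of_on_ray h9 hα
      rcases le_or_gt α' 0 with h10 | h10
      · apply hcontra
        rw [hα, hα', segment_symm]
        exact hmem1 h10 h11
      · have h12 := h.symm.eq_two_of_on_ray h10 hα'
        exact h.cross.ne (by rw [hα, hα', h11, h12])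
  -- Here `b` and `x₀` come before the direction of `b'`, whereas any of `a`, `a'` on the left comes
  -- after it. So exactly one of them is on the left, and `[a, a']` passes from it through `x₀` to
  -- the ray through `ub`.
  · have hb'b : area e b' b < 0 := by
      have := congrArg (fun z => area e b' z) hP
      simp only [area_add_right, area_smul_right, area_self, mul_zero, add_zero] at this
      rw [area_swap e b' ub] at this
      by_contra hc
      push Not at hc
      nlinarith [mul_pos hk hyb', mul_nonneg (sub_nonneg.2 hs1) hc]
    have hb'x : area e b' x₀ < 0 := by
      rw [hx]
      simp only [area_add_right, area_smul_right, area_self, mul_zero, add_zero]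
      nlinarith
    have hb'x2 : area e b' x₀ = (1 - s₀) * area e b' a + s₀ * area e b' a' := by
      rw [hx₀]; simp only [area_add_right, area_smul_right]
    -- the intersection of `[a, a']` with the line through `ub` is on the ray
    have hpos : ∀ {p p' : E} {σ κ τ : ℝ}, 0 < area e ub p → area e ub p' ≤ 0 → 0 < area e b' p →
        0 ≤ τ → τ ≤ 1 → 0 ≤ σ → x₀ = (1 - σ) • p + σ • p' →
        κ • ub = (1 - τ) • p + τ • p' → 0 < κ := by
      intro p p' σ κ τ hp hp' hbp hτ0 hτ1 hσ hxp hκ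
      by_contra hc
      push Not at hc
      have f1 : 0 = (1 - τ) * area e ub p + τ * area e ub p' := by
        have := congrArg (fun z => area e ub z) hκ
        simpa only [area_add_right, area_smul_right, area_self, mul_zero] using this
      have f2 : 0 < (1 - σ) * area e ub p + σ * area e ub p' := by
        rw [hxp] at h0
        simpa only [area_add_right, area_smul_right] using h0
      have f3 : κ * area e b' ub = (1 - τ) * area e b' p + τ * area e b' p' := by
        have := congrArg (fun z => area e b' z) hκ
        simpa only [area_add_right, area_smul_right] using this
      have f4 : (1 - σ) * area e b' p + σ * area e b' p' < 0 := by
        rw [hxp] at hb'x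
        simpa only [area_add_right, area_smul_right] using hb'x
      have f5 : σ < τ := by
        by_contra hc'
        push Not at hc'
        nlinarith
      have f6 : 0 ≤ κ * area e b' ub := by
        rw [area_swap]; nlinarith [mul_nonneg (neg_nonneg.2 hc) hyb'.le]
      have f7 : τ * ((1 - σ) * area e b' p + σ * area e b' p') =
          (τ - σ) * area e b' p + σ * (κ * area e b' ub) := by
        rw [f3]; ring
      nlinarith [mul_pos (sub_pos.2 f5) hbp, mul_nonneg hσ f6]
    have hzero : ∀ {p p' : E}, 0 < area e ub p → area e ub p' ≤ 0 →
        ∃ κ τ : ℝ, 0 ≤ τ ∧ τ ≤ 1 ∧ κ • ub = (1 - τ) • p + τ • p' := by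
      intro p p' hp hp'
      obtain ⟨t, ht0, ht1, ht⟩ := exists_combination_eq_zero (f := area e ub p)
        (g := area e ub p') (by nlinarith)
      obtain ⟨κ, hκ⟩ := exists_smul_of_area_eq_zero (e := e) (v := (1 - t) • p + t • p') hub0
        (by simp only [area_add_right, area_smul_right]; exact ht)
      exact ⟨κ, t, ht0, ht1, hκ.symm⟩
    rcases le_or_gt (area e ub a) 0 with h1 | h1
    · rcases le_or_gt (area e ub a') 0 with h2 | h2
      · nlinarith [mul_nonneg (sub_nonneg.2 hs01.le) (neg_nonneg.2 h1),
          mul_nonneg hs00.le (neg_nonneg.2 h2)]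
      · obtain ⟨κ, τ, hτ0, hτ1, hκ⟩ := hzero h2 h1
        have hκ0 := hpos h2 h1 (h.symm.area_b'_a_pos hfar h2) hτ0 hτ1
          (σ := 1 - s₀) (by linarith) (by rw [hx₀]; module) hκ
        exact h.symm.not_crossing_ray hfar h2 h1 hκ0 hτ0 hτ1 hκ
    · have f1 := h.area_b'_a_pos hfar h1
      rcases le_or_gt (area e ub a') 0 with h2 | h2
      · obtain ⟨κ, τ, hτ0, hτ1, hκ⟩ := hzero h1 h2
        have hκ0 := hpos h1 h2 f1 hτ0 hτ1 hs00.le hx₀ hκ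
        exact h.not_crossing_ray hfar h1 h2 hκ0 hτ0 hτ1 hκ
      · have f2 := h.symm.area_b'_a_pos hfar h2
        nlinarith [mul_pos (sub_pos.2 hs01) f1, mul_pos hs00 f2]

/-- There are no such four points. -/
theorem false (h : SweepQuad e r a a' b b' ua ua' ub ub' xa xa' xb xb') : False := by
  rcases le_or_gt ‖b' - ub‖ r with hnear | hfar
  · exact h.not_near hnear
  obtain ⟨s, hs0, hs1, hs⟩ := exists_combination_eq_zero (f := area e ub b) (g := area e ub b')
    (by nlinarith [h.area_b_nonpos, h.area_b'_pos hfar])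
  obtain ⟨k, hk⟩ := exists_smul_of_area_eq_zero (e := e) (v := (1 - s) • b + s • b')
    (h.exit_b.center_ne_zero h.r_pos) (by simp only [area_add_right, area_smul_right]; exact hs)
  rcases le_or_gt k 0 with h0 | h0
  · exact h.not_behind hfar h0 hs0 hs1 hk.symm
  · exact h.not_in_front hfar h0 hs0 hs1 hk.symm

end far

end SweepQuad

end quad

/-! ### Polar angles and the order of exit. -/

section direction

variable {E : Type*} [NormedAddCommGroup E] [NormedSpace ℝ E] (b : Module.Basis (Fin 2) ℝ E)

lemma area_direction (s t : ℝ) : area b (direction b s) (direction b t) = Real.sin (t - s) := by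
  simp [area, direction, Real.sin_sub, Module.Basis.repr_self]
  ring

lemma direction_ne_zero (t : ℝ) : direction b t ≠ 0 := by
  intro h
  have := area_direction b t (t + Real.pi / 2)
  rw [h] at this
  simp at this

lemma continuous_direction : Continuous (direction b) := by
  unfold direction
  fun_prop

/-- The point of polar angle `t` on the circle of radius `r` around the origin. -/
noncomputable def radialPoint (r t : ℝ) : E := (r / ‖direction b t‖) • direction b t

lemma circlePoint_eq (c : E) (r t : ℝ) : circlePoint b c r t = c + radialPoint b r t := rfl

lemma norm_radialPoint {r : ℝ} (hr : 0 < r) (t : ℝ) : ‖radialPoint b r t‖ = r := by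
  have := norm_pos_iff.2 (direction_ne_zero b t)
  rw [radialPoint, norm_smul, norm_div, norm_norm, Real.norm_of_nonneg hr.le,
    div_mul_cancel₀ _ this.ne']

lemma continuous_radialPoint (r : ℝ) : Continuous (radialPoint b r) := by
  have h := continuous_direction b
  exact (continuous_const.div h.norm fun t => norm_ne_zero_iff.2 (direction_ne_zero b t)).smul h

lemma area_radialPoint_pos {r s t : ℝ} (hr : 0 < r) (hst : s < t) (hts : t < s + Real.pi) :
    0 < area b (radialPoint b r s) (radialPoint b r t) := by
  have h := fun t => norm_pos_iff.2 (direction_ne_zero b t)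
  simp only [radialPoint, area_smul_left, area_smul_right, area_direction]
  exact mul_pos (div_pos hr (h t)) (mul_pos (div_pos hr (h s))
    (Real.sin_pos_of_pos_of_lt_pi (by linarith) (by linarith)))

lemma before_radialPoint {r s t : ℝ} (hr : 0 < r) (hst : s ≤ t) (hts : t < s + Real.pi) :
    Before b (radialPoint b r s) (radialPoint b r t) := by
  rcases hst.eq_or_lt with rfl | h
  · exact Or.inr rfl
  · exact Or.inl (area_radialPoint_pos b hr h hts)

lemma mem_closedBall_circlePoint {c x : E} {r t : ℝ} :
    x ∈ closedBall (circlePoint b c r t) r ↔ ‖x - c - radialPoint b r t‖ ≤ r := by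
  rw [mem_closedBall_iff_norm, circlePoint_eq, sub_add_eq_sub_sub]

/-- Along less than half of a circle, the points at distance at most `r` form an arc. -/
lemma norm_sub_radialPoint_le [StrictConvexSpace ℝ E] {q : E} {r s t w : ℝ} (hr : 0 < r)
    (hs : ‖q - radialPoint b r s‖ ≤ r) (ht : ‖q - radialPoint b r t‖ ≤ r)
    (hsw : s ≤ w) (hwt : w ≤ t) (hst : t < s + Real.pi) : ‖q - radialPoint b r w‖ ≤ r := by
  rcases hsw.eq_or_lt with rfl | hsw
  · exact hs
  rcases hwt.eq_or_lt with rfl | hwt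
  · exact ht
  exact norm_sub_le_of_between (e := b) hr (norm_radialPoint b hr s) (norm_radialPoint b hr t)
    (norm_radialPoint b hr w) hs ht (area_radialPoint_pos b hr hsw (by linarith))
    (area_radialPoint_pos b hr hwt (by linarith)) (area_radialPoint_pos b hr (by linarith) hst)

/-- A point that belongs to the disc of radius `r` centered at an earlier point of the sweep, but
not to the one at a later point, leaves the moving disc in between. -/
lemma exists_isExit [StrictConvexSpace ℝ E] {q : E} {r s t : ℝ} (hr : 0 < r) (hst : s ≤ t)
    (hts : t < s + Real.pi) (hs : ‖q - radialPoint b r s‖ ≤ r) (ht : r < ‖q - radialPoint b r t‖) :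
    ∃ β ∈ Ico s t, IsExit b r q (radialPoint b r β) ∧
      ∀ w ∈ Ioc β t, r < ‖q - radialPoint b r w‖ := by
  have := b.finiteDimensional_of_finite
  have hc : Continuous fun w => ‖q - radialPoint b r w‖ :=
    (continuous_const.sub (continuous_radialPoint b r)).norm
  set S := {w | w ∈ Icc s t ∧ ‖q - radialPoint b r w‖ ≤ r} with hS
  have hScl : IsClosed S := isClosed_Icc.inter (isClosed_le hc continuous_const)
  have hSc : IsCompact S := isCompact_Icc.of_isClosed_subset hScl fun w hw => hw.1
  obtain ⟨β, ⟨hβ, hβr⟩, hmax⟩ := hSc.exists_isGreatest ⟨s, ⟨le_rfl, hst⟩, hs⟩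
  have hβt : β < t := lt_of_le_of_ne hβ.2 (by rintro rfl; linarith)
  have hlt : ∀ w ∈ Ioc β t, r < ‖q - radialPoint b r w‖ := fun w hw => by
    by_contra! h
    exact (hmax ⟨⟨hβ.1.trans hw.1.le, hw.2⟩, h⟩).not_gt hw.1
  refine ⟨β, ⟨hβ.1, hβt⟩, ⟨norm_radialPoint b hr β, ?_, fun v hv hav => ?_⟩, hlt⟩
  · refine hβr.antisymm ?_
    have hcl : β ∈ closure (Ioc β t) := by
      rw [closure_Ioc hβt.ne]; exact ⟨le_rfl, hβt.le⟩
    exact closure_minimal (fun w hw => (hlt w hw).le) (isClosed_le continuous_const hc) hcl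
  -- If the disc about a later `v` contained `q`, so would the discs just after `β`, which are
  -- between the position at `β` and `v`.
  · by_contra! h
    have hca : Continuous fun w => area b (radialPoint b r w) v :=
      (continuous_area b).comp ((continuous_radialPoint b r).prodMk continuous_const)
    have h1 : ∀ᶠ w in nhdsWithin β (Ioi β), 0 < area b (radialPoint b r w) v :=
      (hca.continuousAt.eventually (lt_mem_nhds hav)).filter_mono nhdsWithin_le_nhds
    obtain ⟨w, hw, hwt⟩ := (h1.and (Ioc_mem_nhdsGT hβt)).exists
    exact (hlt w hwt).not_ge (norm_sub_le_of_between (e := b) hr (norm_radialPoint b hr β) hv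
      (norm_radialPoint b hr w) hβr h
      (area_radialPoint_pos b hr hwt.1 (by linarith [hβ.1, hwt.2])) hw hav)

/-- The points added during the sweep leave the moving disc in the order in which they are added. -/
lemma IsAdditionOrder.exists_exit_angles [StrictConvexSpace ℝ E] {K : Set E} {c : E} {r θ₁ : ℝ}
    {m : ℕ} {p : Fin m → E} (hr : 0 < r) (hp : IsAdditionOrder b K c r θ₁ p) :
    ∃ β : Fin m → ℝ, (∀ i, β i ∈ Ico θ₁ (θ₁ + Real.pi / 2)) ∧
      (∀ i, IsExit b r (p i - c) (radialPoint b r (β i))) ∧ Monotone β := by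
  have hpi := Real.pi_pos
  have key : ∀ i, ∃ β ∈ Ico θ₁ (θ₁ + Real.pi / 2), IsExit b r (p i - c) (radialPoint b r β) ∧
      ∃ θ ∈ Ioo β (θ₁ + Real.pi / 2), ∀ w ∈ Ioc β θ, r < ‖p i - c - radialPoint b r w‖ := by
    intro i
    have hi : p i ∈ range p := ⟨i, rfl⟩
    rw [hp.range_eq] at hi
    obtain ⟨θ, hθ, -, hθr, s, hs, hsr⟩ := hi
    rw [mem_closedBall_circlePoint] at hθr hsr
    obtain ⟨β, hβ, hex, hlt⟩ := exists_isExit b hr hs.2.le (by linarith [hs.1, hθ.2]) hsr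
      (not_le.1 hθr)
    exact ⟨β, ⟨hs.1.trans hβ.1, hβ.2.trans hθ.2⟩, hex, θ, ⟨hβ.2, hθ.2⟩, hlt⟩
  choose β hβ hex θ hθ hlt using key
  refine ⟨β, hβ, hex, fun i k hik => ?_⟩
  rcases hik.eq_or_lt with rfl | hik
  · exact le_rfl
  by_contra! hlt'
  -- If `p k` exits before `p i`, then at an angle `t` in between `p k` has been added, so `p i` was
  -- outside at some `w ≤ t`, having been inside earlier. But `p i` is inside again at `β i > t`,
  -- against the arc property.
  obtain ⟨t, ht1, ht2⟩ := exists_between (lt_min hlt' (hθ k).1)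
  have htI : t ∈ Ico θ₁ (θ₁ + Real.pi / 2) :=
    ⟨(hβ k).1.trans ht1.le, ht2.trans_le ((min_le_right _ _).trans (hθ k).2.le)⟩
  obtain ⟨w, hw, -, hwr, s, hs, hsr⟩ := hp.ordered i k hik t htI
    ⟨by
      have : p k ∈ range p := ⟨k, rfl⟩
      rw [hp.range_eq] at this
      obtain ⟨_, _, h, _⟩ := this
      exact h, by
      rw [mem_closedBall_circlePoint, not_le]
      exact hlt k t ⟨ht1, (ht2.trans_le (min_le_right _ _)).le⟩, β k, ⟨(hβ k).1, ht1⟩, by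
      rw [mem_closedBall_circlePoint]
      exact (hex k).dist_eq.le⟩
  rw [mem_closedBall_circlePoint] at hwr hsr
  have hti := ht2.trans_le (min_le_left (β i) _)
  exact hwr (norm_sub_radialPoint_le b hr hsr (hex i).dist_eq.le hs.2.le
    (by linarith [hw.2]) (by linarith [(hβ i).2, hs.1]))

end direction

/-! ### Labels do not alternate between low and high. -/

section labels

variable {E : Type*} [NormedAddCommGroup E] [NormedSpace ℝ E]

/-- The homothety with center `q` and ratio `r` maps the unit disc about `x` to an `r`-disc that
contains it and still has `q` on its circle. -/
lemma norm_sub_expand {x q q' : E} {r : ℝ} (hr : 1 < r) (h : ‖x - q‖ = 1) (h' : ‖x - q'‖ < 1) :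
    ‖q + r • (x - q) - q'‖ < r := by
  have h1 : q + r • (x - q) - q' = (r - 1) • (x - q) + (x - q') := by module
  have h2 := norm_add_le ((r - 1) • (x - q)) (x - q')
  rw [norm_smul, h, Real.norm_of_nonneg (by linarith)] at h2
  rw [h1]
  linarith

lemma Crossing.sub_right {e : Module.Basis (Fin 2) ℝ E} {a a' b b' : E}
    (h : Crossing e a a' b b') (c : E) : Crossing e (a - c) (a' - c) (b - c) (b' - c) := by
  unfold Crossing at *
  simpa only [sub_sub_sub_cancel_right] using h

/-- The order of exit does not separate the two diagonals of a quadrilateral. -/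
lemma not_crossing_of_exit [StrictConvexSpace ℝ E] {e : Module.Basis (Fin 2) ℝ E} {m : ℕ}
    {q : Fin m → E} {c : E} {r θ₁ : ℝ} {β : Fin m → ℝ} (hr : 1 < r)
    (hβ : ∀ i, β i ∈ Ico θ₁ (θ₁ + Real.pi / 2))
    (hex : ∀ i, IsExit e r (q i - c) (radialPoint e r (β i))) (hmono : Monotone β)
    {a a' b b' : Fin m} (hab : a < b) (ha'b : a' < b) (hab' : a < b') (ha'b' : a' < b')
    {x : Fin m → E} (hx : ∀ k ∈ ({a, a', b, b'} : Set (Fin m)), ‖x k - q k‖ = 1)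
    (hxl : ∀ k ∈ ({a, a', b, b'} : Set (Fin m)), ∀ l ∈ ({a, a', b, b'} : Set (Fin m)), k ≠ l →
      ‖x k - q l‖ < 1)
    (hne : a ≠ a') (hne' : b ≠ b') (hc : Crossing e (q a) (q a') (q b) (q b')) : False := by
  wlog hbb : b ≤ b' generalizing b b'
  · refine this hab' ha'b' hab ha'b ?_ ?_ hne'.symm hc.swap_right (le_of_not_ge hbb)
    · rwa [show ({a, a', b', b} : Set (Fin m)) = {a, a', b, b'} by rw [pair_comm b]]
    · rwa [show ({a, a', b', b} : Set (Fin m)) = {a, a', b, b'} by rw [pair_comm b]]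
  have hr0 : 0 < r := by linarith
  have hpi := Real.pi_pos
  have hb : ∀ {i k}, i ≤ k → Before e (radialPoint e r (β i)) (radialPoint e r (β k)) :=
    fun {i k} h => before_radialPoint e hr0 (hmono h) (by linarith [(hβ i).1, (hβ k).2])
  let y : Fin m → E := fun k => q k + r • (x k - q k) - c
  have hy : ∀ k ∈ ({a, a', b, b'} : Set (Fin m)), r ≤ ‖y k - (q k - c)‖ := fun k hk => by
    have : y k - (q k - c) = r • (x k - q k) := by simp only [y]; module
    rw [this, norm_smul, hx k hk, Real.norm_of_nonneg hr0.le, mul_one]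
  have hyl : ∀ k ∈ ({a, a', b, b'} : Set (Fin m)), ∀ l ∈ ({a, a', b, b'} : Set (Fin m)), k ≠ l →
      ‖y k - (q l - c)‖ < r := fun k hk l hl hkl => by
    rw [sub_sub_sub_cancel_right]
    exact norm_sub_expand hr (hx k hk) (hxl k hk l hl hkl)
  have ma : a ∈ ({a, a', b, b'} : Set (Fin m)) := by simp
  have ma' : a' ∈ ({a, a', b, b'} : Set (Fin m)) := by simp
  have mb : b ∈ ({a, a', b, b'} : Set (Fin m)) := by simp
  have mb' : b' ∈ ({a, a', b, b'} : Set (Fin m)) := by simp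
  exact SweepQuad.false (e := e) (r := r) (xa := y a) (xa' := y a') (xb := y b) (xb' := y b')
    { r_pos := hr0
      exit_a := hex a
      exit_a' := hex a'
      exit_b := hex b
      exit_b' := hex b'
      before_ab := hb hab.le
      before_a'b := hb ha'b.le
      before_bb' := hb hbb
      before_ab' := hb hab'.le
      before_a'b' := hb ha'b'.le
      before_aa' := (le_total a a').imp hb hb
      xa_a := hy a ma
      xa_a' := hyl a ma a' ma' hne
      xa_b := hyl a ma b mb hab.ne
      xa_b' := hyl a ma b' mb' hab'.ne
      xa'_a := hyl a' ma' a ma hne.symm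
      xa'_a' := hy a' ma'
      xa'_b := hyl a' ma' b mb ha'b.ne
      xa'_b' := hyl a' ma' b' mb' ha'b'.ne
      xb_a := hyl b mb a ma hab.ne'
      xb_a' := hyl b mb a' ma' ha'b.ne'
      xb_b := hy b mb
      xb_b' := hyl b mb b' mb' hne'
      xb'_a := hyl b' mb' a ma hab'.ne'
      xb'_a' := hyl b' mb' a' ma' ha'b'.ne'
      xb'_b := hyl b' mb' b mb hne'.symm
      xb'_b' := hy b' mb'
      cross := hc.sub_right c }

/-- The labels at four successive positions of the boundary do not alternate between lower ones and
higher ones. -/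
lemma IsBoundaryArcCycle.not_alternating [StrictConvexSpace ℝ E] {e : Module.Basis (Fin 2) ℝ E}
    {m n : ℕ} {q : Fin m → E} {c : E} {r θ₁ : ℝ} {β : Fin m → ℝ} {γ : ℝ → E}
    {label : Fin (n + 1) → Fin m} (h : IsBoundaryArcCycle q 1 n γ label)
    (hq : Function.Injective q) (hr : 1 < r) (hβ : ∀ i, β i ∈ Ico θ₁ (θ₁ + Real.pi / 2))
    (hex : ∀ i, IsExit e r (q i - c) (radialPoint e r (β i))) (hmono : Monotone β)
    {i : Fin 4 → Fin (n + 1)} (hi : StrictMono i) :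
    ¬ (max (label (i 0)) (label (i 2)) < min (label (i 1)) (label (i 3)) ∨
      max (label (i 1)) (label (i 3)) < min (label (i 0)) (label (i 2))) := by
  obtain ⟨x, hx, hxl, hc⟩ := h.crossing_labels one_pos hq hi
  have hinj : Function.Injective (label ∘ i) :=
    (h.label_injective e one_pos hq).comp hi.injective
  have : Nonempty (Fin 4) := ⟨0⟩
  -- The four boundary points, indexed by their labels instead of their positions.
  let y : Fin m → E := fun l => x (Function.invFun (label ∘ i) l)
  have hyk : ∀ k, y (label (i k)) = x k := fun k => by
    simp only [y]
    exact congrArg x (Function.leftInverse_invFun hinj k)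
  have hy : ∀ k, ‖y (label (i k)) - q (label (i k))‖ = 1 := fun k => by rw [hyk]; exact hx k
  have hyl : ∀ k l, label (i k) ≠ label (i l) → ‖y (label (i k)) - q (label (i l))‖ < 1 :=
    fun k l hkl => by rw [hyk]; exact hxl k l fun h => hkl (by rw [h])
  have h02 : label (i 0) ≠ label (i 2) := fun h => absurd (hinj h) (by decide)
  have h13 : label (i 1) ≠ label (i 3) := fun h => absurd (hinj h) (by decide)
  rintro (hlt | hlt)
  · simp only [max_lt_iff, lt_min_iff] at hlt
    refine not_crossing_of_exit hr hβ hex hmono hlt.1.1 hlt.1.2 hlt.2.1 hlt.2.2 (x := y) ?_ ?_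
      h02 h13 hc
    · rintro k (rfl | rfl | rfl | rfl) <;> exact hy _
    · rintro k (rfl | rfl | rfl | rfl) l (rfl | rfl | rfl | rfl) <;> exact hyl _ _
  · simp only [max_lt_iff, lt_min_iff] at hlt
    refine not_crossing_of_exit hr hβ hex hmono hlt.1.1 hlt.1.2 hlt.2.1 hlt.2.2 (x := y) ?_ ?_
      h13 h02 hc.swap
    · rintro k (rfl | rfl | rfl | rfl) <;> exact hy _
    · rintro k (rfl | rfl | rfl | rfl) l (rfl | rfl | rfl | rfl) <;> exact hyl _ _

end labels

/-! ### Cyclic sequences without alternation are unimodal. -/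

section unimodal

/-- If `i` were a local maximum other than the position `k` of the global one, then the values at `i
- 1`, `i`, `i + 1`, `k` would alternate between low and high. -/
lemma existsUnique_isCyclicLocalMax {n : ℕ} {α : Type*} [LinearOrder α] {a : Fin (n + 1) → α}
    (ha : Function.Injective a) (h : ∀ s t u v : Fin (n + 1), s < t → t < u → u < v →
      ¬ (max (a s) (a u) < min (a t) (a v) ∨ max (a t) (a v) < min (a s) (a u))) :
    ∃! i, IsCyclicLocalMax a i := by
  obtain ⟨k, hk⟩ := Finite.exists_max a
  refine ⟨k, ⟨hk _, hk _⟩, fun i hi => ?_⟩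
  by_contra hik
  have hlt : a i < a k := lt_of_le_of_ne (hk i) fun h => hik (ha h)
  have hn : n ≠ 0 := by
    rintro rfl
    exact hik (Fin.ext (by omega))
  have hk1 : i - 1 ≠ k := fun h => (hi.1.trans_lt hlt).ne (by rw [h])
  have hk2 : i + 1 ≠ k := fun h => (hi.2.trans_lt hlt).ne (by rw [h])
  have hv1 : (i + 1).val = if i.val = n then 0 else i.val + 1 := by
    rw [Fin.val_add_one]
    simp [Fin.ext_iff]
  have hv2 : (i - 1).val = if i.val = 0 then n else i.val - 1 := by
    rw [Fin.coe_sub_one]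
    simp only [Fin.ext_iff, Fin.val_zero]
  have hlt1 : a (i - 1) < a i := lt_of_le_of_ne hi.1 fun h => by
    have := congrArg Fin.val (ha h)
    split_ifs at hv2 <;> omega
  have hlt2 : a (i + 1) < a i := lt_of_le_of_ne hi.2 fun h => by
    have := congrArg Fin.val (ha h)
    split_ifs at hv1 <;> omega
  have hA : max (a (i + 1)) (a (i - 1)) < min (a i) (a k) := by
    simp only [max_lt_iff, lt_min_iff]
    exact ⟨⟨hlt2, hlt1⟩, hlt2.trans hlt, hlt1.trans hlt⟩
  have hki := fun h => hik (Fin.ext h)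
  have hk1' := fun h => hk1 (Fin.ext h)
  have hk2' := fun h => hk2 (Fin.ext h)
  have hkn := k.isLt
  have hin := i.isLt
  -- The four positions are in cyclic order; the cases say where the cut of `Fin (n + 1)` falls
  -- among them.
  by_cases h0 : i.val = 0
  · refine h i (i + 1) k (i - 1) ?_ ?_ ?_ (Or.inr hA) <;> rw [Fin.lt_def] <;>
      split_ifs at hv1 hv2 <;> omega
  by_cases h1 : i.val = n
  · rw [max_comm, min_comm] at hA
    refine h (i + 1) k (i - 1) i ?_ ?_ ?_ (Or.inl (by rwa [max_comm])) <;> rw [Fin.lt_def] <;>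
      split_ifs at hv1 hv2 <;> omega
  rcases lt_or_gt_of_ne hki with hlt' | hlt'
  · rw [max_comm] at hA
    refine h (i - 1) i (i + 1) k ?_ ?_ ?_ (Or.inl hA) <;> rw [Fin.lt_def] <;>
      split_ifs at hv1 hv2 <;> omega
  · rw [max_comm, min_comm] at hA
    refine h k (i - 1) i (i + 1) ?_ ?_ ?_ (Or.inr hA) <;> rw [Fin.lt_def] <;>
      split_ifs at hv1 hv2 <;> omega

lemma existsUnique_isCyclicLocalMin {n : ℕ} {α : Type*} [LinearOrder α] {a : Fin (n + 1) → α}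
    (ha : Function.Injective a) (h : ∀ s t u v : Fin (n + 1), s < t → t < u → u < v →
      ¬ (max (a s) (a u) < min (a t) (a v) ∨ max (a t) (a v) < min (a s) (a u))) :
    ∃! i, IsCyclicLocalMin a i :=
  existsUnique_isCyclicLocalMax (a := OrderDual.toDual ∘ a) (OrderDual.toDual.injective.comp ha)
    fun s t u v h1 h2 h3 h4 => h s t u v h1 h2 h3 h4.symm

lemma IsBoundaryArcCycle.unimodal {E : Type*} [NormedAddCommGroup E] [NormedSpace ℝ E]
    [StrictConvexSpace ℝ E] {e : Module.Basis (Fin 2) ℝ E}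
    {m n : ℕ} {q : Fin m → E} {c : E} {r θ₁ : ℝ} {β : Fin m → ℝ} {γ : ℝ → E}
    {label : Fin (n + 1) → Fin m} (h : IsBoundaryArcCycle q 1 n γ label)
    (hq : Function.Injective q) (hr : 1 < r) (hβ : ∀ i, β i ∈ Ico θ₁ (θ₁ + Real.pi / 2))
    (hex : ∀ i, IsExit e r (q i - c) (radialPoint e r (β i))) (hmono : Monotone β) :
    Function.Injective label ∧ (∃! i, IsCyclicLocalMax label i) ∧
      ∃! i, IsCyclicLocalMin label i := by
  have hinj := h.label_injective e one_pos hq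
  have key : ∀ s t u v : Fin (n + 1), s < t → t < u → u < v →
      ¬ (max (label s) (label u) < min (label t) (label v) ∨
        max (label t) (label v) < min (label s) (label u)) := by
    intro s t u v hst htu huv
    have hi : StrictMono ![s, t, u, v] := by
      rw [Fin.strictMono_iff_lt_succ]
      intro i
      fin_cases i <;> assumption
    exact h.not_alternating hq hr hβ hex hmono hi
  exact ⟨hinj, existsUnique_isCyclicLocalMax hinj key, existsUnique_isCyclicLocalMin hinj key⟩

end unimodal

/-! ### Moving the break points to the integers. -/

section reparametrization

/-- A broken line through prescribed values. -/
lemma exists_piecewise_linear (τ : ℕ → ℝ) (N : ℕ) : ∃ φ : ℝ → ℝ, Continuous φ ∧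
    (∀ k < N, ∀ t ∈ Icc (k : ℝ) (k + 1), φ t = τ k + (τ (k + 1) - τ k) * (t - k)) ∧
    ∀ t, (N : ℝ) ≤ t → φ t = τ N := by
  induction N with
  | zero => exact ⟨fun _ => τ 0, continuous_const, by simp, by simp⟩
  | succ N ih =>
    obtain ⟨φ, hc, hφ, hend⟩ := ih
    -- The added ramp vanishes up to `N` and is constant from `N + 1` on.
    refine ⟨fun t => φ t + (τ (N + 1) - τ N) * max 0 (min (t - N) 1), by fun_prop, ?_, ?_⟩
    · intro k hk t ht
      rcases (Nat.lt_succ_iff.1 hk).eq_or_lt with rfl | hk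
      · simp only [hend t ht.1]
        rw [min_eq_left (by linarith [ht.2]), max_eq_right (by linarith [ht.1])]
      · have h1 : (k : ℝ) + 1 ≤ N := by exact_mod_cast hk
        simp only [hφ k hk t ht]
        rw [max_eq_left ((min_le_left _ _).trans (by linarith [ht.2]))]
        ring
    · intro t ht
      push_cast at ht
      simp only [hend t (by linarith)]
      rw [min_eq_right (by linarith), max_eq_right zero_le_one]
      ring

/-- A simple closed curve can be reparametrized such that given successive points correspond to the
integers. -/
lemma exists_reparametrization {E : Type*} [TopologicalSpace E] {γ : ℝ → E} {T : ℝ} {n : ℕ}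
    {τ : ℕ → ℝ} (hT : 0 < T) (hc : Continuous γ) (hp : Function.Periodic γ T)
    (hi : InjOn γ (Ico 0 T)) (hτ : ∀ k < n + 1, τ k < τ (k + 1)) (hn : τ (n + 1) = τ 0 + T) :
    ∃ γ' : ℝ → E, Continuous γ' ∧ Function.Periodic γ' ((n : ℝ) + 1) ∧
      InjOn γ' (Ico 0 ((n : ℝ) + 1)) ∧ range γ' = range γ ∧
      ∀ k < n + 1, ∀ t ∈ Icc (k : ℝ) (k + 1), ∃ s ∈ Icc (τ k) (τ (k + 1)), γ' t = γ s := by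
  obtain ⟨φ, hφc, hφ, hend⟩ := exists_piecewise_linear τ (n + 1)
  push_cast at hend
  have hN : (0 : ℝ) < (n : ℝ) + 1 := by positivity
  have hmono : ∀ k l, k ≤ l → l ≤ n + 1 → τ k ≤ τ l := by
    intro k l hkl
    induction l, hkl using Nat.le_induction with
    | base => exact fun _ => le_rfl
    | succ l hkl ih => exact fun h => (ih (by omega)).trans (hτ l (by omega)).le
  have hmem : ∀ k < n + 1, ∀ t ∈ Icc (k : ℝ) (k + 1), φ t ∈ Icc (τ k) (τ (k + 1)) := by
    intro k hk t ht
    have h := hτ k hk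
    rw [hφ k hk t ht]
    constructor <;> nlinarith [ht.1, ht.2]
  have hfl : ∀ t ∈ Ico (0 : ℝ) (n + 1), ∃ k < n + 1, t ∈ Ico (k : ℝ) (k + 1) := fun t ht =>
    ⟨⌊t⌋₊, by
      rw [Nat.floor_lt ht.1]
      exact_mod_cast ht.2, Nat.floor_le ht.1, Nat.lt_floor_add_one t⟩
  have hlt : ∀ k < n + 1, ∀ t ∈ Ico (k : ℝ) (k + 1), φ t < τ (k + 1) := by
    intro k hk t ht
    have h := hτ k hk
    rw [hφ k hk t (Ico_subset_Icc_self ht)]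
    nlinarith [ht.1, ht.2]
  have hφ0 : φ 0 = τ 0 := by
    have := hφ 0 (by omega) 0 (by simp)
    simpa using this
  have hφN : φ (n + 1) = τ 0 + T := by rw [hend _ le_rfl, hn]
  have hrange : ∀ t ∈ Ico (0 : ℝ) (n + 1), φ t ∈ Ico (τ 0) (τ 0 + T) := fun t ht => by
    obtain ⟨k, hk, hkt⟩ := hfl t ht
    exact ⟨(hmono 0 k (by omega) (by omega)).trans (hmem k hk t (Ico_subset_Icc_self hkt)).1,
      (hlt k hk t hkt).trans_le ((hmono (k + 1) (n + 1) (by omega) le_rfl).trans hn.le)⟩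
  have hstrict : ∀ s ∈ Ico (0 : ℝ) (n + 1), ∀ t ∈ Ico (0 : ℝ) (n + 1), s < t → φ s < φ t := by
    intro s hs t ht hst
    obtain ⟨k, hk, hks⟩ := hfl s hs
    obtain ⟨l, hl, hlt'⟩ := hfl t ht
    have hkl : k ≤ l := by
      have : (k : ℝ) < l + 1 := by linarith [hks.1, hlt'.2]
      have : k < l + 1 := by exact_mod_cast this
      omega
    rcases hkl.eq_or_lt with rfl | hkl
    · rw [hφ k hk s (Ico_subset_Icc_self hks), hφ k hk t (Ico_subset_Icc_self hlt')]
      have := hτ k hk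
      nlinarith
    · exact (hlt k hk s hks).trans_le ((hmono (k + 1) l hkl hl.le).trans
        (hmem l hl t (Ico_subset_Icc_self hlt')).1)
  have : Fact (0 < (n : ℝ) + 1) := ⟨hN⟩
  have h0 : (γ ∘ φ) 0 = (γ ∘ φ) ((n : ℝ) + 1) := by
    simp only [Function.comp, hφ0, hφN, hp (τ 0)]
  -- Since `φ` is constant beyond `n + 1`, one period of `γ ∘ φ` is extended periodically through
  -- the circle.
  let γ' : ℝ → E := fun t => AddCircle.liftIco ((n : ℝ) + 1) 0 (γ ∘ φ) (t : AddCircle ((n : ℝ) + 1))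
  have hγ' : ∀ t ∈ Ico (0 : ℝ) (n + 1), γ' t = γ (φ t) := fun t ht =>
    AddCircle.liftIco_zero_coe_apply ht
  have hper : Function.Periodic γ' ((n : ℝ) + 1) := fun t => by
    simp only [γ', AddCircle.coe_add_period]
  have hend' : γ' (n + 1) = γ (φ (n + 1)) := by
    have := hper 0
    rw [zero_add] at this
    rw [this, hγ' 0 ⟨le_rfl, hN⟩]
    exact h0
  refine ⟨γ', (AddCircle.liftIco_zero_continuous h0 (hc.comp hφc).continuousOn).comp
    (AddCircle.continuous_mk' _), hper, ?_, ?_, ?_⟩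
  · intro s hs t ht hst
    rw [hγ' s hs, hγ' t ht] at hst
    by_contra hne
    rcases lt_or_gt_of_ne hne with h | h
    · exact eq_of_periodic_injOn hT hp hi (hstrict s hs t ht h)
        (by linarith [(hrange s hs).1, (hrange t ht).2]) hst
    · exact eq_of_periodic_injOn hT hp hi (hstrict t ht s hs h)
        (by linarith [(hrange t ht).1, (hrange s hs).2]) hst.symm
  · refine Subset.antisymm ?_ ?_
    · rintro _ ⟨t, rfl⟩
      obtain ⟨s, hs, hst⟩ := hper.exists_mem_Ico₀ hN t
      rw [hst, hγ' s hs]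
      exact ⟨_, rfl⟩
    · rintro _ ⟨x, rfl⟩
      obtain ⟨y, hy, hxy⟩ := hp.exists_mem_Ico hT x (τ 0)
      obtain ⟨t, ht, hty⟩ := intermediate_value_Icc hN.le hφc.continuousOn
        (show y ∈ Icc (φ 0) (φ (n + 1)) by rw [hφ0, hφN]; exact Ico_subset_Icc_self hy)
      have htN : t ≠ n + 1 := by
        rintro rfl
        rw [hφN] at hty
        linarith [hy.2]
      exact ⟨t, by rw [hxy, ← hty, hγ' t ⟨ht.1, lt_of_le_of_ne ht.2 htN⟩]⟩
  · intro k hk t ht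
    refine ⟨φ t, hmem k hk t ht, ?_⟩
    have h1 : (k : ℝ) + 1 ≤ n + 1 := by exact_mod_cast hk
    rcases (ht.2.trans h1).eq_or_lt with rfl | h
    · exact hend'
    · exact hγ' t ⟨(Nat.cast_nonneg k).trans ht.1, h⟩

end reparametrization

/-! ### Cutting a period into maximal labelled intervals. -/

section labelling

variable {j : ℕ} {L : Fin j → Set ℝ} {T : ℝ}

/-- The open interval is connected and covered by the disjoint open sets `interior (L i)`, so one of
them contains it. -/
lemma exists_Icc_subset_of_Ioo (hcl : ∀ i, IsClosed (L i))
    (hdis : ∀ i k, i ≠ k → Disjoint (interior (L i)) (interior (L k))) {s t : ℝ} (hst : s < t)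
    (h : ∀ x ∈ Ioo s t, ∃ i, L i ∈ nhds x) : ∃ i, Icc s t ⊆ L i := by
  obtain ⟨x, hx⟩ := exists_between hst
  obtain ⟨i, hi⟩ := h x hx
  refine ⟨i, ?_⟩
  have hsub : Ioo s t ⊆ interior (L i) := by
    refine isPreconnected_Ioo.subset_left_of_subset_union isOpen_interior
      (v := ⋃ k ∈ {k | i ≠ k}, interior (L k)) (isOpen_biUnion fun _ _ => isOpen_interior)
      (disjoint_iUnion₂_right.2 fun k hk => hdis i k hk) ?_
      ⟨x, hx, mem_interior_iff_mem_nhds.2 hi⟩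
    intro y hy
    obtain ⟨k, hk⟩ := h y hy
    by_cases hik : i = k
    · exact Or.inl (hik ▸ mem_interior_iff_mem_nhds.2 hk)
    · exact Or.inr (mem_biUnion hik (mem_interior_iff_mem_nhds.2 hk))
  rw [← closure_Ioo hst.ne]
  exact closure_minimal (hsub.trans interior_subset) (hcl i)

/-- A periodic covering of the line by finitely many closed sets, any two of which meet in finitely
many points of a period, partitions a period into finitely many maximal intervals. -/
lemma exists_cyclic_labelling (hT : 0 < T) (hcl : ∀ i, IsClosed (L i)) (hcov : ∀ x, ∃ i, x ∈ L i)
    (hper : ∀ i x, x + T ∈ L i ↔ x ∈ L i)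
    (hfin : ∀ a i k, i ≠ k → (L i ∩ L k ∩ Ico a (a + T)).Finite) :
    ∃ (n : ℕ) (τ : ℕ → ℝ) (label : Fin (n + 1) → Fin j), (∀ k < n + 1, τ k < τ (k + 1)) ∧
      τ (n + 1) = τ 0 + T ∧
      (∀ k : Fin (n + 1), Icc (τ k) (τ ((k : ℕ) + 1)) ⊆ L (label k)) ∧
      (0 < n → ∀ k, label k ≠ label (k + 1)) := by
  have hdis : ∀ i k, i ≠ k → Disjoint (interior (L i)) (interior (L k)) := by
    intro i k hik
    rw [disjoint_left]
    intro x hi hk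
    have h1 : L i ∩ L k ∈ nhds x := Filter.inter_mem (mem_interior_iff_mem_nhds.1 hi)
      (mem_interior_iff_mem_nhds.1 hk)
    obtain ⟨u, hu, hsub⟩ := exists_Ico_subset_of_mem_nhds h1 ⟨x + T, by linarith⟩
    have hlt : x < min u (x + T) := lt_min hu (by linarith)
    exact (Ico_infinite hlt) ((hfin x i k hik).subset fun y hy =>
      ⟨hsub ⟨hy.1, hy.2.trans_le (min_le_left _ _)⟩, hy.1, hy.2.trans_le (min_le_right _ _)⟩)
  -- The break points: the points at which no single label is valid on both sides.
  let B : Set ℝ := {x | ∀ i, L i ∉ nhds x}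
  have hBD : B ⊆ ⋃ i, ⋃ k ∈ {k | i ≠ k}, L i ∩ L k := by
    intro x hx
    obtain ⟨i, hi⟩ := hcov x
    have h1 : x ∈ closure (L i)ᶜ := by
      rw [closure_compl, mem_compl_iff, mem_interior_iff_mem_nhds]
      exact hx i
    have h2 : (L i)ᶜ ⊆ ⋃ k ∈ {k | i ≠ k}, L k := fun y hy => by
      obtain ⟨k, hk⟩ := hcov y
      exact mem_biUnion (show i ≠ k by rintro rfl; exact hy hk) hk
    have h3 := closure_minimal h2 (Set.Finite.isClosed_biUnion (toFinite _) fun k _ => hcl k) h1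
    obtain ⟨k, hk, hxk⟩ := mem_iUnion₂.1 h3
    exact mem_iUnion.2 ⟨i, mem_biUnion hk ⟨hi, hxk⟩⟩
  have hBfin : ∀ a, (B ∩ Ico a (a + T)).Finite := by
    intro a
    have : (⋃ i, ⋃ k ∈ {k | i ≠ k}, L i ∩ L k ∩ Ico a (a + T)).Finite :=
      finite_iUnion fun i => Set.Finite.biUnion (toFinite _) fun k hk => hfin a i k hk
    refine this.subset ?_
    rintro x ⟨hx, hxa⟩
    have := hBD hx
    simp only [mem_iUnion] at this ⊢
    obtain ⟨i, k, hik, h⟩ := this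
    exact ⟨i, k, hik, h, hxa⟩
  rcases B.eq_empty_or_nonempty with hB | ⟨τ₀, hτ₀⟩
  · obtain ⟨i, hi⟩ := exists_Icc_subset_of_Ioo hcl hdis hT fun x _ => by
      by_contra! h
      exact (hB ▸ (show x ∈ B from h) : x ∈ (∅ : Set ℝ))
    refine ⟨0, fun k => k * T, fun _ => i, fun k hk => ?_, by simp, fun k => ?_, by simp⟩
    · push_cast
      linarith
    · have : (k : ℕ) = 0 := by omega
      simpa [this] using hi
  · set F := (hBfin τ₀).toFinset with hF
    have hmemF : ∀ x, x ∈ F ↔ x ∈ B ∧ x ∈ Ico τ₀ (τ₀ + T) := fun x => by simp [hF]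
    have h0F : τ₀ ∈ F := (hmemF τ₀).2 ⟨hτ₀, le_rfl, by linarith⟩
    obtain ⟨n, hn⟩ : ∃ n, F.card = n + 1 := Nat.exists_eq_succ_of_ne_zero
      (Finset.card_ne_zero_of_mem h0F)
    let σ := F.orderEmbOfFin hn
    have hσF : ∀ k, σ k ∈ F := fun k => F.orderEmbOfFin_mem hn k
    have hσr : ∀ x ∈ F, ∃ k, σ k = x := fun x hx => by
      have : x ∈ range σ := by
        rw [F.range_orderEmbOfFin hn]
        exact hx
      exact this
    -- The break points of the period starting at the break point `τ₀`, in increasing order, closed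
    -- up by `τ₀ + T`.
    let τ : ℕ → ℝ := fun k => if h : k < n + 1 then σ ⟨k, h⟩ else τ₀ + T
    have hτσ : ∀ k : Fin (n + 1), τ k = σ k := fun k => by
      simp only [τ, dif_pos k.isLt]
    have hτn : τ (n + 1) = τ₀ + T := by simp [τ]
    have hτ0 : τ 0 = τ₀ := by
      have h1 : τ 0 = σ 0 := hτσ 0
      obtain ⟨k, hk⟩ := hσr τ₀ h0F
      rw [h1]
      refine le_antisymm ?_ ((hmemF _).1 (hσF 0)).2.1
      rw [← hk]
      exact σ.monotone (Fin.zero_le k)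
    have hτlt : ∀ k < n + 1, τ k < τ (k + 1) := by
      intro k hk
      rw [hτσ ⟨k, hk⟩]
      by_cases h : k + 1 < n + 1
      · rw [hτσ ⟨k + 1, h⟩]
        exact σ.strictMono (by simp [Fin.lt_def])
      · have : k + 1 = n + 1 := by omega
        rw [this, hτn]
        exact ((hmemF _).1 (hσF _)).2.2
    have hgap : ∀ k : Fin (n + 1), ∃ i, Icc (τ k) (τ ((k : ℕ) + 1)) ⊆ L i := by
      intro k
      refine exists_Icc_subset_of_Ioo hcl hdis (hτlt k k.isLt) fun x hx => ?_
      by_contra! hxB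
      have hxF : x ∈ F := by
        refine (hmemF x).2 ⟨hxB, ?_, ?_⟩
        · exact (((hmemF _).1 (hσF k)).2.1.trans (hτσ k).ge).trans hx.1.le
        · by_cases h : (k : ℕ) + 1 < n + 1
          · exact hx.2.trans (((hτσ ⟨_, h⟩).le).trans_lt ((hmemF _).1 (hσF _)).2.2)
          · have : (k : ℕ) + 1 = n + 1 := by omega
            rw [this, hτn] at hx
            exact hx.2
      obtain ⟨l, rfl⟩ := hσr x hxF
      rw [hτσ k] at hx
      have h1 : k < l := σ.lt_iff_lt.1 hx.1
      by_cases h : (k : ℕ) + 1 < n + 1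
      · have h2 := hx.2
        rw [hτσ ⟨_, h⟩] at h2
        have h3 := σ.lt_iff_lt.1 h2
        rw [Fin.lt_def] at h1 h3
        simp only at h3
        omega
      · rw [Fin.lt_def] at h1
        omega
    choose label hlabel using hgap
    refine ⟨n, τ, label, hτlt, by rw [hτn, hτ0], hlabel, fun _ k hk => ?_⟩
    have hnhds : ∀ {i : Fin j} {x y z : ℝ}, x < y → y < z → Icc x y ⊆ L i → Icc y z ⊆ L i →
        L i ∈ nhds y := fun {i x y z} hxy hyz h1 h2 => by
      refine Filter.mem_of_superset (Icc_mem_nhds hxy hyz) ?_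
      rw [← Icc_union_Icc_eq_Icc hxy.le hyz.le]
      exact union_subset h1 h2
    have h1 := hlabel k
    have h2 := hlabel (k + 1)
    rw [← hk] at h2
    by_cases h : (k : ℕ) + 1 < n + 1
    · have h3 : ((k + 1 : Fin (n + 1)) : ℕ) = k + 1 := by
        rw [Fin.val_add_one_of_lt']
        exact h
      rw [h3] at h2
      have h4 := ((hmemF _).1 (hσF ⟨k + 1, h⟩)).1
      rw [← hτσ ⟨k + 1, h⟩] at h4
      exact h4 (label k) (hnhds (hτlt _ k.isLt) (hτlt _ h) h1 h2)
    -- At the wrap-around the first interval is shifted by a period to meet the last one at `τ₀ +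
    -- T`. Equal labels there would contradict that `τ₀` is a break point.
    · have h3 : (k : ℕ) = n := by omega
      have h4 : ((k + 1 : Fin (n + 1)) : ℕ) = 0 := by
        rw [Fin.val_add_one, if_pos (Fin.ext (by simpa using h3))]
      rw [h4, hτ0] at h2
      rw [h3, hτn] at h1
      have h5 : τ n < τ₀ + T := hτn ▸ hτlt n (by omega)
      have h6 : τ₀ < τ 1 := hτ0 ▸ hτlt 0 (by omega)
      have h7 : L (label k) ∈ nhds (τ₀ + T) := hnhds h5 (z := τ 1 + T) (by linarith) h1
        fun x hx => by
          have := (hper (label k) (x - T)).2 (h2 ⟨by linarith [hx.1], by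
            rw [zero_add]
            linarith [hx.2]⟩)
          rwa [sub_add_cancel] at this
      refine hτ₀ (label k) ?_
      have h8 : L (label k) = (fun x => x + T) ⁻¹' L (label k) := by
        ext x
        exact (hper (label k) x).symm
      rw [h8]
      exact (continuous_add_const T).continuousAt.preimage_mem_nhds h7

end labelling

/-! ### The boundary as a simple closed curve of arcs. -/

section frontier

variable {E : Type*} [NormedAddCommGroup E] [NormedSpace ℝ E]

lemma exists_pos_smul_direction (e : Module.Basis (Fin 2) ℝ E) {v : E} (hv : v ≠ 0) :
    ∃ s : ℝ, 0 < s ∧ ∃ θ, v = s • direction e θ := by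
  let z : ℂ := ⟨e.repr v 0, e.repr v 1⟩
  have hz : v = ‖z‖ • direction e z.arg := by
    apply e.ext_elem
    intro i
    fin_cases i
    · simp [direction, z]
    · simp [direction, z]
  refine ⟨‖z‖, norm_pos_iff.2 fun h => hv ?_, z.arg, hz⟩
  rw [hz, h, norm_zero, zero_smul]

lemma direction_periodic (e : Module.Basis (Fin 2) ℝ E) :
    Function.Periodic (direction e) (2 * Real.pi) := fun t => by
  simp [direction]

lemma eq_of_smul_direction_eq (e : Module.Basis (Fin 2) ℝ E) {c d s t : ℝ} (hc : 0 < c)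
    (hd : 0 < d) (hst : |s - t| < 2 * Real.pi) (h : c • direction e s = d • direction e t) :
    s = t := by
  have h0 : c * Real.cos s = d * Real.cos t := by
    simpa [direction] using congrArg (fun v => e.repr v 0) h
  have h1 : c * Real.sin s = d * Real.sin t := by
    simpa [direction] using congrArg (fun v => e.repr v 1) h
  have hs := Real.sin_sq_add_cos_sq s
  have ht := Real.sin_sq_add_cos_sq t
  have hcd : c = d := by
    have : c ^ 2 = d ^ 2 := by
      calc c ^ 2 = (c * Real.cos s) ^ 2 + (c * Real.sin s) ^ 2 := by linear_combination -c ^ 2 * hs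
        _ = d ^ 2 := by rw [h0, h1]; linear_combination d ^ 2 * ht
    exact (pow_left_inj₀ hc.le hd.le two_ne_zero).1 this
  subst hcd
  have h2 := mul_left_cancel₀ hc.ne' h0
  have h3 := mul_left_cancel₀ hc.ne' h1
  have h4 : Real.cos (s - t) = 1 := by
    rw [Real.cos_sub, h2, h3]
    linarith
  rw [abs_lt] at hst
  rw [Real.cos_eq_one_iff_of_lt_of_lt (by linarith [hst.1]) hst.2] at h4
  linarith

/-- The frontier of a bounded convex set with non-empty interior in the plane is a simple closed
curve. -/
lemma exists_frontier_curve (e : Module.Basis (Fin 2) ℝ E) {Y : Set E} (hY : Convex ℝ Y)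
    (hb : Bornology.IsBounded Y) (hi : (interior Y).Nonempty) :
    ∃ γ : ℝ → E, Continuous γ ∧ Function.Periodic γ (2 * Real.pi) ∧
      InjOn γ (Ico 0 (2 * Real.pi)) ∧ range γ = frontier Y := by
  obtain ⟨o, ho⟩ := hi
  let Z : Set E := (fun v => o + v) ⁻¹' Y
  have hZ : Convex ℝ Z := hY.translate_preimage_right o
  have hZ0 : Z ∈ nhds (0 : E) :=
    (continuous_const_add o).continuousAt.preimage_mem_nhds
      (by simpa using mem_interior_iff_mem_nhds.1 ho)
  have hZb : Bornology.IsVonNBounded ℝ Z := by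
    rw [NormedSpace.isVonNBounded_iff]
    obtain ⟨R, hR⟩ := hb.subset_closedBall 0
    refine (isBounded_closedBall (x := (0 : E)) (r := R + ‖o‖)).subset fun v hv => ?_
    have h1 := hR hv
    rw [mem_closedBall_zero_iff] at h1 ⊢
    have h2 := norm_sub_le (o + v) o
    rw [add_sub_cancel_left] at h2
    linarith
  have hg : ∀ θ, 0 < gauge Z (direction e θ) := fun θ =>
    (gauge_pos (absorbent_nhds_zero hZ0) hZb).2 (direction_ne_zero e θ)
  have hgc := continuous_gauge hZ hZ0
  have hd := continuous_direction e
  have hfr : ∀ x, x ∈ frontier Y ↔ gauge Z (x - o) = 1 := fun x => by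
    rw [gauge_eq_one_iff_mem_frontier hZ hZ0]
    have h1 : frontier Z = (Homeomorph.addLeft o) ⁻¹' frontier Y :=
      ((Homeomorph.addLeft o).preimage_frontier Y).symm
    simp [h1]
  -- Radial projection from an interior point: the gauge of the translated set equals 1 exactly on
  -- its frontier.
  refine ⟨fun θ => o + (gauge Z (direction e θ))⁻¹ • direction e θ, ?_, fun θ => ?_, ?_, ?_⟩
  · exact continuous_const.add (((hgc.comp hd).inv₀ fun θ => (hg θ).ne').smul hd)
  · simp only [direction_periodic e θ]
  · intro s hs t ht hst
    refine eq_of_smul_direction_eq e (inv_pos.2 (hg s)) (inv_pos.2 (hg t)) ?_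
      (add_left_cancel hst)
    rw [abs_lt]
    constructor <;> linarith [hs.1, hs.2, ht.1, ht.2]
  · ext x
    rw [hfr]
    constructor
    · rintro ⟨θ, rfl⟩
      simp only [add_sub_cancel_left]
      rw [gauge_smul_of_nonneg (inv_pos.2 (hg θ)).le, smul_eq_mul, inv_mul_cancel₀ (hg θ).ne']
    · intro hx
      have hne : x - o ≠ 0 := fun h => by
        rw [h, gauge_zero] at hx
        exact zero_ne_one hx
      obtain ⟨s, hs, θ, hθ⟩ := exists_pos_smul_direction e hne
      refine ⟨θ, ?_⟩
      rw [hθ, gauge_smul_of_nonneg hs.le, smul_eq_mul] at hx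
      simp only
      rw [← eq_inv_of_mul_eq_one_left hx, ← hθ, add_sub_cancel]

lemma exists_isBoundaryArcCycle [StrictConvexSpace ℝ E] (e : Module.Basis (Fin 2) ℝ E) {j : ℕ}
    {q : Fin j → E} {ρ : ℝ} (hρ : 0 < ρ) (hq : Function.Injective q) (hj : 1 ≤ j)
    (hint : (interior (ballInter (range q) ρ)).Nonempty) :
    ∃ (n : ℕ) (γ : ℝ → E) (label : Fin (n + 1) → Fin j), IsBoundaryArcCycle q ρ n γ label := by
  have hconv : Convex ℝ (ballInter (range q) ρ) :=
    convex_iInter₂ fun x _ => convex_closedBall x ρ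
  have hT := Real.two_pi_pos
  obtain ⟨γ, hc, hp, hi, hr⟩ := exists_frontier_curve e hconv
    (isBounded_ballInter_range (⟨0, hj⟩ : Fin j)) hint
  -- The parameters on each circle form a closed periodic set. These sets cover the line, and two of
  -- them share finitely many points of a period because two circles do.
  obtain ⟨n, τ, label, hτ, hn, hL, hne⟩ := exists_cyclic_labelling
    (L := fun i => γ ⁻¹' sphere (q i) ρ) hT (fun i => isClosed_sphere.preimage hc)
    (fun x => by
      have hx : γ x ∈ frontier (ballInter (range q) ρ) := hr ▸ mem_range_self x
      obtain ⟨i, hi⟩ := ((mem_frontier_ballInter hρ.ne').1 hx).2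
      exact ⟨i, mem_sphere_iff_norm.2 hi⟩)
    (fun i x => by rw [mem_preimage, mem_preimage, hp x])
    (fun a i k hik => by
      refine Finite.of_finite_image ((finite_sphere_inter_sphere e (hq.ne hik) ρ).subset
        (image_subset_iff.2 fun x hx => hx.1)) fun s hs t ht hst => ?_
      by_contra hne
      rcases lt_or_gt_of_ne hne with h | h
      · exact eq_of_periodic_injOn hT hp hi h (by linarith [hs.2.1, ht.2.2]) hst
      · exact eq_of_periodic_injOn hT hp hi h (by linarith [ht.2.1, hs.2.2]) hst.symm)
  obtain ⟨γ', hc', hp', hi', hr', hγ'⟩ := exists_reparametrization hT hc hp hi hτ hn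
  refine ⟨n, γ', label, hc', hp', hi', hr'.trans hr, fun i t ht => ?_, hne⟩
  obtain ⟨s, hs, hst⟩ := hγ' i i.isLt t ht
  rw [hst]
  exact hL i hs

end frontier

theorem lemma4p3 {E : Type*} [NormedAddCommGroup E] [NormedSpace ℝ E] [StrictConvexSpace ℝ E]
    (b : Module.Basis (Fin 2) ℝ E) (K : Set E) (hK : K.Finite) (c : E) (hc : c ∈ K)
    (r : ℝ) (hr : 1 < r) (θ₁ : ℝ) (m : ℕ) (p : Fin m → E)
    (hp : IsAdditionOrder b K c r θ₁ p)
    (j : ℕ) (hj : 1 ≤ j) (hjm : j ≤ m)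
    (hint : (interior (ballInter (range fun i : Fin j => p (Fin.castLE hjm i)) 1)).Nonempty) :
    (∃ (n : ℕ) (γ : ℝ → E) (label : Fin (n + 1) → Fin j),
      IsBoundaryArcCycle (fun i : Fin j => p (Fin.castLE hjm i)) 1 n γ label) ∧
    ∀ (n : ℕ) (γ : ℝ → E) (label : Fin (n + 1) → Fin j),
      IsBoundaryArcCycle (fun i : Fin j => p (Fin.castLE hjm i)) 1 n γ label →
        Function.Injective label ∧
        (∃! i, IsCyclicLocalMax label i) ∧
        (∃! i, IsCyclicLocalMin label i) := by
  have hq : Function.Injective fun i : Fin j => p (Fin.castLE hjm i) :=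
    hp.injective.comp (Fin.castLE_injective hjm)
  refine ⟨exists_isBoundaryArcCycle b one_pos hq hj hint, fun n γ label h => ?_⟩
  -- Exit angles exist for the whole list; restricting them to its first `j` points keeps them
  -- monotone.
  obtain ⟨β, hβ, hex, hmono⟩ := hp.exists_exit_angles b (by linarith)
  exact h.unimodal (β := β ∘ Fin.castLE hjm) hq hr (fun i => hβ _) (fun i => hex _)
    (hmono.comp (Fin.strictMono_castLE hjm).monotone)
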